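/- **Setting.** For every sample size $n$ let $Z_n\in\mathbb R^{n\times p_{zn}}$ be a fixed matrix of instruments with rows $Z_i'$, centred and standardized ($\sum_i Z_{ih}=0$, $n^{-1}\sum_i Z_{ih}^2=1$), and consider the two-stage model $$X_{ij}=Z_i'\alpha_j+v_{ij}\quad(j=1,\dots,p_{xn}),\qquad Y_i=X_i'\beta_0+u_i,\qquad i=1,\dots,n,$$ where all quantities may depend on $n$. Put $\varepsilon_i=v_i'\beta_0+u_i$, $D_n=Z_n\alpha$ with entries $d_{ij}$, $\alpha=(\alpha_1,\dots,\alpha_{p_{xn}})$. Let $k_{xn}$ and $m_{xn}$ be the numbers of nonzero and zero coordinates of $\beta_0$, with $k_{xn}\ge1$ and $m_{xn}\ge2$, and $k_{znj}$ the number of nonzero coordinates of $\alpha_j$. Let $D_{1n}$ (with rows $d_{1i}'$) consist of the columns $j$ of $D_n$ with $\beta_{0j}\ne0$, and $Z_{1nj}$ (with rows $Z_{1ij}'$) of the columns $h$ of $Z_n$ with $\alpha_{hj}\neq0$; $\alpha_{1j}$, $\hat\alpha_{1j}$ are the corresponding parts of $\alpha_j$, $\hat\alpha_j$. Put $\Sigma_{1nj}=n^{-1}Z_{1nj}'Z_{1nj}$.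 Given a first-stage estimator $\hat\alpha$, an initial estimator $\tilde\beta_n$ and a tuning parameter $\lambda_{xn}$, let $\hat d_i=\hat\alpha'Z_i$, $w_{nj}=|\tilde\beta_{nj}|^{-1}$ (with $1/0=\infty$ and $\infty\cdot0=0$), and let the adaptive LASSO estimator $\hat\beta_n$ be any minimizer over $b\in\mathbb R^{p_{xn}}$ of $$L_n(b)=\tfrac12\sum_{i=1}^n(Y_i-\hat d_i'b)^2+\lambda_{xn}\sum_{j=1}^{p_{xn}}w_{nj}|b_j| .$$ **First-stage assumptions** (constants do not depend on $n$; deterministic conditions are required for all large $n$). - (A.1) For each $j$, $v_{1j},\dots,v_{nj}$ are i.i.d. with mean $0$ and variance in $(0,\infty)$. - (A.2) The eigenvalues of $n^{-1}Z_n'Z_n$ are positive and bounded above by a constant; those of all $\Sigma_{1nj}$ lie between two positive constants. - (A.3) There are constants $0<a_0<a_1<\infty$ with $a_0\le|\alpha_{hj}|\le a_1$ whenever $\alpha_{hj}\ne0$. - (A.4) $\hat\alpha$ is model selection consistent, $P(\hat\alpha_{hj}=0\Leftrightarrow\alpha_{hj}=0\ \ \forall h,j)\to1$, and oracle efficient: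 $$\sqrt n\sum_j\delta_j'(\hat\alpha_{1j}-\alpha_{1j})=n^{-1/2}\sum_j\sum_{i=1}^n\delta_j'\Sigma_{1nj}^{-1}Z_{1ij}v_{ij}+o_p(1)$$ uniformly over all $\delta=(\delta_j)_j$ with $\sum_j\|\delta_j\|^2\le1$. **Assumptions D.1–D.6.** - (D.1) The vectors $(u_i,v_i)$, $i=1,\dots,n$, are i.i.d. with mean $0$ and finite variances, $\mathrm{Var}(u_i)=\sigma_u^2\in(0,\infty)$; they are jointly sub-Gaussian (all linear combinations with coefficient vector in the unit ball are sub-Gaussian with one common constant); and for a $d\in[1,2]$ and constants $K,C>0$, $P(|\varepsilon_i|>x)\le K\exp(-Cx^d)$ for all $x\ge0$, all $i$ and $n$. - (D.2) $\tilde\beta_n$ is zero-consistent with rate $r_n\to\infty$: $r_n\max_{j:\beta_{0j}=0}|\tilde\beta_{nj}|=O_p(1)$, and there is a constant $\xi_b>0$ such that for every $\epsilon>0$, $P(\min_{j:\beta_{0j}\ne0}|\tilde\beta_{nj}|\ge\xi_bb_1)>1-\epsilon$ for all large $n$, with $b_1$ as in (D.3). - (D.3) There are constants $0<b_0<b_1<\infty$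 with $b_0\le|\beta_{0j}|\le b_1$ whenever $\beta_{0j}\neq0$. - (D.4) $\lambda_{xn}\to\infty$; $\lambda_{xn}k_{xn}/\sqrt n\to0$; $p_{xn}^2k_{xn}\max_jk_{znj}/n\to0$; $\lambda_{xn}k_{xn}/n\to0$; $k_{xn}^2/r_n\to0$; and, if $1<d\le2$, $$\frac{(\log k_{xn})^{1/d}}{\sqrt n}\to0,\qquad\frac{\sqrt n(\log m_{xn})^{1/d}}{\lambda_{xn}r_n}\to0,$$ if $d=1$, $$\frac{(\log n)(\log k_{xn})}{\sqrt n}\to0,\qquad\frac{\sqrt n(\log n)(\log m_{xn})}{\lambda_{xn}r_n}\to0 .$$ - (D.5) The eigenvalues of $n^{-1}D_{1n}'D_{1n}$ and those of $n^{-1}D_n'D_n$ lie between two positive constants, and $n^{-1/2}\max_{1\le i\le n}d_{1i}'d_{1i}\to0$. - (D.6) The instruments are bounded in probability: for every $\eta>0$ there is an $M$ such that, for all large $n$ and all $h$, at most $\eta n$ of the values $Z_{1h},\dots,Z_{nh}$ exceed $M$ in absolute value. **Theorem.** Under (A.1)–(A.4) and (D.1)–(D.6), the adaptive LASSO estimator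 is sign consistent: $P(\mathrm{sgn}(\hat\beta_n)=\mathrm{sgn}(\beta_0))\to1$, with the sign taken coordinatewise. -/

import Mathlib

open MeasureTheory ProbabilityTheory Filter Topology
open scoped NNReal Matrix

noncomputable section

/-- The data of a triangular array of two-stage linear models, for every sample size `n`:
`p n` second-stage covariates, `q n` fixed instruments `Z n`, first-stage coefficients `α n`
(column `j` belongs to covariate `j`), second-stage coefficients `β₀ n`, second-stage errors `u`,
first-stage errors `v`, a first-stage estimator `alphaHat` of `α`, an initial estimator
`betaTilde` of `β₀`, and a tuning parameter `lam`. -/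
structure TwoStageModel (Ω : Type*) where
  p : ℕ → ℕ
  q : ℕ → ℕ
  Z : (n : ℕ) → Matrix (Fin n) (Fin (q n)) ℝ
  α : (n : ℕ) → Matrix (Fin (q n)) (Fin (p n)) ℝ
  β₀ : (n : ℕ) → Fin (p n) → ℝ
  u : (n : ℕ) → Fin n → Ω → ℝ
  v : (n : ℕ) → Fin n → Fin (p n) → Ω → ℝ
  alphaHat : (n : ℕ) → Ω → Matrix (Fin (q n)) (Fin (p n)) ℝ
  betaTilde : (n : ℕ) → Ω → Fin (p n) → ℝ
  lam : ℕ → ℝ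

/-- The Gram matrix `n⁻¹ AᵀA` of a matrix with `n` rows. -/
def gram {n : ℕ} {ι : Type*} (A : Matrix (Fin n) ι ℝ) : Matrix ι ι ℝ :=
  (n : ℝ)⁻¹ • (Aᵀ * A)

namespace TwoStageModel

variable {Ω : Type*} (S : TwoStageModel Ω)

/-- The covariates, `X_ij = Z_i'α_j + v_ij`. -/
def X (n : ℕ) (ω : Ω) : Matrix (Fin n) (Fin (S.p n)) ℝ :=
  fun i j => (S.Z n * S.α n) i j + S.v n i j ω

/-- The outcome, `Y_i = X_i'β₀ + u_i`. -/
def Y (n : ℕ) (ω : Ω) (i : Fin n) : ℝ :=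
  ∑ j, S.X n ω i j * S.β₀ n j + S.u n i ω

/-- The composite error, `ε_i = v_i'β₀ + u_i`. -/
def eps (n : ℕ) (i : Fin n) (ω : Ω) : ℝ :=
  ∑ j, S.v n i j ω * S.β₀ n j + S.u n i ω

/-- The conditional means of the covariates given the instruments, `D = Zα`. -/
def D (n : ℕ) : Matrix (Fin n) (Fin (S.p n)) ℝ := S.Z n * S.α n

/-- The estimated conditional means, `Zα̂`. -/
def DHat (n : ℕ) (ω : Ω) : Matrix (Fin n) (Fin (S.p n)) ℝ := S.Z n * S.alphaHat n ω

/-- The columns of `D` that belong to the relevant covariates. -/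
def D₁ (n : ℕ) : Matrix (Fin n) {j : Fin (S.p n) // S.β₀ n j ≠ 0} ℝ :=
  (S.D n).submatrix id Subtype.val

/-- The columns of `Z` that belong to the instruments relevant for covariate `j`. -/
def Z₁ (n : ℕ) (j : Fin (S.p n)) : Matrix (Fin n) {h : Fin (S.q n) // S.α n h j ≠ 0} ℝ :=
  (S.Z n).submatrix id Subtype.val

/-- The number of relevant covariates. -/
def k (n : ℕ) : ℕ := (Finset.univ.filter fun j => S.β₀ n j ≠ 0).card

/-- The number of irrelevant covariates. -/
def m (n : ℕ) : ℕ := (Finset.univ.filter fun j => S.β₀ n j = 0).card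

/-- The largest number of relevant instruments of a covariate. -/
def kzMax (n : ℕ) : ℕ :=
  Finset.univ.sup fun j => (Finset.univ.filter fun h => S.α n h j ≠ 0).card

/-! ### The adaptive LASSO -/

/-- The loss `½ ∑ (Y_i - d̂_i'b)² + λ ∑ |β̃_j|⁻¹ |b_j|`. -/
def loss (n : ℕ) (ω : Ω) (b : Fin (S.p n) → ℝ) : ℝ :=
  (1 / 2) * ∑ i, (S.Y n ω i - ∑ j, S.DHat n ω i j * b j) ^ 2
    + S.lam n * ∑ j, |S.betaTilde n ω j|⁻¹ * |b j|

/-- The vectors `b` of finite loss: where `β̃_j = 0` the weight `|β̃_j|⁻¹` is infinite (not `0`,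
the value of `0⁻¹` in Lean), so that `b_j` has to vanish. -/
def Feasible (n : ℕ) (ω : Ω) (b : Fin (S.p n) → ℝ) : Prop :=
  ∀ j, S.betaTilde n ω j = 0 → b j = 0

/-- `b` is an adaptive LASSO estimate: a global minimizer of the loss. -/
def IsAdaptiveLasso (n : ℕ) (ω : Ω) (b : Fin (S.p n) → ℝ) : Prop :=
  S.Feasible n ω b ∧ ∀ b', S.Feasible n ω b' → S.loss n ω b ≤ S.loss n ω b'

/-! ### Assumptions on the instruments and the first stage -/

/-- The instruments are centred and standardized. -/
def StandardizedInstruments : Prop :=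
  ∀ᶠ n in atTop, ∀ h, ∑ i, S.Z n i h = 0 ∧ (n : ℝ)⁻¹ * ∑ i, S.Z n i h ^ 2 = 1

/-- The (fixed) instruments are bounded in probability, in the sense of their empirical
distributions: uniformly in `n` and `h`, all but a small fraction of the `Z_ih` are bounded. -/
def InstrumentsBoundedInProbability : Prop :=
  ∀ η : ℝ, 0 < η → ∃ M : ℝ, ∀ᶠ n in atTop, ∀ h,
    ((Finset.univ.filter fun i => M < |S.Z n i h|).card : ℝ) ≤ η * n

/-- The eigenvalues of the Gram matrix of all instruments are positive and bounded from above,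
those of the relevant instruments of each covariate are bounded away from `0` and `∞`. -/
def FirstStageEigenvalues : Prop :=
  (∃ ρ₂ : ℝ, ∀ᶠ n in atTop, ∀ μ ∈ spectrum ℝ (gram (S.Z n)), 0 < μ ∧ μ < ρ₂) ∧
  ∃ τ₁ τ₂ : ℝ, 0 < τ₁ ∧ τ₁ < τ₂ ∧
    ∀ᶠ n in atTop, ∀ j, ∀ μ ∈ spectrum ℝ (gram (S.Z₁ n j)), τ₁ < μ ∧ μ < τ₂

/-- The nonzero first-stage coefficients are bounded away from `0` and `∞`. -/
def FirstStageCoefficients : Prop :=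
  ∃ a₀ a₁ : ℝ, 0 < a₀ ∧ a₀ < a₁ ∧
    ∀ᶠ n in atTop, ∀ h j, S.α n h j ≠ 0 → a₀ ≤ |S.α n h j| ∧ |S.α n h j| ≤ a₁

/-- The remainder
`√n (α̂_1j - α_1j) - n^{-1/2} ∑_i Σ_1j⁻¹ Z_1ij v_ij` in the asymptotically linear representation
of the oracle estimator for the `j`-th equation, with `Σ_1j = n⁻¹ Z_1j'Z_1j`. -/
def oracleRemainder (n : ℕ) (ω : Ω) (j : Fin (S.p n)) :
    {h : Fin (S.q n) // S.α n h j ≠ 0} → ℝ :=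
  fun h => √(n : ℝ) * (S.alphaHat n ω h j - S.α n h j)
    - (√(n : ℝ))⁻¹ *
      ∑ i, ((gram (S.Z₁ n j))⁻¹ *ᵥ (fun h' => S.Z₁ n j i h')) h * S.v n i j ω

/-! ### Deterministic assumptions on the second stage -/

/-- The nonzero second-stage coefficients are bounded away from `0` and `∞`. -/
def SecondStageCoefficients (b₀ b₁ : ℝ) : Prop :=
  0 < b₀ ∧ b₀ < b₁ ∧
    ∀ᶠ n in atTop, ∀ j, S.β₀ n j ≠ 0 → b₀ ≤ |S.β₀ n j| ∧ |S.β₀ n j| ≤ b₁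

/-- The rate conditions on the dimensions, the tuning parameter and the rate `r` of the initial
estimator, for errors with tails of order `d`. -/
structure Rates (d : ℝ) (r : ℕ → ℝ) : Prop where
  lam_tendsto : Tendsto S.lam atTop atTop
  lam_k : Tendsto (fun n : ℕ => S.lam n * S.k n / √(n : ℝ)) atTop (𝓝 0)
  dims : Tendsto (fun n : ℕ => (S.p n : ℝ) ^ 2 * ((S.k n : ℝ) * S.kzMax n / n)) atTop (𝓝 0)
  lam_k' : Tendsto (fun n : ℕ => S.lam n * S.k n / n) atTop (𝓝 0)
  k_r : Tendsto (fun n : ℕ => (S.k n : ℝ) ^ 2 / r n) atTop (𝓝 0)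
  log_k : 1 < d →
    Tendsto (fun n : ℕ => Real.log (S.k n) ^ (1 / d) / √(n : ℝ)) atTop (𝓝 0)
  log_m : 1 < d →
    Tendsto (fun n : ℕ => √(n : ℝ) * Real.log (S.m n) ^ (1 / d) / (S.lam n * r n)) atTop (𝓝 0)
  log_k_one : d = 1 →
    Tendsto (fun n : ℕ => Real.log n * Real.log (S.k n) / √(n : ℝ)) atTop (𝓝 0)
  log_m_one : d = 1 →
    Tendsto (fun n : ℕ => √(n : ℝ) * Real.log n * Real.log (S.m n) / (S.lam n * r n))
      atTop (𝓝 0)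

/-- The eigenvalues of the Gram matrices of `D₁` and `D` are bounded away from `0` and `∞`, and
`n^{-1/2} max_i d_1i'd_1i → 0`. -/
structure SecondStageDesign : Prop where
  relevant : ∃ τ₁ τ₂ : ℝ, 0 < τ₁ ∧ τ₁ < τ₂ ∧
    ∀ᶠ n in atTop, ∀ μ ∈ spectrum ℝ (gram (S.D₁ n)), τ₁ < μ ∧ μ < τ₂
  full : ∃ ρ₁ ρ₂ : ℝ, 0 < ρ₁ ∧ ρ₁ < ρ₂ ∧
    ∀ᶠ n in atTop, ∀ μ ∈ spectrum ℝ (gram (S.D n)), ρ₁ < μ ∧ μ < ρ₂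
  rows : Tendsto (fun n : ℕ => (√(n : ℝ))⁻¹ * ⨆ i, ∑ j, S.D₁ n i j ^ 2) atTop (𝓝 0)

/-! ### Measurability and the first-stage estimator -/

variable [MeasurableSpace Ω] (P : Measure Ω)

/-- The estimators used in the construction are random variables. -/
def MeasurableEstimators : Prop :=
  (∀ n h j, Measurable fun ω => S.alphaHat n ω h j) ∧
  (∀ n j, Measurable fun ω => S.betaTilde n ω j)

/-- Model selection consistency of the first-stage estimator: with probability tending to one it
finds the nonzero coefficients of the matrix `α`. -/
def FirstStageSelectionConsistent : Prop :=
  Tendsto (fun n => P {ω | ∀ h j, S.alphaHat n ω h j = 0 ↔ S.α n h j = 0}) atTop (𝓝 1)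

/-- Oracle efficiency of the first-stage estimator: `√n δ'(α̂₁ - α₁)` equals the corresponding
linear term of the least squares estimator that knows the relevant instruments, up to a term that
tends to `0` in probability uniformly over all vectors `δ = (δ_j)_j` with `∑_j ‖δ_j‖² ≤ 1`. -/
def FirstStageOracleEfficient : Prop :=
  ∀ η : ℝ, 0 < η → Tendsto (fun n => P {ω |
    ∃ δ : (j : Fin (S.p n)) → {h : Fin (S.q n) // S.α n h j ≠ 0} → ℝ,
      ∑ j, ∑ h, δ j h ^ 2 ≤ 1 ∧ η ≤ |∑ j, ∑ h, δ j h * S.oracleRemainder n ω j h|})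
    atTop (𝓝 0)

/-! ### Assumptions on the errors -/

/-- The error vectors `(u_i, v_i)`, `i = 1, …, n`, are i.i.d. with mean zero and finite positive
variances, that of `u_i` being a constant. -/
structure ErrorsIID : Prop where
  measurable_u : ∀ n i, Measurable (S.u n i)
  measurable_v : ∀ n i j, Measurable (S.v n i j)
  indep : ∀ n, iIndepFun (fun (i : Fin n) ω => (S.u n i ω, fun j => S.v n i j ω)) P
  identDistrib : ∀ n (i i' : Fin n),
    IdentDistrib (fun ω => (S.u n i ω, fun j => S.v n i j ω))
      (fun ω => (S.u n i' ω, fun j => S.v n i' j ω)) P P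
  memLp_u : ∀ n i, MemLp (S.u n i) 2 P
  memLp_v : ∀ n i j, MemLp (S.v n i j) 2 P
  mean_u : ∀ n i, ∫ ω, S.u n i ω ∂P = 0
  mean_v : ∀ n i j, ∫ ω, S.v n i j ω ∂P = 0
  variance_u : ∃ σ2 : ℝ, 0 < σ2 ∧ ∀ n i, variance (S.u n i) P = σ2
  variance_v : ∀ n i j, 0 < variance (S.v n i j) P

/-- The error vectors `(u_i, v_i)` are jointly sub-Gaussian: all linear combinations with
coefficients in the unit ball are sub-Gaussian with one constant. -/
def JointlySubGaussian : Prop :=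
  ∃ c : ℝ≥0, ∀ n i (a₀ : ℝ) (a : Fin (S.p n) → ℝ), a₀ ^ 2 + ∑ j, a j ^ 2 ≤ 1 →
    HasSubgaussianMGF (fun ω => a₀ * S.u n i ω + ∑ j, a j * S.v n i j ω) c P

/-- The tail bound `P(|ε_i| > x) ≤ K exp(-C x^d)` for the composite errors. -/
def EpsTail (d : ℝ) : Prop :=
  ∃ K C : ℝ, 0 < K ∧ 0 < C ∧ ∀ n i (x : ℝ), 0 ≤ x →
    P.real {ω | x < |S.eps n i ω|} ≤ K * Real.exp (-C * x ^ d)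

/-! ### The initial estimator -/

/-- The initial estimator `β̃` is zero-consistent with rate `r_n → ∞`; `b₁` is the upper bound of
the nonzero coefficients. -/
def ZeroConsistent (r : ℕ → ℝ) (b₁ : ℝ) : Prop :=
  Tendsto r atTop atTop ∧
  (∀ η : ℝ, 0 < η → ∃ M : ℝ, ∀ᶠ n in atTop,
    P.real {ω | ∃ j, S.β₀ n j = 0 ∧ M < r n * |S.betaTilde n ω j|} ≤ η) ∧
  ∃ ξ : ℝ, 0 < ξ ∧ ∀ η : ℝ, 0 < η → ∀ᶠ n in atTop,
    1 - η < P.real {ω | ∀ j, S.β₀ n j ≠ 0 → ξ * b₁ ≤ |S.betaTilde n ω j|}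

end TwoStageModel

end

/-! Put `Γ = α̂ - α` and `Δ = Z Γ`, so that the fitted design is `D + Δ` and `Y = (D + Δ) β₀ + (ε -
Δ β₀)`. The first stage thus only perturbs the regressors and the noise of a weighted LASSO. The
perturbed design is still injective, so a vector satisfying the Karush-Kuhn-Tucker conditions is the
only minimizer (`weighted_lasso_unique`), and it suffices to exhibit one with the right signs. The
candidate is `β₀ + x`, where `x` lives on the support of `β₀` and solves the normal equations there
with the signs of `β₀` in the penalty. Good conditioning makes `x` smaller than `b₀`, so the signs
on the support are correct. It remains to bound the score of each irrelevant covariate by its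
weight, which is at least of order `λ r` because the initial estimator is small there.

No irrepresentability condition is available for these scores. Instead `sign_eq_of_lasso_minimizer`
tests the score against the combination `c` of regressors that gives the residual of covariate `j`
after projection on the relevant ones. Its norm is bounded and `D c` is orthogonal to `D x`, so the
main effect of `x` drops out. The penalty on the support contributes `λ √k`, which is negligible
against `λ r`.

Two leading terms are left, both to be controlled uniformly over the irrelevant covariates. The
noise `(D c)'ε` has tails of order `d`, so a union bound gives the order `√n (log m)^{1/d}`. The
cross term `(D c)'Δ β₀` needs more care: Cauchy-Schwarz would give `√(n p k)`, which the rates do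
not cover. The oracle representation turns it into a weighted sum of the errors `v` plus a remainder
controlled by the norm of the weights, and these weights have norm of order `n` if every instrument
is relevant for boundedly many covariates. This row sparsity is not assumed; it is deduced from the
eigenvalue bounds in `exists_card_row_support_le`.

Everything else is crude. By Markov's inequality `‖Γ‖` is of order `√(p/n)` in Frobenius norm, and
since `p √k` is small against `√n`, all further terms are of order `√n + λ √k`
(`exists_estimation_error_bound`), which `λ r` dominates. -/

/-! ### The Euclidean norm of a vector of real numbers -/

section Euclidean

variable {ι κ : Type*} [Fintype ι] [Fintype κ]

/-- The Euclidean norm of a function on a finite type. -/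
noncomputable def l2 (x : ι → ℝ) : ℝ := ‖WithLp.toLp 2 x‖

lemma l2_nonneg (x : ι → ℝ) : 0 ≤ l2 x := norm_nonneg _

lemma l2_sq (x : ι → ℝ) : l2 x ^ 2 = ∑ i, x i ^ 2 := by
  simp [l2, EuclideanSpace.norm_sq_eq]

lemma dotProduct_self_eq_l2_sq (x : ι → ℝ) : x ⬝ᵥ x = l2 x ^ 2 := by
  rw [l2_sq, dotProduct]
  exact Finset.sum_congr rfl fun i _ => by ring

lemma l2_add_le (x y : ι → ℝ) : l2 (x + y) ≤ l2 x + l2 y := by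
  simpa [l2] using norm_add_le (WithLp.toLp 2 x) (WithLp.toLp 2 y)

lemma l2_sub_le (x y : ι → ℝ) : l2 (x - y) ≤ l2 x + l2 y := by
  simpa [l2] using norm_sub_le (WithLp.toLp 2 x) (WithLp.toLp 2 y)

lemma l2_smul (c : ℝ) (x : ι → ℝ) : l2 (c • x) = |c| * l2 x := by
  simp [l2, norm_smul]

lemma l2_eq_zero {x : ι → ℝ} (h : l2 x = 0) : x = 0 := by
  simpa [l2] using h

lemma l2_le_of_sum_sq_le {x : ι → ℝ} {c : ℝ} (hc : 0 ≤ c) (h : ∑ i, x i ^ 2 ≤ c ^ 2) :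
    l2 x ≤ c := by
  rw [← l2_sq] at h
  exact le_of_sq_le_sq h hc

lemma abs_le_l2 (x : ι → ℝ) (i : ι) : |x i| ≤ l2 x := by
  refine abs_le_of_sq_le_sq ?_ (l2_nonneg x)
  rw [l2_sq]
  exact Finset.single_le_sum (f := fun i => x i ^ 2) (fun _ _ => sq_nonneg _) (Finset.mem_univ i)

lemma abs_dotProduct_le (x y : ι → ℝ) : |x ⬝ᵥ y| ≤ l2 x * l2 y := by
  refine abs_le_of_sq_le_sq ?_ (mul_nonneg (l2_nonneg x) (l2_nonneg y))
  rw [mul_pow, l2_sq, l2_sq]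
  exact Finset.sum_mul_sq_le_sq_mul_sq _ _ _

/-- A matrix and its transpose have the same operator norm: expand `‖Aᵀz‖² = z'A(Aᵀz)` and cancel
one factor. -/
lemma l2_transpose_mulVec_le {A : Matrix ι κ ℝ} {c : ℝ} (hc : 0 ≤ c)
    (h : ∀ y, l2 (A *ᵥ y) ≤ c * l2 y) (z : ι → ℝ) : l2 (Aᵀ *ᵥ z) ≤ c * l2 z := by
  have h1 : l2 (Aᵀ *ᵥ z) ^ 2 ≤ l2 z * (c * l2 (Aᵀ *ᵥ z)) := by
    rw [← dotProduct_self_eq_l2_sq]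
    have : (Aᵀ *ᵥ z) ⬝ᵥ (Aᵀ *ᵥ z) = z ⬝ᵥ (A *ᵥ (Aᵀ *ᵥ z)) := by
      rw [Matrix.dotProduct_mulVec z, ← Matrix.mulVec_transpose]
    rw [this]
    exact (le_abs_self _).trans ((abs_dotProduct_le _ _).trans
      (mul_le_mul_of_nonneg_left (h _) (l2_nonneg _)))
  rcases (l2_nonneg (Aᵀ *ᵥ z)).eq_or_lt with h0 | h0
  · rw [← h0]; exact mul_nonneg hc (l2_nonneg _)
  · nlinarith

lemma dotProduct_transpose_mulVec (A : Matrix ι κ ℝ) (y : κ → ℝ) (z : ι → ℝ) :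
    y ⬝ᵥ (Aᵀ *ᵥ z) = (A *ᵥ y) ⬝ᵥ z := by
  rw [Matrix.dotProduct_mulVec, Matrix.vecMul_transpose]

/-- Shifting the Gram matrix by `τ` shifts its spectrum into the nonnegative reals, so the
difference is positive semidefinite. The eigenvalue assumptions enter the argument only through this
bound and its upper counterpart. -/
lemma gram_lower_bound {n : ℕ} (hn : 0 < n) [DecidableEq κ] (A : Matrix (Fin n) κ ℝ) {τ : ℝ}
    (h : ∀ μ ∈ spectrum ℝ (gram A), τ ≤ μ) (y : κ → ℝ) :
    τ * n * l2 y ^ 2 ≤ l2 (A *ᵥ y) ^ 2 := by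
  have hH : (gram A).IsHermitian := by
    ext i j; simp [gram, Matrix.mul_apply, mul_comm]
  have hps : (gram A - algebraMap ℝ _ τ).PosSemidef := by
    rw [Matrix.posSemidef_iff_isHermitian_and_spectrum_nonneg]
    refine ⟨hH.sub ?_, ?_⟩
    · ext i j; simp [Matrix.algebraMap_matrix_apply, eq_comm]
    · rw [← spectrum.sub_singleton_eq]
      rintro _ ⟨μ, hμ, _, rfl, rfl⟩
      simpa using h μ hμ
  have h1 := hps.dotProduct_mulVec_nonneg y
  have hn' : (0 : ℝ) < n := by exact_mod_cast hn
  have h2 : star y ⬝ᵥ ((gram A - algebraMap ℝ _ τ) *ᵥ y)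
      = (n : ℝ)⁻¹ * l2 (A *ᵥ y) ^ 2 - τ * l2 y ^ 2 := by
    rw [Matrix.sub_mulVec, dotProduct_sub, gram, Matrix.smul_mulVec, dotProduct_smul,
      ← Matrix.mulVec_mulVec, star_trivial, dotProduct_transpose_mulVec,
      dotProduct_self_eq_l2_sq, Algebra.algebraMap_eq_smul_one, Matrix.smul_mulVec, Matrix.one_mulVec,
      dotProduct_smul, dotProduct_self_eq_l2_sq]
    rfl
  rw [h2] at h1
  have := mul_le_mul_of_nonneg_left (sub_nonneg.1 h1) hn'.le
  rw [mul_inv_cancel_left₀ hn'.ne'] at this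
  linarith

lemma gram_upper_bound {n : ℕ} (hn : 0 < n) [DecidableEq κ] (A : Matrix (Fin n) κ ℝ) {τ : ℝ}
    (h : ∀ μ ∈ spectrum ℝ (gram A), μ ≤ τ) (y : κ → ℝ) :
    l2 (A *ᵥ y) ^ 2 ≤ τ * n * l2 y ^ 2 := by
  have hH : (gram A).IsHermitian := by
    ext i j; simp [gram, Matrix.mul_apply, mul_comm]
  have hps : (algebraMap ℝ _ τ - gram A).PosSemidef := by
    rw [Matrix.posSemidef_iff_isHermitian_and_spectrum_nonneg]
    refine ⟨Matrix.IsHermitian.sub ?_ hH, ?_⟩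
    · ext i j; simp [Matrix.algebraMap_matrix_apply, eq_comm]
    · rw [← spectrum.singleton_sub_eq]
      rintro _ ⟨_, rfl, μ, hμ, rfl⟩
      simpa using h μ hμ
  have h1 := hps.dotProduct_mulVec_nonneg y
  have hn' : (0 : ℝ) < n := by exact_mod_cast hn
  have h2 : star y ⬝ᵥ ((algebraMap ℝ _ τ - gram A) *ᵥ y)
      = τ * l2 y ^ 2 - (n : ℝ)⁻¹ * l2 (A *ᵥ y) ^ 2 := by
    rw [Matrix.sub_mulVec, dotProduct_sub, gram, Matrix.smul_mulVec, dotProduct_smul,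
      ← Matrix.mulVec_mulVec, star_trivial, dotProduct_transpose_mulVec,
      dotProduct_self_eq_l2_sq, Algebra.algebraMap_eq_smul_one, Matrix.smul_mulVec, Matrix.one_mulVec,
      dotProduct_smul, dotProduct_self_eq_l2_sq]
    rfl
  rw [h2] at h1
  have := mul_le_mul_of_nonneg_left (sub_nonneg.1 h1) hn'.le
  rw [mul_inv_cancel_left₀ hn'.ne'] at this
  linarith

/-! ### Restricted least squares and the optimality conditions of the LASSO -/

/-- The normal equations of least squares with regressors restricted to a set `J`. -/
lemma exists_restricted_normal_equations (A : Matrix ι κ ℝ) (J : κ → Prop) {c : ℝ} (hc : 0 < c)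
    (hA : ∀ y : κ → ℝ, (∀ j, ¬ J j → y j = 0) → c * l2 y ^ 2 ≤ l2 (A *ᵥ y) ^ 2)
    (g : κ → ℝ) (hg : ∀ j, ¬ J j → g j = 0) :
    ∃ x : κ → ℝ, (∀ j, ¬ J j → x j = 0) ∧ (∀ j, J j → (Aᵀ *ᵥ (A *ᵥ x)) j = g j) ∧
      c * l2 x ≤ l2 g := by
  classical
  let R : (κ → ℝ) →ₗ[ℝ] (κ → ℝ) :=
    { toFun := fun x j => if J j then x j else 0
      map_add' := fun x y => by ext j; by_cases h : J j <;> simp [h]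
      map_smul' := fun a x => by ext j; by_cases h : J j <;> simp [h] }
  let B : (κ → ℝ) →ₗ[ℝ] (κ → ℝ) := (Aᵀ * A).mulVecLin
  -- The Gram operator compressed to `J`, completed by the identity off `J`. It acts on the whole
  -- space, so injectivity yields surjectivity without passing to a subtype.
  let T : (κ → ℝ) →ₗ[ℝ] (κ → ℝ) := R ∘ₗ B ∘ₗ R + (LinearMap.id - R)
  have hTJ : ∀ x j, J j → T x j = (Aᵀ *ᵥ (A *ᵥ R x)) j := by
    intro x j hj; simp [T, R, B, hj, -Matrix.mulVec_mulVec, Matrix.mulVec_transpose]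
  have hTn : ∀ x j, ¬ J j → T x j = x j := by
    intro x j hj; simp [T, R, hj]
  have hR : ∀ x : κ → ℝ, (∀ j, ¬ J j → x j = 0) → R x = x := by
    intro x hx; ext j; by_cases h : J j <;> simp [R, h, hx]
  have key : ∀ x : κ → ℝ, (∀ j, ¬ J j → x j = 0) → ∀ y : κ → ℝ,
      (∀ j, J j → (Aᵀ *ᵥ (A *ᵥ x)) j = y j) → l2 (A *ᵥ x) ^ 2 = x ⬝ᵥ y := by
    intro x hx y hy
    rw [← dotProduct_self_eq_l2_sq, ← dotProduct_transpose_mulVec]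
    refine Finset.sum_congr rfl fun j _ => ?_
    by_cases h : J j
    · rw [hy j h]
    · simp [hx j h]
  have hinj : Function.Injective T := by
    rw [← LinearMap.ker_eq_bot, LinearMap.ker_eq_bot']
    intro x hx
    have h0 : ∀ j, ¬ J j → x j = 0 := fun j hj => by rw [← hTn x j hj, hx]; rfl
    have h1 := key x h0 0 fun j hj => by
      have := hTJ x j hj
      rw [hR x h0, hx] at this
      exact this.symm
    have h2 := hA x h0
    rw [h1, dotProduct_zero] at h2
    have h3 : l2 x ^ 2 ≤ 0 := by nlinarith [sq_nonneg (l2 x)]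
    exact l2_eq_zero (by nlinarith [l2_nonneg x])
  obtain ⟨x, hx⟩ := LinearMap.injective_iff_surjective.1 hinj g
  have h0 : ∀ j, ¬ J j → x j = 0 := fun j hj => by rw [← hTn x j hj, hx, hg j hj]
  have h1 : ∀ j, J j → (Aᵀ *ᵥ (A *ᵥ x)) j = g j := fun j hj => by
    rw [← hx, hTJ x j hj, hR x h0]
  refine ⟨x, h0, h1, ?_⟩
  have h2 := key x h0 g h1
  have h3 := hA x h0
  have h4 := (le_abs_self _).trans (abs_dotProduct_le x g)
  rcases (l2_nonneg x).eq_or_lt with h5 | h5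
  · rw [← h5, mul_zero]; exact l2_nonneg g
  · nlinarith

/-- A vector that satisfies the Karush-Kuhn-Tucker conditions of a weighted LASSO problem with
injective design is its only minimizer. Coordinates of infinite weight are those with `T j = 0`. -/
lemma weighted_lasso_unique (A : Matrix ι κ ℝ) (Y : ι → ℝ) (T : κ → ℝ) {lam : ℝ}
    (hA : ∀ y, A *ᵥ y = 0 → y = 0) (hlam : 0 ≤ lam) (b b' : κ → ℝ)
    (hb₁ : ∀ j, b j ≠ 0 → (Aᵀ *ᵥ (Y - A *ᵥ b)) j = lam * |T j|⁻¹ * SignType.sign (b j))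
    (hb₀ : ∀ j, b j = 0 → T j ≠ 0 → |(Aᵀ *ᵥ (Y - A *ᵥ b)) j| ≤ lam * |T j|⁻¹)
    (hb' : ∀ j, T j = 0 → b' j = 0)
    (hmin : (1 / 2) * ∑ i, (Y i - ∑ j, A i j * b' j) ^ 2 + lam * ∑ j, |T j|⁻¹ * |b' j| ≤
      (1 / 2) * ∑ i, (Y i - ∑ j, A i j * b j) ^ 2 + lam * ∑ j, |T j|⁻¹ * |b j|) :
    b' = b := by
  set e := Y - A *ᵥ b with he
  set δ := b' - b with hδ
  have e1 : ∑ i, (Y i - ∑ j, A i j * b j) ^ 2 = l2 e ^ 2 := by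
    rw [l2_sq]; rfl
  have e2 : ∑ i, (Y i - ∑ j, A i j * b' j) ^ 2 = l2 (e - A *ᵥ δ) ^ 2 := by
    rw [l2_sq, hδ, he, Matrix.mulVec_sub]
    refine Finset.sum_congr rfl fun i _ => ?_
    simp [Matrix.mulVec, dotProduct]
  have e3 : l2 (e - A *ᵥ δ) ^ 2 = l2 e ^ 2 - 2 * (δ ⬝ᵥ (Aᵀ *ᵥ e)) + l2 (A *ᵥ δ) ^ 2 := by
    rw [dotProduct_transpose_mulVec, ← dotProduct_self_eq_l2_sq, ← dotProduct_self_eq_l2_sq,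
      ← dotProduct_self_eq_l2_sq, sub_dotProduct, dotProduct_sub (e : ι → ℝ) e,
      dotProduct_sub (A *ᵥ δ), dotProduct_comm e (A *ᵥ δ)]
    ring
  rw [e1, e2, e3] at hmin
  -- The subgradient inequality of the penalty at `b`, coordinate by coordinate. Combined with the
  -- exact expansion of the quadratic part, minimality leaves `½ ‖A δ‖² ≤ 0`.
  have h1 : δ ⬝ᵥ (Aᵀ *ᵥ e) ≤ lam * ∑ j, |T j|⁻¹ * |b' j| - lam * ∑ j, |T j|⁻¹ * |b j| := by
    rw [Finset.mul_sum, Finset.mul_sum, ← Finset.sum_sub_distrib]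
    refine Finset.sum_le_sum fun j _ => ?_
    have hw : 0 ≤ lam * |T j|⁻¹ := mul_nonneg hlam (inv_nonneg.2 (abs_nonneg _))
    by_cases hbj : b j = 0
    · by_cases hT : T j = 0
      · simp [hδ, hbj, hb' j hT]
      · have := hb₀ j hbj hT
        have h2 : δ j * (Aᵀ *ᵥ e) j ≤ |b' j| * |(Aᵀ *ᵥ e) j| := by
          rw [← abs_mul]; simpa [hδ, hbj] using le_abs_self (b' j * (Aᵀ *ᵥ e) j)
        have h3 := mul_le_mul_of_nonneg_left this (abs_nonneg (b' j))
        rw [hbj, abs_zero]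
        linarith
    · rw [hb₁ j hbj]
      rcases lt_or_gt_of_ne hbj with h | h
      · simp only [sign_neg h, SignType.coe_neg_one, abs_of_neg h, hδ, Pi.sub_apply]
        have := neg_abs_le (b' j)
        nlinarith [mul_le_mul_of_nonneg_left this hw]
      · simp only [sign_pos h, SignType.coe_one, abs_of_pos h, hδ, Pi.sub_apply]
        have := le_abs_self (b' j)
        nlinarith [mul_le_mul_of_nonneg_left this hw]
  have h4 : l2 (A *ᵥ δ) = 0 := by nlinarith [l2_nonneg (A *ᵥ δ)]
  exact sub_eq_zero.1 (hA δ (l2_eq_zero h4))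

end Euclidean

/-! ### Every instrument is relevant for a bounded number of covariates -/

/-- A coefficient matrix `α` with nonzero entries of absolute value in `[a₀, a₁]` and sparse
columns, for regressors `Z` such that `Z` and `Z α` have bounded operator norms and `Z` is
well-conditioned on the supports of the columns of `α`; `N` is the order of the squared norms. -/
structure SparseDesign {ι η κ : Type*} [Fintype ι] [Fintype η] [Fintype κ]
    (Z : Matrix ι η ℝ) (α : Matrix η κ ℝ) (N ρ τ a₀ a₁ : ℝ) (K : ℕ) : Prop where
  pos : 0 < N
  col : ∀ h, l2 (Zᵀ h) ^ 2 ≤ N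
  regressors : ∀ z, l2 (Zᵀ *ᵥ z) ^ 2 ≤ ρ * N * l2 z ^ 2
  design : ∀ z, l2 ((Z * α)ᵀ *ᵥ z) ^ 2 ≤ ρ * N * l2 z ^ 2
  lower : ∀ l y, (∀ h, α h l = 0 → y h = 0) → τ * N * l2 y ^ 2 ≤ l2 (Z *ᵥ y) ^ 2
  coeff : ∀ h l, α h l ≠ 0 → a₀ ≤ |α h l| ∧ |α h l| ≤ a₁
  sparse : ∀ l, (Finset.univ.filter fun h => α h l ≠ 0).card ≤ K

lemma card_filter_mul_sq_le {κ : Type*} [Fintype κ] (y : κ → ℝ) {a : ℝ} (ha : 0 ≤ a) :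
    ((Finset.univ.filter fun l => a ≤ |y l|).card : ℝ) * a ^ 2 ≤ l2 y ^ 2 := by
  rw [l2_sq, ← nsmul_eq_mul]
  refine (Finset.card_nsmul_le_sum _ (fun l => y l ^ 2) _ fun l hl => ?_).trans
    (Finset.sum_le_sum_of_subset_of_nonneg (Finset.subset_univ _) fun _ _ _ => sq_nonneg _)
  rw [← sq_abs (y l)]
  exact pow_le_pow_left₀ ha (Finset.mem_filter.1 hl).2 2

namespace SparseDesign

variable {ι η κ : Type*} [Fintype ι] [Fintype η] [Fintype κ]
  {Z : Matrix ι η ℝ} {α : Matrix η κ ℝ} {N ρ τ a₀ a₁ : ℝ} {K : ℕ}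

/-- A Bessel-type bound: the squared inner products of one instrument with all columns of `A` sum to
at most `ρ N²`, so few of them can reach `c N`. It serves for `A = Z` and for `A = Z α`. -/
lemma card_filter_le (hS : SparseDesign Z α N ρ τ a₀ a₁ K) (hρ : 0 < ρ) {c : ℝ} (hc : 0 < c)
    {κ' : Type*} [Fintype κ'] {A : Matrix ι κ' ℝ}
    (hA : ∀ z, l2 (Aᵀ *ᵥ z) ^ 2 ≤ ρ * N * l2 z ^ 2) (h : η) :
    ((Finset.univ.filter fun l => c * N ≤ |(Aᵀ *ᵥ (Zᵀ h)) l|).card : ℝ) ≤ ρ / c ^ 2 := by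
  have hN := hS.pos
  have h1 := (card_filter_mul_sq_le (Aᵀ *ᵥ (Zᵀ h)) (mul_pos hc hN).le).trans (hA (Zᵀ h))
  have h2 : ρ * N * l2 (Zᵀ h) ^ 2 ≤ ρ * N * N :=
    mul_le_mul_of_nonneg_left (hS.col h) (mul_pos hρ hN).le
  rw [le_div_iff₀ (by positivity)]
  refine le_of_mul_le_mul_right ?_ (mul_pos hN hN)
  calc _ = _ := by ring
    _ ≤ _ := h1.trans h2
    _ = _ := by ring

/-- If the instruments in `T` are relevant for covariate `l`, then one of them is correlated with
the covariate or with another relevant instrument. -/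
lemma exists_correlated (hS : SparseDesign Z α N ρ τ a₀ a₁ K) (hτ : 0 < τ) (ha₀ : 0 < a₀)
    (ha : a₀ < a₁) (hK : 0 < K)
    {T : Finset η} (hT : T.Nonempty) {l : κ} (hTl : ∀ h ∈ T, α h l ≠ 0) :
    (∃ h ∈ T, τ * a₀ ^ 2 / (4 * K * a₁) * N ≤ |((Z * α)ᵀ *ᵥ (Zᵀ h)) l|) ∨
    ∃ h ∈ T, ∃ h', h' ∉ T ∧ α h' l ≠ 0 ∧
      τ * a₀ ^ 2 / (4 * K ^ 2 * a₁ ^ 2) * N ≤ |(Zᵀ *ᵥ (Zᵀ h)) h'| := by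
  classical
  by_contra! hcon
  obtain ⟨h1, h2⟩ := hcon
  have hN := hS.pos
  have ha₁ : 0 < a₁ := ha₀.trans ha
  have hK' : (0 : ℝ) < K := by exact_mod_cast hK
  set y : η → ℝ := fun h => if h ∈ T then α h l else 0 with hy
  set w : η → ℝ := fun h => if h ∈ T then 0 else α h l with hw
  have hyw : y + w = fun h => α h l := by
    ext h; by_cases hh : h ∈ T <;> simp [hy, hw, hh]
  have hTK : (T.card : ℝ) ≤ K := by
    refine Nat.cast_le.2 ((Finset.card_le_card fun h hh => ?_).trans (hS.sparse l))
    simpa using hTl h hh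
  have hcol : ∀ z : ι → ℝ, ∀ h, (Zᵀ h) ⬝ᵥ z = (Zᵀ *ᵥ z) h := fun z h => rfl
  have hZy : ∀ z : ι → ℝ, (Z *ᵥ y) ⬝ᵥ z = ∑ h ∈ T, α h l * ((Zᵀ h) ⬝ᵥ z) := by
    intro z
    rw [← dotProduct_transpose_mulVec, dotProduct, ← Finset.sum_filter_add_sum_filter_not
      Finset.univ (fun h => h ∈ T)]
    rw [Finset.sum_eq_zero (s := Finset.univ.filter fun h => ¬ h ∈ T), add_zero]
    · rw [Finset.filter_univ_mem]
      exact Finset.sum_congr rfl fun h hh => by simp [hy, hh, hcol]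
    · intro h hh
      simp [hy, (Finset.mem_filter.1 hh).2]
  have hDl : ∀ h, (Zᵀ h) ⬝ᵥ (Z *ᵥ (y + w)) = ((Z * α)ᵀ *ᵥ (Zᵀ h)) l := by
    intro h
    rw [hyw, dotProduct_comm]
    rfl
  -- Split column `l` of `α` into its part `y` on `T` and the rest `w`, and use `Z y = D_l - Z w` in
  -- one factor of `‖Z y‖²`. The left side is at least `τ a₀² N`, while the thresholds are chosen so
  -- that failure of both alternatives bounds each sum on the right by a quarter of this.
  have e1 : l2 (Z *ᵥ y) ^ 2 = ∑ h ∈ T, α h l * ((Z * α)ᵀ *ᵥ (Zᵀ h)) l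
      - ∑ h ∈ T, α h l * ∑ h', w h' * (Zᵀ *ᵥ (Zᵀ h)) h' := by
    have : Z *ᵥ y = Z *ᵥ (y + w) - Z *ᵥ w := by rw [Matrix.mulVec_add]; abel
    rw [← dotProduct_self_eq_l2_sq, congrArg ((Z *ᵥ y) ⬝ᵥ ·) this, dotProduct_sub, hZy, hZy]
    congr 1
    · exact Finset.sum_congr rfl fun h _ => by rw [hDl]
    · refine Finset.sum_congr rfl fun h _ => ?_
      rw [dotProduct_comm, ← dotProduct_transpose_mulVec]; rfl
  have hwb : ∀ h ∈ T, |∑ h', w h' * (Zᵀ *ᵥ (Zᵀ h)) h'| ≤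
      K * (a₁ * (τ * a₀ ^ 2 / (4 * K ^ 2 * a₁ ^ 2) * N)) := by
    intro h hh
    have hs : ∑ h', w h' * (Zᵀ *ᵥ (Zᵀ h)) h' =
        ∑ h' ∈ Finset.univ.filter fun h => α h l ≠ 0, w h' * (Zᵀ *ᵥ (Zᵀ h)) h' := by
      rw [Finset.sum_filter_of_ne]
      intro h' _ hne h0
      apply hne
      by_cases hh' : h' ∈ T <;> simp [hw, hh', h0]
    rw [hs]
    refine (Finset.abs_sum_le_sum_abs _ _).trans ((Finset.sum_le_card_nsmul _ _
      (a₁ * (τ * a₀ ^ 2 / (4 * K ^ 2 * a₁ ^ 2) * N)) fun h' hh' => ?_).trans ?_)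
    · rw [abs_mul]
      by_cases hT' : h' ∈ T
      · simp only [hw, hT', if_true, abs_zero, zero_mul]; positivity
      · simp only [hw, hT', if_false]
        have hne : α h' l ≠ 0 := (Finset.mem_filter.1 hh').2
        exact mul_le_mul (hS.coeff h' l hne).2 (h2 h hh h' hT' hne).le (abs_nonneg _) ha₁.le
    · rw [nsmul_eq_mul]
      exact mul_le_mul_of_nonneg_right (by exact_mod_cast hS.sparse l) (by positivity)
  have hb1 : |∑ h ∈ T, α h l * ((Z * α)ᵀ *ᵥ (Zᵀ h)) l| ≤
      K * (a₁ * (τ * a₀ ^ 2 / (4 * K * a₁) * N)) := by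
    refine (Finset.abs_sum_le_sum_abs _ _).trans ((Finset.sum_le_card_nsmul _ _
      (a₁ * (τ * a₀ ^ 2 / (4 * K * a₁) * N)) fun h hh => ?_).trans ?_)
    · rw [abs_mul]
      exact mul_le_mul (hS.coeff h l (hTl h hh)).2 (h1 h hh).le (abs_nonneg _) ha₁.le
    · rw [nsmul_eq_mul]
      exact mul_le_mul_of_nonneg_right hTK (by positivity)
  have hb2 : |∑ h ∈ T, α h l * ∑ h', w h' * (Zᵀ *ᵥ (Zᵀ h)) h'| ≤
      K * (a₁ * (K * (a₁ * (τ * a₀ ^ 2 / (4 * K ^ 2 * a₁ ^ 2) * N)))) := by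
    refine (Finset.abs_sum_le_sum_abs _ _).trans ((Finset.sum_le_card_nsmul _ _
      (a₁ * (K * (a₁ * (τ * a₀ ^ 2 / (4 * K ^ 2 * a₁ ^ 2) * N)))) fun h hh => ?_).trans ?_)
    · rw [abs_mul]
      exact mul_le_mul (hS.coeff h l (hTl h hh)).2 (hwb h hh) (abs_nonneg _) ha₁.le
    · rw [nsmul_eq_mul]
      exact mul_le_mul_of_nonneg_right hTK (by positivity)
  have hlow := hS.lower l y fun h h0 => by
    by_cases hh : h ∈ T
    · exact absurd h0 (hTl h hh)
    · simp [hy, hh]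
  have hy2 : a₀ ^ 2 ≤ l2 y ^ 2 := by
    obtain ⟨h, hh⟩ := hT
    have : |y h| = |α h l| := by simp [hy, hh]
    exact pow_le_pow_left₀ ha₀.le (((hS.coeff h l (hTl h hh)).1.trans this.ge).trans
      (abs_le_l2 y h)) 2
  have c1 : K * (a₁ * (τ * a₀ ^ 2 / (4 * K * a₁) * N)) = τ * a₀ ^ 2 * N / 4 := by
    field_simp
  have c2 : K * (a₁ * (K * (a₁ * (τ * a₀ ^ 2 / (4 * K ^ 2 * a₁ ^ 2) * N)))) =
      τ * a₀ ^ 2 * N / 4 := by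
    field_simp
  rw [c1] at hb1
  rw [c2] at hb2
  have := mul_le_mul_of_nonneg_left hy2 (mul_pos hτ hN).le
  have hpos : 0 < τ * a₀ ^ 2 * N := by positivity
  have := (abs_le.1 hb1).2
  have := (abs_le.1 hb2).1
  nlinarith

end SparseDesign

/-- The number of covariates for which all instruments of a nonempty set are relevant is bounded by
a constant, by downward induction on the size of the set. -/
lemma exists_card_common_support_le {ρ τ a₀ a₁ : ℝ} {K : ℕ} (hρ : 0 < ρ) (hτ : 0 < τ)
    (ha₀ : 0 < a₀) (ha : a₀ < a₁) (hK : 0 < K) (t : ℕ) :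
    ∃ B : ℝ, 0 ≤ B ∧ ∀ (n q p : ℕ) (Z : Matrix (Fin n) (Fin q) ℝ)
      (α : Matrix (Fin q) (Fin p) ℝ) (N : ℝ), SparseDesign Z α N ρ τ a₀ a₁ K →
      ∀ T : Finset (Fin q), T.Nonempty → K + 1 ≤ T.card + t →
        ((Finset.univ.filter fun l => ∀ h ∈ T, α h l ≠ 0).card : ℝ) ≤ B := by
  have hempty : ∀ (n q p : ℕ) (Z : Matrix (Fin n) (Fin q) ℝ)
      (α : Matrix (Fin q) (Fin p) ℝ) (N : ℝ), SparseDesign Z α N ρ τ a₀ a₁ K →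
      ∀ T : Finset (Fin q), K + 1 ≤ T.card →
        (Finset.univ.filter fun l => ∀ h ∈ T, α h l ≠ 0) = ∅ := by
    intro n q p Z α N hS T hT
    refine Finset.filter_eq_empty_iff.2 fun l _ hl => ?_
    have := (Finset.card_le_card (s := T) (t := Finset.univ.filter fun h => α h l ≠ 0)
      fun h hh => by simpa using hl h hh).trans (hS.sparse l)
    omega
  induction t with
  | zero =>
    refine ⟨0, le_rfl, fun n q p Z α N hS T _ hc => ?_⟩
    rw [hempty n q p Z α N hS T hc]; simp
  | succ t ih =>
    obtain ⟨B, hB, ih⟩ := ih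
    have ha₁ : 0 < a₁ := ha₀.trans ha
    have hK' : (0 : ℝ) < K := by exact_mod_cast hK
    set c := τ * a₀ ^ 2 / (4 * K * a₁) with hc
    set c' := τ * a₀ ^ 2 / (4 * K ^ 2 * a₁ ^ 2) with hc'
    have hcpos : 0 < c := by positivity
    have hcpos' : 0 < c' := by positivity
    refine ⟨K * (ρ / c ^ 2) + K * (ρ / c' ^ 2 * B), by positivity,
      fun n q p Z α N hS T hT hcard => ?_⟩
    by_cases hTK : K + 1 ≤ T.card
    · rw [hempty n q p Z α N hS T hTK]; simp; positivity
    have hTK' : (T.card : ℝ) ≤ K := by exact_mod_cast (by omega : T.card ≤ K)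
    classical
    let A : Fin q → Finset (Fin p) := fun h =>
      Finset.univ.filter fun l => c * N ≤ |((Z * α)ᵀ *ᵥ (Zᵀ h)) l|
    let G : Fin q → Finset (Fin q) := fun h =>
      Finset.univ.filter fun h' => c' * N ≤ |(Zᵀ *ᵥ (Zᵀ h)) h'|
    -- Empty on `T`, because only an instrument outside `T` enlarges the set and so brings the
    -- induction hypothesis into play.
    let E : Fin q → Finset (Fin p) := fun h' =>
      if h' ∈ T then ∅ else Finset.univ.filter fun l => ∀ h ∈ insert h' T, α h l ≠ 0
    have hE : ∀ h', ((E h').card : ℝ) ≤ B := by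
      intro h'
      by_cases hh : h' ∈ T
      · simp [E, hh, hB]
      · simp only [E, hh, if_false]
        refine ih n q p Z α N hS _ (Finset.insert_nonempty _ _) ?_
        rw [Finset.card_insert_of_notMem hh]; omega
    -- Each such covariate is either correlated with an instrument of `T`, which happens boundedly
    -- often, or has a further relevant instrument `h'` correlated with `T`. There are boundedly
    -- many such `h'`, and each is handled by the bound for `insert h' T`.
    have hsub : (Finset.univ.filter fun l => ∀ h ∈ T, α h l ≠ 0) ⊆
        T.biUnion A ∪ T.biUnion fun h => (G h).biUnion E := by
      intro l hl
      have hl' : ∀ h ∈ T, α h l ≠ 0 := (Finset.mem_filter.1 hl).2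
      rcases hS.exists_correlated hτ ha₀ ha hK hT hl' with ⟨h, hh, h1⟩ | ⟨h, hh, h', hh', h0, h1⟩
      · exact Finset.mem_union_left _ (Finset.mem_biUnion.2 ⟨h, hh, by simpa [A] using h1⟩)
      · refine Finset.mem_union_right _ (Finset.mem_biUnion.2 ⟨h, hh, Finset.mem_biUnion.2
          ⟨h', by simpa [G] using h1, ?_⟩⟩)
        simp only [E, hh', if_false, Finset.mem_filter, Finset.mem_univ, true_and,
          Finset.forall_mem_insert]
        exact ⟨h0, hl'⟩
    have hcardA : ((T.biUnion A).card : ℝ) ≤ K * (ρ / c ^ 2) := by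
      calc ((T.biUnion A).card : ℝ) ≤ ∑ h ∈ T, ((A h).card : ℝ) := by
            exact_mod_cast Finset.card_biUnion_le
        _ ≤ T.card • (ρ / c ^ 2) := Finset.sum_le_card_nsmul _ _ _ fun h _ =>
            hS.card_filter_le hρ hcpos hS.design h
        _ ≤ _ := by
            rw [nsmul_eq_mul]; exact mul_le_mul_of_nonneg_right hTK' (by positivity)
    have hcardG : ((T.biUnion fun h => (G h).biUnion E).card : ℝ) ≤ K * (ρ / c' ^ 2 * B) := by
      calc ((T.biUnion fun h => (G h).biUnion E).card : ℝ)
          ≤ ∑ h ∈ T, (((G h).biUnion E).card : ℝ) := by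
            exact_mod_cast Finset.card_biUnion_le
        _ ≤ T.card • (ρ / c' ^ 2 * B) := Finset.sum_le_card_nsmul _ _ _ fun h _ => by
            calc (((G h).biUnion E).card : ℝ) ≤ ∑ h' ∈ G h, ((E h').card : ℝ) := by
                  exact_mod_cast Finset.card_biUnion_le
              _ ≤ (G h).card • B := Finset.sum_le_card_nsmul _ _ _ fun h' _ => hE h'
              _ ≤ _ := by
                rw [nsmul_eq_mul]
                exact mul_le_mul_of_nonneg_right
                  (hS.card_filter_le hρ hcpos' hS.regressors h) hB
        _ ≤ _ := by
            rw [nsmul_eq_mul]; exact mul_le_mul_of_nonneg_right hTK' (by positivity)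
    calc ((Finset.univ.filter fun l => ∀ h ∈ T, α h l ≠ 0).card : ℝ)
        ≤ (T.biUnion A).card + (T.biUnion fun h => (G h).biUnion E).card := by
          exact_mod_cast (Finset.card_le_card hsub).trans (Finset.card_union_le _ _)
      _ ≤ _ := add_le_add hcardA hcardG

/-- In a sparse design the rows of the coefficient matrix are sparse, too. -/
lemma exists_card_row_support_le {ρ τ a₀ a₁ : ℝ} (K : ℕ) (hρ : 0 < ρ) (hτ : 0 < τ)
    (ha₀ : 0 < a₀) (ha : a₀ < a₁) :
    ∃ B : ℝ, 0 < B ∧ ∀ (n q p : ℕ) (Z : Matrix (Fin n) (Fin q) ℝ)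
      (α : Matrix (Fin q) (Fin p) ℝ) (N : ℝ), SparseDesign Z α N ρ τ a₀ a₁ K →
      ∀ h, ((Finset.univ.filter fun l => α h l ≠ 0).card : ℝ) ≤ B := by
  obtain ⟨B, hB, h⟩ := exists_card_common_support_le hρ hτ ha₀ ha K.succ_pos (K + 1)
  refine ⟨B + 1, by positivity, fun n q p Z α N hS j => ?_⟩
  -- The induction divides by the sparsity level, so it is applied with the positive level `K + 1`,
  -- starting from a singleton.
  have hS' : SparseDesign Z α N ρ τ a₀ a₁ (K + 1) :=
    { hS with sparse := fun l => (hS.sparse l).trans K.le_succ }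
  have := h n q p Z α N hS' {j} (Finset.singleton_nonempty j) (by simp)
  simp only [Finset.mem_singleton, forall_eq] at this
  linarith

/-! ### Weighted sums of independent random variables with exponential tails -/

section Tails

variable {Ω : Type*} [MeasurableSpace Ω] {P : Measure Ω} [IsProbabilityMeasure P]

/-- The linear term is kept exactly, since it integrates to zero for centred variables. -/
lemma exp_le_one_add_add_sq_mul (y : ℝ) :
    Real.exp y ≤ 1 + y + y ^ 2 * Real.exp |y| := by
  have h1 : Real.exp y - 1 ≤ y * Real.exp y := by
    have := Real.add_one_le_exp (-y)
    have h2 : Real.exp (-y) * Real.exp y = 1 := by rw [← Real.exp_add]; simp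
    nlinarith [Real.exp_pos y]
  rcases le_or_gt 0 y with h | h
  · rw [abs_of_nonneg h]; nlinarith
  · have h2 := Real.add_one_le_exp y
    have h3 : 1 ≤ Real.exp |y| := Real.one_le_exp (abs_nonneg y)
    have h4 : Real.exp y ≤ 1 + y + y ^ 2 := by nlinarith
    nlinarith [sq_nonneg y]

/-- Discretize `|X|^d` at the integers. The tail decays like `exp(-C k)` while the exponential grows
like `exp(C k / 2)`, so halving the constant leaves a geometric series of ratio `exp(-C / 2)`. -/
lemma lintegral_exp_rpow_le {d K C : ℝ} (hd : 1 ≤ d) (hK : 0 < K) (hC : 0 < C) {X : Ω → ℝ}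
    (hX : Measurable X)
    (htail : ∀ x, 0 ≤ x → P.real {ω | x < |X ω|} ≤ K * Real.exp (-C * x ^ d)) :
    ∫⁻ ω, ENNReal.ofReal (Real.exp (C / 2 * |X ω| ^ d)) ∂P ≤
      ENNReal.ofReal (1 + K * Real.exp (C / 2) * (1 - Real.exp (-(C / 2)))⁻¹) := by
  have hd0 : 0 < d := by linarith
  set κ := C / 2 with hκ
  have hκ0 : 0 < κ := by positivity
  have hr0 : 0 ≤ Real.exp (-κ) := (Real.exp_pos _).le
  have hr1 : Real.exp (-κ) < 1 := by rw [Real.exp_lt_one_iff]; linarith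
  have hmY : Measurable fun ω => |X ω| ^ d := (hX.abs).pow_const d
  have hset : ∀ k : ℕ, MeasurableSet {ω | (k : ℝ) < |X ω| ^ d} := fun k =>
    measurableSet_lt measurable_const hmY
  have hpt : ∀ ω, ENNReal.ofReal (Real.exp (κ * |X ω| ^ d)) ≤
      1 + ∑' k : ℕ, ENNReal.ofReal (Real.exp (κ * (k + 1))) *
        Set.indicator {ω | (k : ℝ) < |X ω| ^ d} 1 ω := by
    intro ω
    have hY : 0 ≤ |X ω| ^ d := by positivity
    rcases hY.eq_or_lt with h | h
    · rw [← h]; simp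
    · obtain ⟨k, hk⟩ : ∃ k : ℕ, ⌈|X ω| ^ d⌉₊ = k + 1 :=
        Nat.exists_eq_succ_of_ne_zero (Nat.ceil_pos.2 h).ne'
      have h1 : (k : ℝ) < |X ω| ^ d := by
        refine Nat.lt_ceil.1 ?_
        omega
      have h2 : |X ω| ^ d ≤ k + 1 := by
        have := Nat.le_ceil (|X ω| ^ d)
        rw [hk] at this
        exact_mod_cast this
      refine le_add_left (le_trans ?_ (ENNReal.le_tsum k))
      rw [Set.indicator_of_mem (show ω ∈ {ω | (k : ℝ) < |X ω| ^ d} from h1), Pi.one_apply, mul_one]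
      exact ENNReal.ofReal_le_ofReal (Real.exp_le_exp.2 (by nlinarith))
  have hprob : ∀ k : ℕ, P {ω | (k : ℝ) < |X ω| ^ d} ≤
      ENNReal.ofReal (K * Real.exp (-C * k)) := by
    intro k
    have hk : (0 : ℝ) ≤ (k : ℝ) ^ (1 / d) := by positivity
    have hs : {ω | (k : ℝ) < |X ω| ^ d} = {ω | (k : ℝ) ^ (1 / d) < |X ω|} := by
      ext ω
      simp only [Set.mem_ofPred_eq]
      rw [← Real.rpow_lt_rpow_iff hk (abs_nonneg _) hd0, ← Real.rpow_mul (by positivity),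
        one_div_mul_cancel hd0.ne', Real.rpow_one]
    rw [hs, ← ofReal_measureReal]
    refine ENNReal.ofReal_le_ofReal ((htail _ hk).trans_eq ?_)
    rw [← Real.rpow_mul (by positivity), one_div_mul_cancel hd0.ne', Real.rpow_one]
  calc ∫⁻ ω, ENNReal.ofReal (Real.exp (κ * |X ω| ^ d)) ∂P
      ≤ ∫⁻ ω, (1 + ∑' k : ℕ, ENNReal.ofReal (Real.exp (κ * (k + 1))) *
        Set.indicator {ω | (k : ℝ) < |X ω| ^ d} 1 ω) ∂P := lintegral_mono hpt
    _ = 1 + ∑' k : ℕ, ENNReal.ofReal (Real.exp (κ * (k + 1))) * P {ω | (k : ℝ) < |X ω| ^ d} := by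
      rw [lintegral_add_left measurable_const, lintegral_one, measure_univ, lintegral_tsum]
      · congr 2
        ext k
        rw [lintegral_const_mul _ (measurable_one.indicator (hset k)),
          lintegral_indicator_one (hset k)]
      · exact fun k => ((measurable_one.indicator (hset k)).const_mul _).aemeasurable
    _ ≤ 1 + ∑' k : ℕ, ENNReal.ofReal (K * Real.exp κ * Real.exp (-κ) ^ k) := by
      gcongr with k
      refine (mul_le_mul_right (hprob k) _).trans_eq ?_
      rw [← ENNReal.ofReal_mul (Real.exp_pos _).le]
      congr 1
      rw [← Real.exp_nat_mul, mul_left_comm, ← Real.exp_add, mul_assoc, ← Real.exp_add]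
      congr 2
      rw [hκ]; ring
    _ = _ := by
      have hsum := (hasSum_geometric_of_lt_one hr0 hr1).mul_left (K * Real.exp κ)
      rw [← ENNReal.ofReal_tsum_of_nonneg (fun k => by positivity) hsum.summable, hsum.tsum_eq,
        ENNReal.ofReal_add one_pos.le, ENNReal.ofReal_one]
      have : 0 ≤ (1 - Real.exp (-κ))⁻¹ := inv_nonneg.2 (by linarith)
      positivity

lemma integral_exp_rpow_le {d K C : ℝ} (hd : 1 ≤ d) (hK : 0 < K) (hC : 0 < C) {X : Ω → ℝ}
    (hX : Measurable X)
    (htail : ∀ x, 0 ≤ x → P.real {ω | x < |X ω|} ≤ K * Real.exp (-C * x ^ d)) :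
    Integrable (fun ω => Real.exp (C / 2 * |X ω| ^ d)) P ∧
    ∫ ω, Real.exp (C / 2 * |X ω| ^ d) ∂P ≤
      1 + K * Real.exp (C / 2) * (1 - Real.exp (-(C / 2)))⁻¹ := by
  have h := lintegral_exp_rpow_le hd hK hC hX htail
  have hm : Measurable fun ω => Real.exp (C / 2 * |X ω| ^ d) :=
    (((hX.abs).pow_const d).const_mul _).exp
  have hpos : 0 ≤ (1 - Real.exp (-(C / 2)))⁻¹ := by
    have : Real.exp (-(C / 2)) < 1 := by rw [Real.exp_lt_one_iff]; linarith
    exact inv_nonneg.2 (by linarith)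
  refine ⟨⟨hm.aestronglyMeasurable, ?_⟩, ?_⟩
  · rw [hasFiniteIntegral_iff_ofReal (Eventually.of_forall fun ω => (Real.exp_pos _).le)]
    exact h.trans_lt ENNReal.ofReal_lt_top
  · rw [integral_eq_lintegral_of_nonneg_ae (Eventually.of_forall fun ω => (Real.exp_pos _).le)
      hm.aestronglyMeasurable]
    exact ENNReal.toReal_le_of_le_ofReal (by positivity) h

/-- Young's inequality in the form needed for moment generating functions at large arguments. -/
lemma mul_rpow_sub_one_mul_le {d : ℝ} (hd₁ : 1 < d) (hd₂ : d ≤ 2) {θ t x : ℝ} (hθ : 0 ≤ θ)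
    (hθ₁ : θ ≤ 1) (ht : 0 < t) (hx : 0 ≤ x) :
    θ * t ^ (d - 1) * x ≤ θ ^ 2 * t ^ d + x ^ d := by
  have hd0 : 0 < d - 1 := by linarith
  rcases hθ.eq_or_lt with h0 | hθ0
  · rw [← h0]; simp; positivity
  -- Chosen so that `y ^ (d - 1) = θ * t ^ (d - 1)`. As `d ≤ 2` and `θ ≤ 1`, the exponent `1 / (d -
  -- 1) ≥ 1` gives `y ^ d ≤ θ ^ 2 * t ^ d`, and it remains to compare `x` with `y`.
  set y := θ ^ (1 / (d - 1)) * t with hy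
  have hy0 : 0 < y := by positivity
  have hy1 : y ^ (d - 1) = θ * t ^ (d - 1) := by
    rw [hy, Real.mul_rpow (by positivity) ht.le, ← Real.rpow_mul hθ, one_div_mul_cancel hd0.ne',
      Real.rpow_one]
  have hpow : ∀ z : ℝ, 0 < z → z ^ (d - 1) * z = z ^ d := fun z hz => by
    rw [← Real.rpow_add_one hz.ne']; ring_nf
  have hyd : y ^ d ≤ θ ^ 2 * t ^ d := by
    rw [← hpow y hy0, hy1, hy, ← hpow t ht]
    have : θ ^ (1 / (d - 1)) ≤ θ := by
      conv_rhs => rw [← Real.rpow_one θ]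
      exact Real.rpow_le_rpow_of_exponent_ge hθ0 hθ₁ (by rw [le_div_iff₀ hd0]; linarith)
    calc _ = θ * θ ^ (1 / (d - 1)) * (t ^ (d - 1) * t) := by ring
      _ ≤ θ * θ * (t ^ (d - 1) * t) := by gcongr
      _ = _ := by ring
  rw [← hy1]
  rcases le_total y x with h | h
  · rcases hx.eq_or_lt with h0 | hx0
    · rw [← h0] at h; linarith
    · calc y ^ (d - 1) * x ≤ x ^ (d - 1) * x := by gcongr
        _ = x ^ d := hpow x hx0
        _ ≤ _ := le_add_of_nonneg_left (by positivity)
  · calc y ^ (d - 1) * x ≤ y ^ (d - 1) * y := by gcongr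
      _ = y ^ d := hpow y hy0
      _ ≤ _ := hyd.trans (le_add_of_nonneg_right (by positivity))

set_option maxHeartbeats 1000000 in
/-- Bounds on the moment generating function of a centred random variable with tails
`K exp(-C x^d)`. -/
lemma exists_mgf_le_of_tail {d K C : ℝ} (hd₁ : 1 ≤ d) (hd₂ : d ≤ 2) (hK : 0 < K) (hC : 0 < C) :
    ∃ c : ℝ, 0 < c ∧ ∀ X : Ω → ℝ, Measurable X → ∫ ω, X ω ∂P = 0 →
      (∀ x, 0 ≤ x → P.real {ω | x < |X ω|} ≤ K * Real.exp (-C * x ^ d)) →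
      ∀ t a : ℝ, 1 ≤ t → |a| ≤ 1 →
        Integrable (fun ω => Real.exp (c * t ^ (d - 1) * (a * X ω))) P ∧
        ∫ ω, Real.exp (c * t ^ (d - 1) * (a * X ω)) ∂P ≤ Real.exp (c / 2 * (a ^ 2 * t ^ d)) := by
  set κ := C / 2 with hκ
  have hκ0 : 0 < κ := by positivity
  set M := 1 + K * Real.exp κ * (1 - Real.exp (-κ))⁻¹ with hM
  have hM1 : 1 ≤ M := by
    have : Real.exp (-κ) < 1 := by rw [Real.exp_lt_one_iff]; linarith
    have : 0 ≤ (1 - Real.exp (-κ))⁻¹ := inv_nonneg.2 (by linarith)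
    have : 0 ≤ K * Real.exp κ * (1 - Real.exp (-κ))⁻¹ := by positivity
    linarith
  have hlog : 0 ≤ Real.log M := Real.log_nonneg hM1
  set M₂ := 2 / (κ / 2) ^ 2 * (Real.exp κ * M) with hM₂
  have hM₂0 : 0 < M₂ := by positivity
  set B := M₂ + 1 / κ + Real.log M / (κ / 2) ^ 2 with hB
  have hB0 : 0 < B := by positivity
  -- The first bound keeps arguments in the range of the available exponential moment. The second
  -- turns `c ^ 2 * B` into `c / 2`, half of what the Chernoff exponent later supplies.
  set c := min (κ / 2) (1 / (2 * B)) with hc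
  have hc0 : 0 < c := by positivity
  have hc1 : c ≤ κ / 2 := min_le_left _ _
  have hcB : c ^ 2 * B ≤ c / 2 := by
    have : c * B ≤ 1 / 2 := by
      calc c * B ≤ 1 / (2 * B) * B := by gcongr; exact min_le_right _ _
        _ = 1 / 2 := by field_simp
    nlinarith
  refine ⟨c, hc0, fun X hX hmean htail t a ht ha => ?_⟩
  obtain ⟨hint, hle⟩ := integral_exp_rpow_le (P := P) hd₁ hK hC hX htail
  rw [← hκ] at hint hle
  rw [← hM] at hle
  have ht0 : 0 < t := by linarith
  have hd0 : 0 < d := by linarith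
  -- The Chernoff parameter for deviation `t`, so that `s * t = c * t ^ d`. Because `d ≤ 2` and `t ≥
  -- 1`, its square is at most `c ^ 2 * t ^ d`. The resulting bound is quadratic in `a`, hence adds
  -- up over independent summands to the squared norm of the weights.
  set s := c * t ^ (d - 1) with hs
  have hs0 : 0 < s := by positivity
  have hsq : s ^ 2 ≤ c ^ 2 * t ^ d := by
    rw [hs, mul_pow, ← Real.rpow_mul_natCast ht0.le]
    exact mul_le_mul_of_nonneg_left
      (Real.rpow_le_rpow_of_exponent_le ht (by push_cast; linarith)) (sq_nonneg c)
  clear_value s c B M₂ M κ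
  have hone : ∀ x : ℝ, 0 ≤ x → x ≤ 1 + x ^ d := by
    intro x hx
    rcases le_total x 1 with h | h
    · have : 0 ≤ x ^ d := by positivity
      linarith
    · have : x ^ (1 : ℝ) ≤ x ^ d := Real.rpow_le_rpow_of_exponent_le h hd₁
      rw [Real.rpow_one] at this; linarith
  have hXmeas : ∀ r : ℝ, AEStronglyMeasurable (fun ω => Real.exp (r * (a * X ω))) P := fun r =>
    ((hX.const_mul a).const_mul r).exp.aestronglyMeasurable
  have hXint : Integrable X P := by
    refine (hint.const_mul (Real.exp κ / κ)).mono' hX.aestronglyMeasurable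
      (Eventually.of_forall fun ω => ?_)
    rw [Real.norm_eq_abs, div_mul_eq_mul_div, le_div_iff₀ hκ0, ← Real.exp_add]
    have h1 := hone |X ω| (abs_nonneg _)
    have h2 := Real.add_one_le_exp (κ + κ * |X ω| ^ d)
    nlinarith
  have hfin : a ^ 2 * (c ^ 2 * t ^ d) * B ≤ c / 2 * (a ^ 2 * t ^ d) := by
    have : 0 ≤ a ^ 2 * t ^ d := by positivity
    nlinarith
  -- For small arguments a second-order expansion and centring suffice. For large ones the bound
  -- follows from Young's inequality, and the constant factor `M` is absorbed because `a ^ 2 * s ^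
  -- 2` is then bounded below.
  rcases le_or_gt (|a| * s) (κ / 2) with hreg | hreg
  · have hpt : ∀ ω, Real.exp (s * (a * X ω)) ≤ 1 + s * a * X ω +
        (s * a) ^ 2 * (2 / (κ / 2) ^ 2 * (Real.exp κ * Real.exp (κ * |X ω| ^ d))) := by
      intro ω
      have h1 := exp_le_one_add_add_sq_mul (s * (a * X ω))
      have h2 : |s * (a * X ω)| ≤ κ / 2 * |X ω| := by
        rw [abs_mul, abs_mul, abs_of_pos hs0, ← mul_assoc, mul_comm s]
        exact mul_le_mul_of_nonneg_right hreg (abs_nonneg _)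
      have h3 : X ω ^ 2 ≤ 2 / (κ / 2) ^ 2 * Real.exp (κ / 2 * |X ω|) := by
        have := Real.quadratic_le_exp_of_nonneg (x := κ / 2 * |X ω|) (by positivity)
        have h5 : 0 ≤ κ / 2 * |X ω| := by positivity
        rw [div_mul_eq_mul_div, le_div_iff₀ (by positivity), ← sq_abs (X ω)]
        nlinarith
      have h4 : X ω ^ 2 * Real.exp |s * (a * X ω)| ≤
          2 / (κ / 2) ^ 2 * (Real.exp κ * Real.exp (κ * |X ω| ^ d)) := by
        calc _ ≤ 2 / (κ / 2) ^ 2 * Real.exp (κ / 2 * |X ω|) * Real.exp (κ / 2 * |X ω|) := by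
              gcongr
          _ = 2 / (κ / 2) ^ 2 * Real.exp (κ * |X ω|) := by
              rw [mul_assoc, ← Real.exp_add]; ring_nf
          _ ≤ _ := by
              rw [← Real.exp_add]
              have h6 := mul_le_mul_of_nonneg_left (hone |X ω| (abs_nonneg _)) hκ0.le
              exact mul_le_mul_of_nonneg_left (Real.exp_le_exp.2 (by linarith)) (by positivity)
      have h5 := mul_le_mul_of_nonneg_left h4 (sq_nonneg (s * a))
      calc _ ≤ _ := h1
        _ = 1 + s * a * X ω + (s * a) ^ 2 * (X ω ^ 2 * Real.exp |s * (a * X ω)|) := by ring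
        _ ≤ _ := by linarith
    have hi1 : Integrable (fun ω => 1 + s * a * X ω) P :=
      (integrable_const _).add (hXint.const_mul _)
    have hi2 : Integrable (fun ω =>
        (s * a) ^ 2 * (2 / (κ / 2) ^ 2 * (Real.exp κ * Real.exp (κ * |X ω| ^ d)))) P :=
      ((hint.const_mul _).const_mul _).const_mul _
    have hint' : Integrable (fun ω => 1 + s * a * X ω +
        (s * a) ^ 2 * (2 / (κ / 2) ^ 2 * (Real.exp κ * Real.exp (κ * |X ω| ^ d)))) P :=
      hi1.add hi2
    have hI : Integrable (fun ω => Real.exp (s * (a * X ω))) P :=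
      hint'.mono' (hXmeas s) (Eventually.of_forall fun ω => by
        rw [Real.norm_eq_abs, abs_of_pos (Real.exp_pos _)]; exact hpt ω)
    refine ⟨hI, (integral_mono hI hint' hpt).trans ?_⟩
    rw [integral_add hi1 hi2, integral_add (integrable_const _) (hXint.const_mul _), integral_const_mul, hmean,
      integral_const_mul, integral_const_mul, integral_const_mul]
    simp only [integral_const, probReal_univ, smul_eq_mul, mul_one, mul_zero, add_zero]
    have h1 : 2 / (κ / 2) ^ 2 * (Real.exp κ * ∫ ω, Real.exp (κ * |X ω| ^ d) ∂P) ≤ M₂ := by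
      rw [hM₂]; gcongr
    have h2 : (s * a) ^ 2 * (2 / (κ / 2) ^ 2 * (Real.exp κ * ∫ ω, Real.exp (κ * |X ω| ^ d) ∂P)) ≤
        c / 2 * (a ^ 2 * t ^ d) := by
      calc _ ≤ (s * a) ^ 2 * M₂ := by gcongr
        _ = a ^ 2 * s ^ 2 * M₂ := by ring
        _ ≤ a ^ 2 * (c ^ 2 * t ^ d) * B := by
          gcongr
          rw [hB, add_assoc]
          exact le_add_of_nonneg_right (by positivity)
        _ ≤ _ := hfin
    linarith [Real.add_one_le_exp (c / 2 * (a ^ 2 * t ^ d))]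
  -- For `d = 1` the parameter is `c ≤ κ / 2` itself, so the large regime is empty.
  · have hd1 : 1 < d := by
      rcases hd₁.eq_or_lt with h | h
      · exfalso
        have : s = c := by rw [hs, ← h]; simp
        rw [this] at hreg
        nlinarith [abs_nonneg a]
      · exact h
    have hpt : ∀ ω, Real.exp (s * (a * X ω)) ≤
        Real.exp (a ^ 2 * (c ^ 2 * t ^ d) * (1 / κ)) * Real.exp (κ * |X ω| ^ d) := by
      intro ω
      rw [← Real.exp_add, Real.exp_le_exp]
      have hθ : |a| * c / κ ≤ 1 := by
        rw [div_le_one hκ0]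
        nlinarith [abs_nonneg a]
      have h1 := mul_rpow_sub_one_mul_le hd1 hd₂ (θ := |a| * c / κ) (by positivity) hθ ht0
        (abs_nonneg (X ω))
      have h2 := mul_le_mul_of_nonneg_left h1 hκ0.le
      calc s * (a * X ω) ≤ s * (|a| * |X ω|) := by
            rw [← abs_mul]; exact mul_le_mul_of_nonneg_left (le_abs_self _) hs0.le
        _ = κ * (|a| * c / κ * t ^ (d - 1) * |X ω|) := by
          rw [hs, show |a| * c / κ = κ⁻¹ * (|a| * c) by ring]
          rw [mul_assoc κ⁻¹, mul_assoc κ⁻¹, mul_inv_cancel_left₀ hκ0.ne']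
          ring
        _ ≤ _ := h2
        _ = _ := by
          rw [div_pow, mul_pow, sq_abs]
          field_simp
    have hint' := hint.const_mul (Real.exp (a ^ 2 * (c ^ 2 * t ^ d) * (1 / κ)))
    have hI : Integrable (fun ω => Real.exp (s * (a * X ω))) P :=
      hint'.mono' (hXmeas s) (Eventually.of_forall fun ω => by
        rw [Real.norm_eq_abs, abs_of_pos (Real.exp_pos _)]; exact hpt ω)
    refine ⟨hI, (integral_mono hI hint' hpt).trans ?_⟩
    rw [integral_const_mul]
    have hMle : M ≤ Real.exp (a ^ 2 * (c ^ 2 * t ^ d) * (Real.log M / (κ / 2) ^ 2)) := by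
      rw [← Real.log_le_iff_le_exp (by linarith)]
      have h1 : (κ / 2) ^ 2 ≤ a ^ 2 * (c ^ 2 * t ^ d) := by
        calc (κ / 2) ^ 2 ≤ (|a| * s) ^ 2 := by gcongr
          _ = a ^ 2 * s ^ 2 := by rw [mul_pow, sq_abs]
          _ ≤ _ := by gcongr
      rw [mul_div_assoc', le_div_iff₀ (by positivity), mul_comm]
      gcongr
    calc _ ≤ Real.exp (a ^ 2 * (c ^ 2 * t ^ d) * (1 / κ)) *
          Real.exp (a ^ 2 * (c ^ 2 * t ^ d) * (Real.log M / (κ / 2) ^ 2)) := by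
            gcongr; exact hle.trans hMle
      _ ≤ Real.exp (a ^ 2 * (c ^ 2 * t ^ d) * B) := by
          rw [← Real.exp_add, Real.exp_le_exp, ← mul_add]
          gcongr
          rw [hB, add_assoc]
          exact le_add_of_nonneg_left hM₂0.le
      _ ≤ _ := Real.exp_le_exp.2 hfin

end Tails

/-! ### Tails and second moments of weighted sums -/

section WeightedSums

variable {Ω : Type*} [MeasurableSpace Ω] {P : Measure Ω} [IsProbabilityMeasure P]

omit [IsProbabilityMeasure P] in
lemma lintegral_sq_le_of_integral_exp_le {W : Ω → ℝ} {s E : ℝ} (hs : 0 < s)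
    (h₁ : Integrable (fun ω => Real.exp (s * W ω)) P)
    (h₂ : Integrable (fun ω => Real.exp (-s * W ω)) P)
    (hE₁ : ∫ ω, Real.exp (s * W ω) ∂P ≤ E) (hE₂ : ∫ ω, Real.exp (-s * W ω) ∂P ≤ E) :
    ∫⁻ ω, ENNReal.ofReal (W ω ^ 2) ∂P ≤ ENNReal.ofReal (4 * E / s ^ 2) := by
  have hpt : ∀ ω, W ω ^ 2 ≤ 2 / s ^ 2 * (Real.exp (s * W ω) + Real.exp (-s * W ω)) := by
    intro ω
    rw [div_mul_eq_mul_div, le_div_iff₀ (by positivity)]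
    have h := Real.quadratic_le_exp_of_nonneg (abs_nonneg (s * W ω))
    have h0 := abs_nonneg (s * W ω)
    rw [sq_abs] at h
    have h3 : Real.exp |s * W ω| ≤ Real.exp (s * W ω) + Real.exp (-s * W ω) := by
      rcases abs_cases (s * W ω) with ⟨h4, _⟩ | ⟨h4, _⟩
      · rw [h4]; exact le_add_of_nonneg_right (Real.exp_pos _).le
      · rw [h4, neg_mul]; exact le_add_of_nonneg_left (Real.exp_pos _).le
    nlinarith
  have hint := (h₁.add h₂).const_mul (2 / s ^ 2)
  refine (lintegral_mono fun ω => ENNReal.ofReal_le_ofReal (hpt ω)).trans ?_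
  have h := ofReal_integral_eq_lintegral_ofReal hint (Eventually.of_forall fun ω => by
    have := Real.exp_pos (s * W ω)
    have := Real.exp_pos (-s * W ω)
    simp only [Pi.zero_apply, Pi.add_apply]
    positivity)
  simp only [Pi.add_apply] at h
  rw [← h]
  refine ENNReal.ofReal_le_ofReal ?_
  rw [integral_const_mul, integral_add h₁ h₂, div_mul_eq_mul_div]
  exact div_le_div_of_nonneg_right (by linarith) (sq_nonneg s)

lemma measure_lt_abs_le_of_integral_exp_le {W : Ω → ℝ} {s E : ℝ} (hs : 0 < s) (x : ℝ)
    (h₁ : Integrable (fun ω => Real.exp (s * W ω)) P)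
    (h₂ : Integrable (fun ω => Real.exp (-s * W ω)) P)
    (hE₁ : ∫ ω, Real.exp (s * W ω) ∂P ≤ E) (hE₂ : ∫ ω, Real.exp (-s * W ω) ∂P ≤ E) :
    P {ω | x < |W ω|} ≤ ENNReal.ofReal (2 * (Real.exp (-s * x) * E)) := by
  have hsub : {ω | x < |W ω|} ⊆ {ω | x ≤ W ω} ∪ {ω | x ≤ (-W) ω} := by
    intro ω hω
    rcases lt_abs.1 (show x < |W ω| from hω) with h | h
    · exact Or.inl h.le
    · exact Or.inr h.le
  have h3 := measure_ge_le_exp_mul_mgf (μ := P) (X := W) x hs.le h₁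
  have h4 := measure_ge_le_exp_mul_mgf (μ := P) (X := -W) (t := s) x hs.le (by simpa using h₂)
  have h5 : mgf (-W) P s ≤ E := by simpa [mgf] using hE₂
  rw [← ofReal_measureReal]
  refine ENNReal.ofReal_le_ofReal ((measureReal_mono hsub).trans
    ((measureReal_union_le _ _).trans ?_))
  have h6 : Real.exp (-s * x) * mgf W P s ≤ Real.exp (-s * x) * E :=
    mul_le_mul_of_nonneg_left hE₁ (Real.exp_pos _).le
  have h7 : Real.exp (-s * x) * mgf (-W) P s ≤ Real.exp (-s * x) * E :=
    mul_le_mul_of_nonneg_left h5 (Real.exp_pos _).le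
  linarith

/-- Weighted sums of independent centred random variables with tails `K exp(-C x^d)`: second
moments and tails in terms of the Euclidean norm of the weights. -/
lemma exists_weighted_sum_bounds {d K C : ℝ} (hd₁ : 1 ≤ d) (hd₂ : d ≤ 2) (hK : 0 < K)
    (hC : 0 < C) :
    ∃ V c : ℝ, 0 < V ∧ 0 < c ∧ ∀ {n : ℕ} (X : Fin n → Ω → ℝ), iIndepFun X P →
      (∀ i, Measurable (X i)) → (∀ i, ∫ ω, X i ω ∂P = 0) →
      (∀ i x, 0 ≤ x → P.real {ω | x < |X i ω|} ≤ K * Real.exp (-C * x ^ d)) →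
      ∀ (a : Fin n → ℝ) (A : ℝ), 0 ≤ A → l2 a ≤ A →
        ∫⁻ ω, ENNReal.ofReal ((∑ i, a i * X i ω) ^ 2) ∂P ≤ ENNReal.ofReal (V * A ^ 2) ∧
        ∀ t, 1 ≤ t → P {ω | A * t < |∑ i, a i * X i ω|} ≤
          ENNReal.ofReal (2 * Real.exp (-c * t ^ d)) := by
  obtain ⟨c, hc, hmgf⟩ := exists_mgf_le_of_tail (P := P) hd₁ hd₂ hK hC
  refine ⟨4 * Real.exp (c / 2) / c ^ 2, c / 2, by positivity, by positivity,
    fun {n} X hind hX hmean htail a A hA haA => ?_⟩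
  rcases hA.eq_or_lt with h0 | hA0
  · have ha : a = 0 := l2_eq_zero (le_antisymm (h0 ▸ haA) (l2_nonneg a))
    subst ha
    rw [← h0]
    simp
  have hd0 : 0 < d := by linarith
  set b : Fin n → ℝ := fun i => A⁻¹ * a i with hb
  have hbl : l2 b ≤ 1 := by
    rw [show b = A⁻¹ • a from rfl, l2_smul, abs_of_pos (inv_pos.2 hA0), inv_mul_le_one₀ hA0]
    exact haA
  have hb1 : ∀ i, |b i| ≤ 1 := fun i => (abs_le_l2 b i).trans hbl
  have hb2 : ∑ i, b i ^ 2 ≤ 1 := by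
    rw [← l2_sq]; exact pow_le_one₀ (l2_nonneg b) hbl
  set W : Ω → ℝ := fun ω => ∑ i, b i * X i ω with hW
  have hWa : ∀ ω, ∑ i, a i * X i ω = A * W ω := by
    intro ω
    rw [hW, Finset.mul_sum]
    refine Finset.sum_congr rfl fun i _ => ?_
    rw [hb]; field_simp
  -- The sign `σ` covers both tails at once. The second moment uses this at `t = 1`, the tail bound
  -- at the given `t`.
  have key : ∀ σ : ℝ, |σ| = 1 → ∀ t : ℝ, 1 ≤ t →
      Integrable (fun ω => Real.exp (c * t ^ (d - 1) * (σ * W ω))) P ∧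
      ∫ ω, Real.exp (c * t ^ (d - 1) * (σ * W ω)) ∂P ≤ Real.exp (c / 2 * t ^ d) := by
    intro σ hσ t ht
    have hind' : iIndepFun (fun i ω => σ * b i * X i ω) P :=
      hind.comp (fun i x => σ * b i * x) fun i => measurable_id.const_mul _
    have hmeas' : ∀ i, Measurable fun ω => σ * b i * X i ω := fun i => (hX i).const_mul _
    have hi := fun i => hmgf (X i) (hX i) (hmean i) (htail i) t (σ * b i) ht
      (by rw [abs_mul, hσ, one_mul]; exact hb1 i)
    have hI := hind'.integrable_exp_mul_sum hmeas' (s := Finset.univ)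
      (t := c * t ^ (d - 1)) fun i _ => (hi i).1
    have hM := hind'.mgf_sum (t := c * t ^ (d - 1)) hmeas' Finset.univ
    have hsum : ∀ ω, (∑ i, fun ω => σ * b i * X i ω) ω = σ * W ω := by
      intro ω
      rw [hW, Finset.sum_apply, Finset.mul_sum]
      exact Finset.sum_congr rfl fun i _ => by ring
    simp only [mgf, hsum] at hI hM
    refine ⟨hI, hM.trans_le ?_⟩
    calc _ ≤ ∏ i, Real.exp (c / 2 * ((σ * b i) ^ 2 * t ^ d)) :=
          Finset.prod_le_prod (fun i _ => integral_nonneg fun ω => (Real.exp_pos _).le)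
            fun i _ => (hi i).2
      _ = Real.exp (c / 2 * ((∑ i, b i ^ 2) * t ^ d)) := by
          rw [← Real.exp_sum, Finset.sum_mul, Finset.mul_sum]
          refine congrArg _ (Finset.sum_congr rfl fun i _ => ?_)
          rw [mul_pow, ← sq_abs σ, hσ]; ring
      _ ≤ _ := by
          refine Real.exp_le_exp.2 (mul_le_mul_of_nonneg_left ?_ (by positivity))
          exact mul_le_of_le_one_left (by positivity) hb2
  constructor
  · obtain ⟨i1, e1⟩ := key 1 (by simp) 1 le_rfl
    obtain ⟨i2, e2⟩ := key (-1) (by simp) 1 le_rfl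
    simp only [Real.one_rpow, mul_one, one_mul, neg_mul, mul_neg] at i1 e1 i2 e2
    have h := lintegral_sq_le_of_integral_exp_le (W := W) hc i1 (by simpa using i2) e1
      (by simpa using e2)
    simp only [hWa, mul_pow]
    calc _ = ENNReal.ofReal (A ^ 2) * ∫⁻ ω, ENNReal.ofReal (W ω ^ 2) ∂P := by
          rw [← lintegral_const_mul']
          · simp_rw [ENNReal.ofReal_mul (sq_nonneg A)]
          · exact ENNReal.ofReal_ne_top
      _ ≤ ENNReal.ofReal (A ^ 2) * _ := mul_le_mul_right h _
      _ = _ := by rw [← ENNReal.ofReal_mul (sq_nonneg A), mul_comm]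
  · intro t ht
    have ht0 : 0 < t := by linarith
    obtain ⟨i1, e1⟩ := key 1 (by simp) t ht
    obtain ⟨i2, e2⟩ := key (-1) (by simp) t ht
    simp only [one_mul, neg_mul, mul_neg] at i1 e1 i2 e2
    have h := measure_lt_abs_le_of_integral_exp_le (W := W) (s := c * t ^ (d - 1)) (by positivity)
      t i1 (by simpa using i2) e1 (by simpa using e2)
    have hset : {ω | A * t < |∑ i, a i * X i ω|} = {ω | t < |W ω|} := by
      ext ω
      simp only [Set.mem_ofPred_eq, hWa, abs_mul, abs_of_pos hA0, mul_lt_mul_iff_right₀ hA0]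
    rw [hset]
    refine h.trans_eq ?_
    rw [← Real.exp_add]
    congr 3
    have : t ^ (d - 1) * t = t ^ d := by rw [← Real.rpow_add_one ht0.ne']; ring_nf
    rw [← this]; ring

omit [IsProbabilityMeasure P] in
lemma hasSubgaussianMGF_mono {W : Ω → ℝ} {c c' : ℝ≥0} (h : HasSubgaussianMGF W c P)
    (hc : c ≤ c') : HasSubgaussianMGF W c' P :=
  ⟨h.integrable_exp_mul, fun t => (h.mgf_le t).trans (Real.exp_le_exp.2 (by
    have : (c : ℝ) ≤ c' := hc
    gcongr))⟩

/-- Homogeneity: rescale the coefficient vector to the unit sphere. Joint sub-Gaussianity allows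
arbitrary dependence between the coordinates of one error vector. -/
lemma hasSubgaussianMGF_linear_combination {n p : ℕ} {v : Fin n → Fin p → Ω → ℝ} {c : ℝ≥0}
    (hc : ∀ i (a : Fin p → ℝ), l2 a ≤ 1 → HasSubgaussianMGF (fun ω => ∑ j, a j * v i j ω) c P)
    (i : Fin n) (a : Fin p → ℝ) :
    HasSubgaussianMGF (fun ω => ∑ j, a j * v i j ω) (Real.toNNReal (l2 a ^ 2) * c) P := by
  rcases (l2_nonneg a).eq_or_lt with h0 | h0
  · have ha : a = 0 := l2_eq_zero h0.symm
    subst ha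
    simp [← h0]
  · have h := (hc i ((l2 a)⁻¹ • a) (by
      rw [l2_smul, abs_of_pos (inv_pos.2 h0), inv_mul_cancel₀ h0.ne'])).const_mul (l2 a)
    have hc' : (⟨l2 a ^ 2, sq_nonneg _⟩ : ℝ≥0) = Real.toNNReal (l2 a ^ 2) := by
      ext; exact (Real.coe_toNNReal _ (sq_nonneg _)).symm
    rw [← hc']
    refine h.congr (Eventually.of_forall fun ω => ?_)
    simp only [Finset.mul_sum, Pi.smul_apply, smul_eq_mul]
    refine Finset.sum_congr rfl fun j _ => ?_
    field_simp

/-- Weighted sums of independent jointly sub-Gaussian vectors: second moments and tails in terms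
of the Euclidean norm of the weights. -/
lemma exists_weighted_subgaussian_bounds (c : ℝ≥0) :
    ∃ V κ : ℝ, 0 < V ∧ 0 < κ ∧ ∀ {n p : ℕ} (v : Fin n → Fin p → Ω → ℝ),
      iIndepFun (fun i ω j => v i j ω) P →
      (∀ i (a : Fin p → ℝ), l2 a ≤ 1 → HasSubgaussianMGF (fun ω => ∑ j, a j * v i j ω) c P) →
      ∀ (a : Fin n → Fin p → ℝ) (A : ℝ), 0 ≤ A → ∑ i, ∑ j, a i j ^ 2 ≤ A ^ 2 →
        ∫⁻ ω, ENNReal.ofReal ((∑ i, ∑ j, a i j * v i j ω) ^ 2) ∂P ≤ ENNReal.ofReal (V * A ^ 2) ∧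
        ∀ t, 0 < t → P {ω | A * t < |∑ i, ∑ j, a i j * v i j ω|} ≤
          ENNReal.ofReal (2 * Real.exp (-κ * t ^ 2)) := by
  refine ⟨4 * Real.exp ((c + 1) / 2), 1 / (2 * (c + 1)), by positivity, by positivity,
    fun {n p} v hind hc a A hA haA => ?_⟩
  rcases hA.eq_or_lt with h0 | hA0
  · have ha : ∀ i j, a i j = 0 := by
      rw [← h0, zero_pow two_ne_zero] at haA
      have h1 := (Finset.sum_eq_zero_iff_of_nonneg fun i _ =>
        Finset.sum_nonneg fun j _ => sq_nonneg (a i j)).1 (le_antisymm haA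
          (Finset.sum_nonneg fun i _ => Finset.sum_nonneg fun j _ => sq_nonneg (a i j)))
      intro i j
      have h2 := (Finset.sum_eq_zero_iff_of_nonneg fun j _ => sq_nonneg (a i j)).1
        (h1 i (Finset.mem_univ i)) j (Finset.mem_univ j)
      exact pow_eq_zero_iff two_ne_zero |>.1 h2
    simp [ha, ← h0]
  set W : Ω → ℝ := fun ω => ∑ i, ∑ j, A⁻¹ * a i j * v i j ω with hW
  have hWa : ∀ ω, ∑ i, ∑ j, a i j * v i j ω = A * W ω := by
    intro ω
    simp only [hW, Finset.mul_sum]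
    refine Finset.sum_congr rfl fun i _ => Finset.sum_congr rfl fun j _ => ?_
    field_simp
  -- The proxy is raised to `c + 1` since `c` may vanish and the optimal Chernoff parameter `t / (c
  -- + 1)` needs a positive denominator.
  have hsub : HasSubgaussianMGF W (c + 1) P := by
    have hind' : iIndepFun (fun i ω => ∑ j, A⁻¹ * a i j * v i j ω) P :=
      hind.comp (fun i (x : Fin p → ℝ) => ∑ j, A⁻¹ * a i j * x j) fun i =>
        Finset.measurable_sum _ fun j _ => (measurable_pi_apply j).const_mul _
    refine hasSubgaussianMGF_mono (HasSubgaussianMGF.sum_of_iIndepFun hind' (s := Finset.univ)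
      fun i _ => hasSubgaussianMGF_linear_combination hc i fun j => A⁻¹ * a i j) ?_
    rw [← Finset.sum_mul]
    have : ∑ i, Real.toNNReal (l2 (fun j => A⁻¹ * a i j) ^ 2) ≤ 1 := by
      rw [← NNReal.coe_le_coe, NNReal.coe_sum]
      have hco : ∀ i, ((Real.toNNReal (l2 (fun j => A⁻¹ * a i j) ^ 2) : ℝ≥0) : ℝ) =
          l2 (fun j => A⁻¹ * a i j) ^ 2 := fun i => Real.coe_toNNReal _ (sq_nonneg _)
      rw [Finset.sum_congr rfl fun i _ => hco i]
      simp only [NNReal.coe_one, l2_sq, mul_pow, ← Finset.mul_sum, inv_pow]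
      rw [inv_mul_le_one₀ (by positivity)]
      exact haA
    calc _ ≤ 1 * c := mul_le_mul_left this c
      _ ≤ c + 1 := by rw [one_mul]; exact le_self_add
  have key : ∀ s : ℝ, ∫ ω, Real.exp (s * W ω) ∂P ≤ Real.exp ((c + 1) * s ^ 2 / 2) :=
    fun s => by simpa [mgf] using hsub.mgf_le s
  constructor
  · have h := lintegral_sq_le_of_integral_exp_le (W := W) one_pos (hsub.integrable_exp_mul 1)
      (hsub.integrable_exp_mul (-1)) (key 1) (by simpa using key (-1))
    simp only [hWa, mul_pow]
    calc _ = ENNReal.ofReal (A ^ 2) * ∫⁻ ω, ENNReal.ofReal (W ω ^ 2) ∂P := by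
          rw [← lintegral_const_mul']
          · simp_rw [ENNReal.ofReal_mul (sq_nonneg A)]
          · exact ENNReal.ofReal_ne_top
      _ ≤ ENNReal.ofReal (A ^ 2) * _ := mul_le_mul_right h _
      _ = _ := by
        rw [← ENNReal.ofReal_mul (sq_nonneg A), mul_comm]
        simp
  · intro t ht
    set s := t / (c + 1) with hs
    have hc0 : (0 : ℝ) < c + 1 := by positivity
    have h := measure_lt_abs_le_of_integral_exp_le (W := W) (s := s) (by positivity)
      t (hsub.integrable_exp_mul s) (hsub.integrable_exp_mul (-s)) (key s)
      (by simpa using key (-s))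
    have hset : {ω | A * t < |∑ i, ∑ j, a i j * v i j ω|} = {ω | t < |W ω|} := by
      ext ω
      simp only [Set.mem_ofPred_eq, hWa, abs_mul, abs_of_pos hA0, mul_lt_mul_iff_right₀ hA0]
    rw [hset]
    refine h.trans_eq ?_
    rw [← Real.exp_add, hs]
    congr 3
    field_simp
    ring

end WeightedSums

/-! ### Sign recovery by the adaptive LASSO with perturbed regressors -/

section SignRecovery

variable {ι κ : Type*} [Fintype ι] [Fintype κ]

lemma sign_add_of_abs_lt {a x : ℝ} (h : |x| < |a|) :
    SignType.sign (a + x) = SignType.sign a := by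
  have hx := abs_lt.1 h
  rcases lt_trichotomy a 0 with ha | ha | ha
  · rw [abs_of_neg ha] at hx
    rw [sign_neg ha, sign_neg (by linarith)]
  · rw [ha, abs_zero] at h
    exact absurd h (not_lt.2 (abs_nonneg x))
  · rw [abs_of_pos ha] at hx
    rw [sign_pos ha, sign_pos (by linarith)]

/-- The residual of regressor `j` after regression on the regressors in the support of `β`, as a
linear combination `c` of the regressors. -/
structure IsResidualCombination (D : Matrix ι κ ℝ) (β : κ → ℝ) (j : κ) (c : κ → ℝ) : Prop where
  self : c j = 1
  other : ∀ l, β l = 0 → l ≠ j → c l = 0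
  orthogonal : ∀ l, β l ≠ 0 → (Dᵀ *ᵥ (D *ᵥ c)) l = 0

/-- Take the unit vector of `j` minus the coefficients of the projection of column `j` on the
relevant columns. The scale `s` cancels between the two operator bounds, so the norm of the
combination is bounded by the condition number alone. -/
lemma exists_isResidualCombination (D : Matrix ι κ ℝ) (β : κ → ℝ) {s cD CD : ℝ} (hs : 0 < s)
    (hcD : 0 < cD) (hCD : 0 < CD) (hlow : ∀ y, cD * s * l2 y ≤ l2 (D *ᵥ y))
    (hup : ∀ y, l2 (D *ᵥ y) ≤ CD * s * l2 y) (j : κ) (hj : β j = 0) :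
    ∃ c, IsResidualCombination D β j c ∧ l2 c ≤ 1 + CD ^ 2 / cD ^ 2 := by
  classical
  set u : κ → ℝ := Pi.single j 1 with hu
  have hu1 : l2 u = 1 := by simp [hu, l2]
  set g : κ → ℝ := fun l => if β l ≠ 0 then (Dᵀ *ᵥ (D *ᵥ u)) l else 0 with hg
  have hA : ∀ y : κ → ℝ, (∀ l, ¬ β l ≠ 0 → y l = 0) →
      (cD * s) ^ 2 * l2 y ^ 2 ≤ l2 (D *ᵥ y) ^ 2 := fun y _ => by
    rw [← mul_pow]
    exact pow_le_pow_left₀ (mul_nonneg (by positivity) (l2_nonneg y)) (hlow y) 2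
  obtain ⟨x, hx0, hx1, hx2⟩ := exists_restricted_normal_equations D (fun l => β l ≠ 0)
    (c := (cD * s) ^ 2) (by positivity) hA g fun l hl => by simp only [hg, if_neg hl]
  have hgl : l2 g ≤ (CD * s) ^ 2 := by
    have h1 : l2 g ≤ l2 (Dᵀ *ᵥ (D *ᵥ u)) := by
      refine l2_le_of_sum_sq_le (l2_nonneg _) ?_
      rw [l2_sq]
      refine Finset.sum_le_sum fun l _ => ?_
      by_cases h : β l ≠ 0
      · simp only [hg, if_pos h]; exact le_rfl
      · simp only [hg, if_neg h]; simpa using sq_nonneg _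
    have h2 := l2_transpose_mulVec_le (by positivity : 0 ≤ CD * s) hup (D *ᵥ u)
    have h3 := hup u
    rw [hu1, mul_one] at h3
    calc l2 g ≤ CD * s * l2 (D *ᵥ u) := h1.trans h2
      _ ≤ CD * s * (CD * s) := by gcongr
      _ = _ := by ring
  refine ⟨u - x, ⟨?_, ?_, ?_⟩, ?_⟩
  · simp [hu, hx0 j (not_not.2 hj)]
  · intro l hl hlj
    simp [hu, hx0 l (not_not.2 hl), hlj]
  · intro l hl
    rw [Matrix.mulVec_sub, Matrix.mulVec_sub, Pi.sub_apply, hx1 l hl]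
    simp only [hg, if_pos hl, sub_self]
  · refine (l2_sub_le u x).trans ?_
    rw [hu1]
    have : l2 x ≤ CD ^ 2 / cD ^ 2 := by
      rw [le_div_iff₀ (by positivity)]
      refine le_of_mul_le_mul_right ?_ (by positivity : 0 < s ^ 2)
      calc l2 x * cD ^ 2 * s ^ 2 = (cD * s) ^ 2 * l2 x := by ring
        _ ≤ (CD * s) ^ 2 := hx2.trans hgl
        _ = _ := by ring
    linarith

/-- Deterministic sign recovery: `D` is the unperturbed design, `Δ` its perturbation, `ε` the
noise and `T` the vector of reciprocal weights of the LASSO. -/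
lemma sign_eq_of_lasso_minimizer {D Δ : Matrix ι κ ℝ} {β T b' : κ → ℝ} {ε : ι → ℝ}
    {lam s cD CD g G₁ G₂ F Λ X b₀ Cc H₁ H₂ w : ℝ}
    (hlam : 0 ≤ lam) (hs : 0 < s) (hcD : 0 < cD) (hCD : 0 < CD) (hg : 0 ≤ g) (hCc : 0 ≤ Cc)
    (hlow : ∀ y, cD * s * l2 y ≤ l2 (D *ᵥ y)) (hup : ∀ y, l2 (D *ᵥ y) ≤ CD * s * l2 y)
    (hΔ : ∀ y, l2 (Δ *ᵥ y) ≤ g * l2 y) (hg₁ : g ≤ cD * s / 2) (hg₂ : g ≤ CD * s)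
    (hG₁ : l2 (Dᵀ *ᵥ ε) ≤ G₁) (hG₂ : l2 (Δᵀ *ᵥ ε) ≤ G₂) (hF : l2 (Δ *ᵥ β) ≤ F)
    (hΛw : l2 (fun j => if β j ≠ 0 then lam * |T j|⁻¹ * SignType.sign (β j) else 0) ≤ Λ)
    (hX : G₁ + G₂ + 2 * CD * s * F + Λ ≤ (cD * s / 2) ^ 2 * X) (hXb : X < b₀)
    (hβ : ∀ j, β j ≠ 0 → b₀ ≤ |β j|) (hT : ∀ j, β j ≠ 0 → T j ≠ 0)
    (hc : ∀ j, β j = 0 → ∃ c, IsResidualCombination D β j c ∧ l2 c ≤ Cc ∧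
      |(D *ᵥ c) ⬝ᵥ ε| ≤ H₁ ∧ |(D *ᵥ c) ⬝ᵥ (Δ *ᵥ β)| ≤ H₂)
    (hw : ∀ j, β j = 0 → T j ≠ 0 → w ≤ lam * |T j|⁻¹)
    (hfin : H₁ + H₂ + Cc * (G₂ + g * F) + 3 * CD * Cc * s * g * X + Cc * Λ ≤ w)
    (hb' : ∀ j, T j = 0 → b' j = 0)
    (hmin : ∀ b : κ → ℝ, (∀ j, T j = 0 → b j = 0) →
      (1 / 2) * ∑ i, ((D *ᵥ β + ε) i - ∑ j, (D + Δ) i j * b' j) ^ 2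
          + lam * ∑ j, |T j|⁻¹ * |b' j| ≤
        (1 / 2) * ∑ i, ((D *ᵥ β + ε) i - ∑ j, (D + Δ) i j * b j) ^ 2
          + lam * ∑ j, |T j|⁻¹ * |b j|) (j : κ) :
    SignType.sign (b' j) = SignType.sign (β j) := by
  classical
  set A := D + Δ with hA
  set e := ε - Δ *ᵥ β with he
  have hAlow : ∀ y, cD * s / 2 * l2 y ≤ l2 (A *ᵥ y) := by
    intro y
    have h1 : D *ᵥ y = A *ᵥ y - Δ *ᵥ y := by rw [hA, Matrix.add_mulVec]; abel
    have h2 := l2_sub_le (A *ᵥ y) (Δ *ᵥ y)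
    rw [← h1] at h2
    have h3 := hlow y
    have h4 := hΔ y
    have h5 := mul_le_mul_of_nonneg_right hg₁ (l2_nonneg y)
    nlinarith
  have hAup : ∀ y, l2 (A *ᵥ y) ≤ 2 * CD * s * l2 y := by
    intro y
    rw [hA, Matrix.add_mulVec]
    have h2 := l2_add_le (D *ᵥ y) (Δ *ᵥ y)
    have h3 := hup y
    have h4 := hΔ y
    have h5 := mul_le_mul_of_nonneg_right hg₂ (l2_nonneg y)
    nlinarith
  set ω : κ → ℝ := fun j => if β j ≠ 0 then lam * |T j|⁻¹ * SignType.sign (β j) else 0 with hω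
  -- The right side of the stationarity equations on the support when the estimate is written as `β
  -- + x` and the penalty is given the signs of `β`.
  set r : κ → ℝ := fun j => if β j ≠ 0 then (Aᵀ *ᵥ e - ω) j else 0 with hr
  obtain ⟨x, hx0, hx1, hx2⟩ := exists_restricted_normal_equations A (fun l => β l ≠ 0)
    (c := (cD * s / 2) ^ 2) (by positivity) (fun y _ => by
      rw [← mul_pow]
      exact pow_le_pow_left₀ (mul_nonneg (by positivity) (l2_nonneg y)) (hAlow y) 2) r
    fun l hl => by simp only [hr, if_neg hl]
  have hAe : l2 (Aᵀ *ᵥ e) ≤ G₁ + G₂ + 2 * CD * s * F := by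
    have h1 : Aᵀ *ᵥ e = Dᵀ *ᵥ ε + Δᵀ *ᵥ ε - Aᵀ *ᵥ (Δ *ᵥ β) := by
      rw [he, Matrix.mulVec_sub, hA, Matrix.transpose_add, Matrix.add_mulVec]
    rw [h1]
    have h2 := l2_transpose_mulVec_le (by positivity : 0 ≤ 2 * CD * s) hAup (Δ *ᵥ β)
    have h3 : 2 * CD * s * l2 (Δ *ᵥ β) ≤ 2 * CD * s * F := by gcongr
    linarith [l2_sub_le (Dᵀ *ᵥ ε + Δᵀ *ᵥ ε) (Aᵀ *ᵥ (Δ *ᵥ β)), l2_add_le (Dᵀ *ᵥ ε) (Δᵀ *ᵥ ε)]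
  have hxX : l2 x ≤ X := by
    have h1 : l2 r ≤ l2 (Aᵀ *ᵥ e - ω) := by
      refine l2_le_of_sum_sq_le (l2_nonneg _) ?_
      rw [l2_sq]
      refine Finset.sum_le_sum fun l _ => ?_
      by_cases h : β l ≠ 0
      · simp only [hr, if_pos h]; exact le_rfl
      · simp only [hr, if_neg h]; simpa using sq_nonneg _
    have h2 := l2_sub_le (Aᵀ *ᵥ e) ω
    refine le_of_mul_le_mul_left ?_ (by positivity : 0 < (cD * s / 2) ^ 2)
    linarith
  have hX0 : 0 ≤ X := (l2_nonneg x).trans hxX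
  set b := β + x with hb
  have hres : D *ᵥ β + ε - A *ᵥ b = e - A *ᵥ x := by
    rw [hb, Matrix.mulVec_add, he, hA, Matrix.add_mulVec D Δ β]; abel
  have hscore : ∀ l, β l ≠ 0 → (Aᵀ *ᵥ (e - A *ᵥ x)) l = ω l := by
    intro l hl
    rw [Matrix.mulVec_sub, Pi.sub_apply, hx1 l hl]
    simp only [hr, if_pos hl, Pi.sub_apply]
    ring
  have hsign : ∀ l, β l ≠ 0 → SignType.sign (b l) = SignType.sign (β l) := fun l hl =>
    sign_add_of_abs_lt (((abs_le_l2 x l).trans hxX).trans_lt (hXb.trans_le (hβ l hl)))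
  have hb0 : ∀ l, β l = 0 → b l = 0 := fun l hl => by
    simp [hb, hl, hx0 l (not_not.2 hl)]
  have hoff : ∀ l, β l = 0 → |(Aᵀ *ᵥ (e - A *ᵥ x)) l| ≤ w := by
    intro l hl
    obtain ⟨c, hcR, hcC, hc1, hc2⟩ := hc l hl
    -- The combination `c` has coefficient one at `l`, vanishes at the other irrelevant coordinates,
    -- and on the support meets the known score `ω`. Testing against `c` therefore isolates the
    -- score of `l`.
    have h1 : c ⬝ᵥ (Aᵀ *ᵥ (e - A *ᵥ x)) = (Aᵀ *ᵥ (e - A *ᵥ x)) l + c ⬝ᵥ ω := by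
      have : ∀ m, c m * (Aᵀ *ᵥ (e - A *ᵥ x)) m =
          (if m = l then (Aᵀ *ᵥ (e - A *ᵥ x)) l else 0) + c m * ω m := by
        intro m
        by_cases hm : β m = 0
        · have hωm : ω m = 0 := by simp [hω, hm]
          by_cases hml : m = l
          · subst hml; simp [hcR.self, hωm]
          · simp [hml, hωm, hcR.other m hm hml]
        · have hml : m ≠ l := fun h => hm (h ▸ hl)
          simp [hml, hscore m hm]
      rw [dotProduct, Finset.sum_congr rfl fun m _ => this m, Finset.sum_add_distrib]
      simp [dotProduct]
    clear_value ω A e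
    rw [dotProduct_transpose_mulVec] at h1
    -- Orthogonality removes `(D c)'(D x)`, the one term too large to estimate by norms. Every
    -- remaining term in `x` carries a factor `Δ`.
    have h2 : (A *ᵥ c) ⬝ᵥ (e - A *ᵥ x) = (D *ᵥ c) ⬝ᵥ ε - (D *ᵥ c) ⬝ᵥ (Δ *ᵥ β)
        + (c ⬝ᵥ (Δᵀ *ᵥ ε) - (Δ *ᵥ c) ⬝ᵥ (Δ *ᵥ β)) - ((D *ᵥ c) ⬝ᵥ (Δ *ᵥ x)
        + (Δ *ᵥ c) ⬝ᵥ (A *ᵥ x)) := by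
      have h3 : (D *ᵥ c) ⬝ᵥ (D *ᵥ x) = 0 := by
        rw [dotProduct_comm, ← dotProduct_transpose_mulVec]
        refine Finset.sum_eq_zero fun m _ => ?_
        by_cases hm : β m = 0
        · rw [hx0 m (not_not.2 hm), zero_mul]
        · rw [hcR.orthogonal m hm, mul_zero]
      have h4 : (D *ᵥ c) ⬝ᵥ (A *ᵥ x) = (D *ᵥ c) ⬝ᵥ (Δ *ᵥ x) := by
        rw [hA, Matrix.add_mulVec, dotProduct_add, h3, zero_add]
      rw [dotProduct_transpose_mulVec, dotProduct_sub, ← h4,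
        show A *ᵥ c = D *ᵥ c + Δ *ᵥ c by rw [hA, Matrix.add_mulVec], add_dotProduct,
        add_dotProduct, he, dotProduct_sub, dotProduct_sub]
    have hc0 := l2_nonneg c
    have b1 : |c ⬝ᵥ (Δᵀ *ᵥ ε)| ≤ Cc * G₂ :=
      (abs_dotProduct_le _ _).trans (mul_le_mul hcC hG₂ (l2_nonneg _) hCc)
    have b0 : l2 (Δ *ᵥ c) ≤ g * Cc := (hΔ c).trans (by gcongr)
    have b2 : |(Δ *ᵥ c) ⬝ᵥ (Δ *ᵥ β)| ≤ g * Cc * F :=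
      (abs_dotProduct_le _ _).trans (mul_le_mul b0 hF (l2_nonneg _) (by positivity))
    have b3 : |(D *ᵥ c) ⬝ᵥ (Δ *ᵥ x)| ≤ CD * s * Cc * (g * X) :=
      (abs_dotProduct_le _ _).trans (mul_le_mul ((hup c).trans (by gcongr))
        ((hΔ x).trans (by gcongr)) (l2_nonneg _) (by positivity))
    have b4 : |(Δ *ᵥ c) ⬝ᵥ (A *ᵥ x)| ≤ g * Cc * (2 * CD * s * X) :=
      (abs_dotProduct_le _ _).trans (mul_le_mul b0
        ((hAup x).trans (by gcongr)) (l2_nonneg _) (by positivity))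
    have b5 : |c ⬝ᵥ ω| ≤ Cc * Λ :=
      (abs_dotProduct_le _ _).trans (mul_le_mul hcC hΛw (l2_nonneg _) hCc)
    rw [abs_le] at b1 b2 b3 b4 b5 hc1 hc2 ⊢
    rw [h1] at h2
    constructor <;> linarith
  have hbb : b' = b := by
    refine weighted_lasso_unique A (D *ᵥ β + ε) T (fun y hy => ?_) hlam b b' (fun l hl => ?_)
      (fun l hl hTl => ?_) hb' (hmin b fun l hl => ?_)
    · have h1 := hAlow y
      rw [hy, show l2 (0 : ι → ℝ) = 0 by simp [l2]] at h1
      have : 0 < cD * s / 2 := by positivity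
      exact l2_eq_zero (le_antisymm (by nlinarith) (l2_nonneg y))
    · have hβl : β l ≠ 0 := fun h => hl (hb0 l h)
      rw [hres, hscore l hβl, hsign l hβl]
      simp only [hω, if_pos hβl]
    · have hβl : β l = 0 := by
        by_contra h
        have := hsign l h
        rw [hl, sign_zero] at this
        exact h (sign_eq_zero_iff.1 this.symm)
      rw [hres]
      exact (hoff l hβl).trans (hw l hβl hTl)
    · by_cases h : β l = 0
      · exact hb0 l h
      · exact absurd hl (hT l h)
  rw [hbb]
  by_cases h : β j = 0
  · rw [hb0 j h, h]
  · exact hsign j h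

end SignRecovery

/-! ### Regularity of the design of a two-stage model -/

lemma sum_subtype_of_support {η : Type*} [Fintype η] (p : η → Prop) [DecidablePred p]
    (f : η → ℝ) (hf : ∀ h, ¬ p h → f h = 0) : ∑ h : {h // p h}, f h = ∑ h, f h := by
  rw [← Finset.sum_subtype (Finset.univ.filter p) (by simp) f]
  exact Finset.sum_filter_of_ne fun h _ hne => not_not.1 fun hp => hne (hf h hp)

/-- With `y = G⁻¹ δ` the sum is `‖A y‖² = n y'G y = n y'δ`, and the lower bound on `G` gives `‖y‖ ≤
‖δ‖ / τ`. -/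
lemma sum_gram_inv_mulVec_sq_le {n : ℕ} (hn : 0 < n) {κ : Type*} [Fintype κ] [DecidableEq κ]
    (A : Matrix (Fin n) κ ℝ) {τ : ℝ} (hτ : 0 < τ)
    (hA : ∀ y, τ * n * l2 y ^ 2 ≤ l2 (A *ᵥ y) ^ 2) (δ : κ → ℝ) :
    ∑ i, (δ ⬝ᵥ ((gram A)⁻¹ *ᵥ A i)) ^ 2 ≤ n / τ * l2 δ ^ 2 := by
  have hn' : (0 : ℝ) < n := by exact_mod_cast hn
  have hq : ∀ y, n * (y ⬝ᵥ (gram A *ᵥ y)) = l2 (A *ᵥ y) ^ 2 := by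
    intro y
    rw [gram, Matrix.smul_mulVec, dotProduct_smul, ← Matrix.mulVec_mulVec,
      dotProduct_transpose_mulVec, dotProduct_self_eq_l2_sq, smul_eq_mul,
      mul_inv_cancel_left₀ hn'.ne']
  have hunit : IsUnit (gram A) := by
    rw [← Matrix.mulVec_injective_iff_isUnit]
    rw [← Matrix.coe_mulVecLin, ← LinearMap.ker_eq_bot, LinearMap.ker_eq_bot']
    intro y hy
    rw [Matrix.mulVecLin_apply] at hy
    have h1 := hA y
    rw [← hq, hy, dotProduct_zero, mul_zero] at h1
    have h2 : 0 < τ * n := by positivity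
    have h3 : l2 y ^ 2 ≤ 0 := by nlinarith [sq_nonneg (l2 y)]
    exact l2_eq_zero (by nlinarith [l2_nonneg y])
  have hsymm : ((gram A)⁻¹)ᵀ = (gram A)⁻¹ := by
    rw [Matrix.transpose_nonsing_inv, gram, Matrix.transpose_smul, Matrix.transpose_mul,
      Matrix.transpose_transpose]
  set y := (gram A)⁻¹ *ᵥ δ with hy
  have hGy : gram A *ᵥ y = δ := by
    rw [hy, Matrix.mulVec_mulVec,
      Matrix.mul_nonsing_inv _ ((Matrix.isUnit_iff_isUnit_det _).1 hunit), Matrix.one_mulVec]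
  have hsum : ∑ i, (δ ⬝ᵥ ((gram A)⁻¹ *ᵥ A i)) ^ 2 = l2 (A *ᵥ y) ^ 2 := by
    rw [l2_sq]
    refine Finset.sum_congr rfl fun i _ => ?_
    congr 1
    rw [← hsymm, dotProduct_transpose_mulVec, ← hy, dotProduct_comm]
    rfl
  rw [hsum]
  have h1 := hq y
  rw [hGy] at h1
  have h2 := hA y
  have h3 := (le_abs_self _).trans (abs_dotProduct_le y δ)
  have h4 : τ * l2 y ≤ l2 δ := by
    rcases (l2_nonneg y).eq_or_lt with h0 | h0
    · rw [← h0, mul_zero]; exact l2_nonneg δ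
    · refine le_of_mul_le_mul_right ?_ (by positivity : 0 < n * l2 y)
      calc τ * l2 y * (n * l2 y) = τ * n * l2 y ^ 2 := by ring
        _ ≤ n * (y ⬝ᵥ δ) := by rw [h1]; exact h2
        _ ≤ n * (l2 y * l2 δ) := by gcongr
        _ = _ := by ring
  rw [← h1, div_mul_eq_mul_div, le_div_iff₀ hτ]
  calc n * (y ⬝ᵥ δ) * τ ≤ n * (l2 y * l2 δ) * τ := by gcongr
    _ = n * (τ * l2 y * l2 δ) := by ring
    _ ≤ n * (l2 δ * l2 δ) := by gcongr; exact l2_nonneg _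
    _ = _ := by ring

namespace TwoStageModel

variable {Ω : Type*} (S : TwoStageModel Ω)

/-- Regularity of the design at sample size `n`: bounds on the operators `D`, `Z` and `Z₁ j`, and
on the numbers of nonzero entries of the columns and rows of `α`. -/
structure RegularDesign (n : ℕ) (cD CD CZ τ B : ℝ) (K : ℕ) : Prop where
  pos : 0 < n
  lower : ∀ y, cD * √(n : ℝ) * l2 y ≤ l2 (S.D n *ᵥ y)
  upper : ∀ y, l2 (S.D n *ᵥ y) ≤ CD * √(n : ℝ) * l2 y
  instruments : ∀ y, l2 (S.Z n *ᵥ y) ≤ CZ * √(n : ℝ) * l2 y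
  column : ∀ h, l2 ((S.Z n)ᵀ h) ≤ √(n : ℝ)
  relevant : ∀ j y, τ * n * l2 y ^ 2 ≤ l2 (S.Z₁ n j *ᵥ y) ^ 2
  column_sparse : ∀ j, (Finset.univ.filter fun h => S.α n h j ≠ 0).card ≤ K
  row_sparse : ∀ h, ((Finset.univ.filter fun j => S.α n h j ≠ 0).card : ℝ) ≤ B

lemma Z_mulVec_eq_Z₁_mulVec (n : ℕ) (j : Fin (S.p n)) (y : Fin (S.q n) → ℝ)
    (hy : ∀ h, S.α n h j = 0 → y h = 0) :
    S.Z n *ᵥ y = S.Z₁ n j *ᵥ fun h => y h := by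
  ext i
  exact (sum_subtype_of_support (fun h => S.α n h j ≠ 0) (fun h => S.Z n i h * y h)
    fun h hh => by rw [hy h (not_not.1 hh), mul_zero]).symm

lemma l2_restrict_eq (n : ℕ) (j : Fin (S.p n)) (y : Fin (S.q n) → ℝ)
    (hy : ∀ h, S.α n h j = 0 → y h = 0) :
    l2 (fun h : {h // S.α n h j ≠ 0} => y h) ^ 2 = l2 y ^ 2 := by
  rw [l2_sq, l2_sq]
  exact sum_subtype_of_support (fun h => S.α n h j ≠ 0) (fun h => y h ^ 2)
    fun h hh => by rw [hy h (not_not.1 hh)]; ring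

lemma le_mul_sqrt_of_sq_le {x y ρ : ℝ} {n : ℕ} (hρ : 0 ≤ ρ) (hy : 0 ≤ y)
    (h : x ^ 2 ≤ ρ * n * y ^ 2) : x ≤ √ρ * √(n : ℝ) * y := by
  refine le_of_sq_le_sq ?_ (by positivity)
  rw [mul_pow, mul_pow, Real.sq_sqrt hρ, Real.sq_sqrt (Nat.cast_nonneg n)]
  exact h

/-- Gathers every deterministic fact about the design. Both kinds of sparsity of `α` are
consequences of the eigenvalue and coefficient bounds. -/
lemma eventually_regularDesign (hstd : S.StandardizedInstruments)
    (hZeig : S.FirstStageEigenvalues) (hα : S.FirstStageCoefficients)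
    (hdesign : S.SecondStageDesign) :
    ∃ (cD CD CZ τ B : ℝ) (K : ℕ), 0 < cD ∧ 0 < CD ∧ 0 < CZ ∧ 0 < τ ∧ 0 < B ∧
      ∀ᶠ n in atTop, S.RegularDesign n cD CD CZ τ B K := by
  obtain ⟨⟨ρZ, hρZ⟩, τ, τ', hτ, _, hτe⟩ := hZeig
  obtain ⟨a₀, a₁, ha₀, ha, hαe⟩ := hα
  obtain ⟨ρ₁, ρ₂, hρ₁, hρ, hDe⟩ := hdesign.full
  -- One upper bound for both Gram matrices; the `1` ensures positivity, as `ρZ` comes without a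
  -- sign.
  set ρ := max (max ρZ ρ₂) 1 with hρdef
  have hρ0 : 0 < ρ := lt_max_of_lt_right one_pos
  -- A column of `D` has squared norm at most `ρ n`, but with `k` relevant instruments it is at
  -- least `τ n k a₀ ^ 2`.
  set K : ℕ := ⌊ρ / (τ * a₀ ^ 2)⌋₊ with hK
  obtain ⟨B, hB, hrow⟩ := exists_card_row_support_le (ρ := ρ) K hρ0 hτ ha₀ ha
  refine ⟨√ρ₁, √ρ, √ρ, τ, B, K, by positivity, by positivity, by positivity, hτ, hB, ?_⟩
  filter_upwards [hρZ, hτe, hαe, hDe, hstd, eventually_gt_atTop 0] with n h1 h2 h3 h4 h5 hn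
  have hn' : (0 : ℝ) < n := by exact_mod_cast hn
  have up : ∀ {κ : Type} [Fintype κ] {A : Matrix (Fin n) κ ℝ},
      (∀ y, l2 (A *ᵥ y) ^ 2 ≤ ρ * n * l2 y ^ 2) → ∀ y, l2 (A *ᵥ y) ≤ √ρ * √(n : ℝ) * l2 y :=
    fun h y => le_mul_sqrt_of_sq_le hρ0.le (l2_nonneg y) (h y)
  have upT : ∀ {κ : Type} [Fintype κ] {A : Matrix (Fin n) κ ℝ},
      (∀ y, l2 (A *ᵥ y) ^ 2 ≤ ρ * n * l2 y ^ 2) →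
      ∀ z, l2 (Aᵀ *ᵥ z) ^ 2 ≤ ρ * n * l2 z ^ 2 := by
    intro κ _ A h z
    have := pow_le_pow_left₀ (l2_nonneg _)
      (l2_transpose_mulVec_le (by positivity) (up h) z) 2
    rwa [mul_pow, mul_pow, Real.sq_sqrt hρ0.le, Real.sq_sqrt hn'.le] at this
  have hZup : ∀ y, l2 (S.Z n *ᵥ y) ^ 2 ≤ ρ * n * l2 y ^ 2 := gram_upper_bound hn _ fun μ hμ =>
    (h1 μ hμ).2.le.trans ((le_max_left _ _).trans (le_max_left _ _))
  have hDup : ∀ y, l2 (S.D n *ᵥ y) ^ 2 ≤ ρ * n * l2 y ^ 2 := gram_upper_bound hn _ fun μ hμ =>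
    (h4 μ hμ).2.le.trans ((le_max_right _ _).trans (le_max_left _ _))
  have hDlow : ∀ y, ρ₁ * n * l2 y ^ 2 ≤ l2 (S.D n *ᵥ y) ^ 2 :=
    gram_lower_bound hn _ fun μ hμ => (h4 μ hμ).1.le
  have hrel : ∀ j y, τ * n * l2 y ^ 2 ≤ l2 (S.Z₁ n j *ᵥ y) ^ 2 := fun j =>
    gram_lower_bound hn _ fun μ hμ => (h2 j μ hμ).1.le
  have hlow : ∀ j y, (∀ h, S.α n h j = 0 → y h = 0) →
      τ * n * l2 y ^ 2 ≤ l2 (S.Z n *ᵥ y) ^ 2 := fun j y hy => by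
    rw [S.Z_mulVec_eq_Z₁_mulVec n j y hy, ← S.l2_restrict_eq n j y hy]
    exact hrel j _
  have hcol : ∀ h, l2 ((S.Z n)ᵀ h) ^ 2 = n := fun h => by
    have := (h5 h).2
    rw [inv_mul_eq_iff_eq_mul₀ hn'.ne', mul_one] at this
    rw [l2_sq]
    exact this
  have hsparse : ∀ j, (Finset.univ.filter fun h => S.α n h j ≠ 0).card ≤ K := by
    intro j
    rw [hK]
    refine Nat.le_floor ?_
    rw [le_div_iff₀ (by positivity)]
    have e1 : S.Z n *ᵥ (fun h => S.α n h j) = S.D n *ᵥ Pi.single j 1 := by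
      rw [Matrix.mulVec_single_one]; rfl
    have e2 := hlow j (fun h => S.α n h j) fun h hh => hh
    have e3 := hDup (Pi.single j 1)
    have e4 : l2 (Pi.single j (1 : ℝ) : Fin (S.p n) → ℝ) = 1 := by simp [l2]
    rw [← e1, e4] at e3
    have e5 : ((Finset.univ.filter fun h => S.α n h j ≠ 0).card : ℝ) * a₀ ^ 2 ≤
        l2 (fun h => S.α n h j) ^ 2 := by
      refine le_trans ?_ (card_filter_mul_sq_le (fun h => S.α n h j) ha₀.le)
      gcongr with h
      exact fun hh => (h3 h j hh).1
    refine le_of_mul_le_mul_right ?_ hn'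
    calc _ = τ * n * (((Finset.univ.filter fun h => S.α n h j ≠ 0).card : ℝ) * a₀ ^ 2) := by ring
      _ ≤ τ * n * l2 (fun h => S.α n h j) ^ 2 := by gcongr
      _ ≤ ρ * n * 1 ^ 2 := e2.trans e3
      _ = _ := by ring
  refine ⟨hn, fun y => ?_, up hDup, up hZup, fun h => ?_, hrel, hsparse, fun h => ?_⟩
  · refine le_of_sq_le_sq ?_ (l2_nonneg _)
    rw [mul_pow, mul_pow, Real.sq_sqrt hρ₁.le, Real.sq_sqrt hn'.le]
    exact hDlow y
  · exact Real.le_sqrt_of_sq_le (hcol h).le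
  · exact hrow n (S.q n) (S.p n) (S.Z n) (S.α n) n
      ⟨hn', fun h => (hcol h).le, upT hZup, upT hDup, hlow, fun h j => h3 h j, hsparse⟩ h

end TwoStageModel

/-! ### Sums over pairs of a covariate and a relevant instrument -/

lemma sum_sum_eq_sum_sigma {κ : Type*} [Fintype κ] {η : κ → Type*} [∀ j, Fintype (η j)]
    (f : (j : κ) → η j → ℝ) : ∑ j, ∑ h, f j h = ∑ t : (Σ j, η j), f t.1 t.2 :=
  (Fintype.sum_sigma fun t : (Σ j, η j) => f t.1 t.2).symm

lemma exists_coordinate_selector {κ : Type*} [Fintype κ] {η : κ → Type*} [∀ j, Fintype (η j)]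
    (j : κ) (h : η j) : ∃ δ : (j : κ) → η j → ℝ, ∑ j, ∑ h, δ j h ^ 2 ≤ (1 : ℝ) ^ 2 ∧
      ∀ f : (j : κ) → η j → ℝ, ∑ j, ∑ h, δ j h * f j h = f j h := by
  classical
  refine ⟨fun j' h' => if (⟨j', h'⟩ : Σ j, η j) = ⟨j, h⟩ then 1 else 0, ?_, fun f => ?_⟩
  · rw [sum_sum_eq_sum_sigma]
    simp
  · rw [sum_sum_eq_sum_sigma]
    simp

lemma abs_sum_sum_mul_le {κ : Type*} [Fintype κ] {η : κ → Type*} [∀ j, Fintype (η j)]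
    (x y : (j : κ) → η j → ℝ) {a b : ℝ} (ha : 0 ≤ a) (hb : 0 ≤ b)
    (hx : ∑ j, ∑ h, x j h ^ 2 ≤ a ^ 2) (hy : ∑ j, ∑ h, y j h ^ 2 ≤ b ^ 2) :
    |∑ j, ∑ h, x j h * y j h| ≤ a * b := by
  rw [sum_sum_eq_sum_sigma] at hx hy ⊢
  have h1 := abs_dotProduct_le (fun t : (Σ j, η j) => x t.1 t.2) (fun t => y t.1 t.2)
  exact h1.trans (mul_le_mul (l2_le_of_sum_sq_le ha hx) (l2_le_of_sum_sq_le hb hy)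
    (l2_nonneg _) ha)

lemma measure_lt_sum_sq_le {Ω : Type*} [MeasurableSpace Ω] {P : Measure Ω} {ι : Type*}
    [Fintype ι] {W : ι → Ω → ℝ} (hW : ∀ t, Measurable (W t)) {E M N : ℝ} (hE : 0 ≤ E) (hM : 0 < M)
    (h : ∀ t, ∫⁻ ω, ENNReal.ofReal (W t ω ^ 2) ∂P ≤ ENNReal.ofReal E)
    (hN : (Fintype.card ι : ℝ) ≤ N) :
    P {ω | M < ∑ t, W t ω ^ 2} ≤ ENNReal.ofReal (N * E / M) := by
  have hm : ∀ t, Measurable fun ω => ENNReal.ofReal (W t ω ^ 2) := fun t =>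
    ((hW t).pow_const 2).ennreal_ofReal
  have hsub : {ω | M < ∑ t, W t ω ^ 2} ⊆
      {ω | ENNReal.ofReal M ≤ ∑ t, ENNReal.ofReal (W t ω ^ 2)} := by
    intro ω hω
    simp only [Set.mem_ofPred_eq] at hω ⊢
    rw [← ENNReal.ofReal_sum_of_nonneg fun t _ => sq_nonneg (W t ω)]
    exact ENNReal.ofReal_le_ofReal hω.le
  refine (measure_mono hsub).trans ((meas_ge_le_lintegral_div
    (Finset.measurable_sum _ fun t _ => hm t).aemeasurable (by simpa using hM)
    ENNReal.ofReal_ne_top).trans ?_)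
  rw [lintegral_finsetSum _ fun t _ => hm t, ENNReal.ofReal_div_of_pos hM]
  refine ENNReal.div_le_div_right ?_ _
  calc ∑ t, ∫⁻ ω, ENNReal.ofReal (W t ω ^ 2) ∂P ≤ ∑ _t : ι, ENNReal.ofReal E :=
        Finset.sum_le_sum fun t _ => h t
    _ = ENNReal.ofReal (Fintype.card ι * E) := by
        rw [ENNReal.ofReal_mul (Nat.cast_nonneg _)]; simp
    _ ≤ _ := ENNReal.ofReal_le_ofReal (mul_le_mul_of_nonneg_right hN hE)

/-! ### Moments and tails of the errors and of the first-stage linear terms -/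

namespace TwoStageModel

variable {Ω : Type*} (S : TwoStageModel Ω) [MeasurableSpace Ω] (P : Measure Ω)

/-- Second moments and tails of the weighted sums of the errors. -/
structure NoiseBounds (d V c : ℝ) : Prop where
  eps_sq : ∀ (n : ℕ) (a : Fin n → ℝ) (A : ℝ), 0 ≤ A → l2 a ≤ A →
    ∫⁻ ω, ENNReal.ofReal ((∑ i, a i * S.eps n i ω) ^ 2) ∂P ≤ ENNReal.ofReal (V * A ^ 2)
  eps_tail : ∀ (n : ℕ) (a : Fin n → ℝ) (A : ℝ), 0 ≤ A → l2 a ≤ A → ∀ t, 1 ≤ t →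
    P {ω | A * t < |∑ i, a i * S.eps n i ω|} ≤ ENNReal.ofReal (2 * Real.exp (-c * t ^ d))
  v_sq : ∀ (n : ℕ) (a : Fin n → Fin (S.p n) → ℝ) (A : ℝ), 0 ≤ A → ∑ i, ∑ j, a i j ^ 2 ≤ A ^ 2 →
    ∫⁻ ω, ENNReal.ofReal ((∑ i, ∑ j, a i j * S.v n i j ω) ^ 2) ∂P ≤ ENNReal.ofReal (V * A ^ 2)
  v_tail : ∀ (n : ℕ) (a : Fin n → Fin (S.p n) → ℝ) (A : ℝ), 0 ≤ A →
    ∑ i, ∑ j, a i j ^ 2 ≤ A ^ 2 → ∀ t, 1 ≤ t →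
    P {ω | A * t < |∑ i, ∑ j, a i j * S.v n i j ω|} ≤
      ENNReal.ofReal (2 * Real.exp (-c * t ^ d))

variable {S P}

lemma measurable_eps (hiid : S.ErrorsIID P) (n : ℕ) (i : Fin n) : Measurable (S.eps n i) :=
  (Finset.measurable_sum _ fun j _ => (hiid.measurable_v n i j).mul_const _).add
    (hiid.measurable_u n i)

/-- The composite errors need their own tail assumption: their sub-Gaussian constant from the joint
condition would grow with the norm of `β₀`. For `v` the joint condition gives exponent `2`, which is
weakened to `d ≤ 2` for `t ≥ 1`, so one pair of constants serves both. -/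
lemma exists_noiseBounds [IsProbabilityMeasure P] (hiid : S.ErrorsIID P)
    (hsub : S.JointlySubGaussian P) {d : ℝ} (hd₁ : 1 ≤ d) (hd₂ : d ≤ 2) (htail : S.EpsTail P d) :
    ∃ V c : ℝ, 0 < V ∧ 0 < c ∧ S.NoiseBounds P d V c := by
  obtain ⟨K, C, hK, hC, htail⟩ := htail
  obtain ⟨c₀, hsub⟩ := hsub
  obtain ⟨V₁, c₁, hV₁, hc₁, h₁⟩ := exists_weighted_sum_bounds (P := P) hd₁ hd₂ hK hC
  obtain ⟨V₂, c₂, hV₂, hc₂, h₂⟩ := exists_weighted_subgaussian_bounds (P := P) c₀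
  have hexp : ∀ t : ℝ, 1 ≤ t →
      ENNReal.ofReal (2 * Real.exp (-c₁ * t ^ d)) ≤
        ENNReal.ofReal (2 * Real.exp (-(min c₁ c₂) * t ^ d)) := fun t ht => by
    have : 0 ≤ t ^ d := Real.rpow_nonneg (by linarith) d
    refine ENNReal.ofReal_le_ofReal (mul_le_mul_of_nonneg_left (Real.exp_le_exp.2 ?_) two_pos.le)
    nlinarith [min_le_left c₁ c₂]
  have hexp' : ∀ t : ℝ, 1 ≤ t →
      ENNReal.ofReal (2 * Real.exp (-c₂ * t ^ 2)) ≤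
        ENNReal.ofReal (2 * Real.exp (-(min c₁ c₂) * t ^ d)) := fun t ht => by
    have h0 : 0 ≤ t ^ d := Real.rpow_nonneg (by linarith) d
    have h1 : t ^ d ≤ t ^ 2 := by
      rw [← Real.rpow_natCast t 2]
      exact Real.rpow_le_rpow_of_exponent_le ht (by exact_mod_cast hd₂)
    refine ENNReal.ofReal_le_ofReal (mul_le_mul_of_nonneg_left (Real.exp_le_exp.2 ?_) two_pos.le)
    nlinarith [min_le_right c₁ c₂]
  have heps : ∀ n, iIndepFun (fun i => S.eps n i) P := fun n =>
    (hiid.indep n).comp (fun _ (x : ℝ × (Fin (S.p n) → ℝ)) => ∑ j, x.2 j * S.β₀ n j + x.1)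
      fun i => (Finset.measurable_sum _ fun j _ =>
        ((measurable_pi_apply j).comp measurable_snd).mul_const _).add measurable_fst
  have hv : ∀ n, iIndepFun (fun (i : Fin n) ω j => S.v n i j ω) P := fun n =>
    (hiid.indep n).comp (fun _ (x : ℝ × (Fin (S.p n) → ℝ)) => x.2) fun i => measurable_snd
  have hmean : ∀ n i, ∫ ω, S.eps n i ω ∂P = 0 := by
    intro n i
    have hvi : ∀ j, Integrable (fun ω => S.v n i j ω * S.β₀ n j) P := fun j =>
      ((hiid.memLp_v n i j).integrable one_le_two).mul_const _
    unfold eps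
    rw [integral_add (integrable_finsetSum _ fun j _ => hvi j)
      ((hiid.memLp_u n i).integrable one_le_two), integral_finsetSum _ fun j _ => hvi j,
      hiid.mean_u]
    simp [integral_mul_const, hiid.mean_v]
  have hcv : ∀ n (i : Fin n) (a : Fin (S.p n) → ℝ), l2 a ≤ 1 →
      HasSubgaussianMGF (fun ω => ∑ j, a j * S.v n i j ω) c₀ P := by
    intro n i a ha
    have h := hsub n i 0 a (by
      rw [← l2_sq, zero_pow two_ne_zero, zero_add]; exact pow_le_one₀ (l2_nonneg a) ha)
    simpa using h
  refine ⟨max V₁ V₂, min c₁ c₂, lt_max_of_lt_left hV₁, lt_min hc₁ hc₂,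
    ⟨fun n a A hA ha => ?_, fun n a A hA ha t ht => ?_, fun n a A hA ha => ?_,
      fun n a A hA ha t ht => ?_⟩⟩
  · refine (h₁ (fun i => S.eps n i) (heps n) (measurable_eps hiid n) (hmean n) (htail n)
      a A hA ha).1.trans (ENNReal.ofReal_le_ofReal ?_)
    exact mul_le_mul_of_nonneg_right (le_max_left _ _) (sq_nonneg A)
  · exact ((h₁ (fun i => S.eps n i) (heps n) (measurable_eps hiid n) (hmean n) (htail n)
      a A hA ha).2 t ht).trans (hexp t ht)
  · refine (h₂ (S.v n) (hv n) (hcv n) a A hA ha).1.trans (ENNReal.ofReal_le_ofReal ?_)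
    exact mul_le_mul_of_nonneg_right (le_max_right _ _) (sq_nonneg A)
  · exact ((h₂ (S.v n) (hv n) (hcv n) a A hA ha).2 t (by linarith)).trans (hexp' t ht)

variable (S)

/-- The linear term `n^{-1/2} ∑_i Σ_1j⁻¹ Z_1ij v_ij` of the oracle estimator. -/
noncomputable def linearTerm (n : ℕ) (ω : Ω) (j : Fin (S.p n)) :
    {h : Fin (S.q n) // S.α n h j ≠ 0} → ℝ :=
  fun h => (√(n : ℝ))⁻¹ *
    ∑ i, ((gram (S.Z₁ n j))⁻¹ *ᵥ (fun h' => S.Z₁ n j i h')) h * S.v n i j ω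

/-- The weights of the errors `v` in a linear combination of the linear terms. -/
noncomputable def linearWeight (n : ℕ)
    (δ : (j : Fin (S.p n)) → {h : Fin (S.q n) // S.α n h j ≠ 0} → ℝ)
    (i : Fin n) (j : Fin (S.p n)) : ℝ :=
  (√(n : ℝ))⁻¹ * (δ j ⬝ᵥ ((gram (S.Z₁ n j))⁻¹ *ᵥ S.Z₁ n j i))

omit [MeasurableSpace Ω] in
lemma sum_mul_linearTerm (n : ℕ) (ω : Ω)
    (δ : (j : Fin (S.p n)) → {h : Fin (S.q n) // S.α n h j ≠ 0} → ℝ) :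
    ∑ j, ∑ h, δ j h * S.linearTerm n ω j h =
      ∑ i, ∑ j, S.linearWeight n δ i j * S.v n i j ω := by
  rw [Finset.sum_comm (s := (Finset.univ : Finset (Fin n)))]
  refine Finset.sum_congr rfl fun j _ => ?_
  simp only [linearTerm, linearWeight, dotProduct, Finset.mul_sum, Finset.sum_mul]
  rw [Finset.sum_comm]
  refine Finset.sum_congr rfl fun i _ => Finset.sum_congr rfl fun h _ => ?_
  have : (fun h' => S.Z₁ n j i h') = S.Z₁ n j i := rfl
  rw [this]
  ring

variable {S} {cD CD CZ τ B : ℝ} {K n : ℕ}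

omit [MeasurableSpace Ω] in
lemma RegularDesign.sum_linearWeight_sq_le (hR : S.RegularDesign n cD CD CZ τ B K) (hτ : 0 < τ)
    (δ : (j : Fin (S.p n)) → {h : Fin (S.q n) // S.α n h j ≠ 0} → ℝ) {A : ℝ}
    (hδ : ∑ j, ∑ h, δ j h ^ 2 ≤ A ^ 2) :
    ∑ i, ∑ j, S.linearWeight n δ i j ^ 2 ≤ (A / √τ) ^ 2 := by
  have hn : (0 : ℝ) < n := by exact_mod_cast hR.pos
  rw [Finset.sum_comm]
  calc ∑ j, ∑ i, S.linearWeight n δ i j ^ 2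
      = ∑ j, (n : ℝ)⁻¹ * ∑ i, (δ j ⬝ᵥ ((gram (S.Z₁ n j))⁻¹ *ᵥ S.Z₁ n j i)) ^ 2 := by
        refine Finset.sum_congr rfl fun j _ => ?_
        rw [Finset.mul_sum]
        refine Finset.sum_congr rfl fun i _ => ?_
        rw [linearWeight, mul_pow, inv_pow, Real.sq_sqrt hn.le]
    _ ≤ ∑ j, (n : ℝ)⁻¹ * (n / τ * l2 (δ j) ^ 2) := by
        refine Finset.sum_le_sum fun j _ => mul_le_mul_of_nonneg_left ?_ (by positivity)
        exact sum_gram_inv_mulVec_sq_le hR.pos _ hτ (hR.relevant j) _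
    _ = (∑ j, ∑ h, δ j h ^ 2) / τ := by
        rw [Finset.sum_div]
        refine Finset.sum_congr rfl fun j _ => ?_
        rw [l2_sq]; field_simp
    _ ≤ _ := by
        rw [div_pow, Real.sq_sqrt hτ.le]
        exact div_le_div_of_nonneg_right hδ hτ.le

lemma measurable_linearTerm (hiid : S.ErrorsIID P) (n : ℕ) (j : Fin (S.p n))
    (h : {h : Fin (S.q n) // S.α n h j ≠ 0}) : Measurable fun ω => S.linearTerm n ω j h :=
  (Finset.measurable_sum _ fun i _ => (hiid.measurable_v n i j).const_mul _).const_mul _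

omit [MeasurableSpace Ω] in
lemma RegularDesign.card_sigma_le (hR : S.RegularDesign n cD CD CZ τ B K) :
    (Fintype.card (Σ j : Fin (S.p n), {h : Fin (S.q n) // S.α n h j ≠ 0}) : ℝ) ≤ S.p n * K := by
  rw [Fintype.card_sigma]
  have h : ∀ j : Fin (S.p n), Fintype.card {h : Fin (S.q n) // S.α n h j ≠ 0} ≤ K := fun j => by
    rw [Fintype.card_subtype]; exact hR.column_sparse j
  have := Finset.sum_le_card_nsmul Finset.univ _ K fun j _ => h j
  simp only [Finset.card_univ, Fintype.card_fin, smul_eq_mul] at this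
  exact_mod_cast this

variable {d V c : ℝ}

lemma NoiseBounds.linearTerm_tail (hN : S.NoiseBounds P d V c)
    (hR : S.RegularDesign n cD CD CZ τ B K) (hτ : 0 < τ)
    (δ : (j : Fin (S.p n)) → {h : Fin (S.q n) // S.α n h j ≠ 0} → ℝ) {A : ℝ} (hA : 0 ≤ A)
    (hδ : ∑ j, ∑ h, δ j h ^ 2 ≤ A ^ 2) {t : ℝ} (ht : 1 ≤ t) :
    P {ω | A / √τ * t < |∑ j, ∑ h, δ j h * S.linearTerm n ω j h|} ≤
      ENNReal.ofReal (2 * Real.exp (-c * t ^ d)) := by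
  simp only [sum_mul_linearTerm]
  exact hN.v_tail n _ _ (by positivity) (hR.sum_linearWeight_sq_le hτ δ hδ) t ht

/-- Each coordinate has second moment at most `V / τ`, by choosing `δ` as a coordinate selector, and
column sparsity leaves at most `K p` coordinates. Markov's inequality does the rest. -/
lemma NoiseBounds.linearTerm_sq (hN : S.NoiseBounds P d V c) (hiid : S.ErrorsIID P)
    (hR : S.RegularDesign n cD CD CZ τ B K) (hτ : 0 < τ) (hV : 0 < V) {M : ℝ} (hM : 0 < M)
    (hp : 0 < S.p n) :
    P {ω | M * S.p n < ∑ j, ∑ h, S.linearTerm n ω j h ^ 2} ≤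
      ENNReal.ofReal (K * (V / τ) / M) := by
  classical
  have hp' : (0 : ℝ) < S.p n := by exact_mod_cast hp
  set W : (Σ j : Fin (S.p n), {h : Fin (S.q n) // S.α n h j ≠ 0}) → Ω → ℝ :=
    fun t ω => S.linearTerm n ω t.1 t.2 with hW
  have hsq : ∀ t, ∫⁻ ω, ENNReal.ofReal (W t ω ^ 2) ∂P ≤ ENNReal.ofReal (V / τ) := by
    rintro ⟨j, h⟩
    obtain ⟨δ, h1, h2⟩ :=
      exists_coordinate_selector (η := fun j => {h : Fin (S.q n) // S.α n h j ≠ 0}) j h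
    have h3 : ∀ ω, W ⟨j, h⟩ ω = ∑ i, ∑ j, S.linearWeight n δ i j * S.v n i j ω :=
      fun ω => by rw [← sum_mul_linearTerm, h2]
    simp only [h3]
    refine (hN.v_sq n _ _ (by positivity) (hR.sum_linearWeight_sq_le hτ δ h1)).trans_eq ?_
    rw [div_pow, Real.sq_sqrt hτ.le, one_pow, mul_one_div]
  have hmeas : ∀ t, Measurable (W t) := fun t => measurable_linearTerm hiid n t.1 t.2
  have e : ∀ ω, ∑ j, ∑ h, S.linearTerm n ω j h ^ 2 = ∑ t, W t ω ^ 2 := fun ω =>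
    sum_sum_eq_sum_sigma _
  simp only [e]
  clear_value W
  have hE : 0 ≤ V / τ := by positivity
  have hMp : 0 < M * S.p n := by positivity
  refine (measure_lt_sum_sq_le hmeas hE hMp hsq hR.card_sigma_le).trans_eq ?_
  rw [mul_assoc, mul_comm M, mul_div_mul_left _ _ hp'.ne']

lemma NoiseBounds.instruments_sq (hN : S.NoiseBounds P d V c) (hiid : S.ErrorsIID P)
    (hR : S.RegularDesign n cD CD CZ τ B K) (hV : 0 < V) {M : ℝ} (hM : 0 < M)
    (hp : 0 < S.p n) :
    P {ω | M * (n * S.p n) < ∑ j, ∑ h : {h : Fin (S.q n) // S.α n h j ≠ 0},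
        ((S.Z n)ᵀ *ᵥ fun i => S.eps n i ω) h ^ 2} ≤ ENNReal.ofReal (K * V / M) := by
  have hp' : (0 : ℝ) < S.p n := by exact_mod_cast hp
  have hn : (0 : ℝ) < n := by exact_mod_cast hR.pos
  have e : ∀ ω, ∑ j, ∑ h : {h : Fin (S.q n) // S.α n h j ≠ 0},
        ((S.Z n)ᵀ *ᵥ fun i => S.eps n i ω) h ^ 2 =
      ∑ t : (Σ j : Fin (S.p n), {h : Fin (S.q n) // S.α n h j ≠ 0}),
        (∑ i, (S.Z n)ᵀ t.2 i * S.eps n i ω) ^ 2 := fun ω =>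
      sum_sum_eq_sum_sigma _
  simp only [e]
  refine (measure_lt_sum_sq_le (fun t => Finset.measurable_sum _ fun i _ =>
    (measurable_eps hiid n i).const_mul _)
    (E := V * n) (by positivity) (by positivity) (fun t => ?_) hR.card_sigma_le).trans_eq ?_
  · refine (hN.eps_sq n _ _ (Real.sqrt_nonneg _) (hR.column t.2)).trans_eq ?_
    rw [Real.sq_sqrt hn.le]
  · congr 1
    field_simp

lemma NoiseBounds.design_sq (hN : S.NoiseBounds P d V c) (hiid : S.ErrorsIID P)
    (hR : S.RegularDesign n cD CD CZ τ B K) (hCD : 0 < CD) (hV : 0 < V) {M : ℝ} (hM : 0 < M)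
    (hp : 0 < S.p n) :
    P {ω | M * (n * S.p n) < ∑ j, ((S.D n)ᵀ *ᵥ fun i => S.eps n i ω) j ^ 2} ≤
      ENNReal.ofReal (V * CD ^ 2 / M) := by
  have hp' : (0 : ℝ) < S.p n := by exact_mod_cast hp
  have hn : (0 : ℝ) < n := by exact_mod_cast hR.pos
  refine (measure_lt_sum_sq_le (W := fun j ω => ∑ i, (S.D n)ᵀ j i * S.eps n i ω)
    (fun j => Finset.measurable_sum _ fun i _ => (measurable_eps hiid n i).const_mul _)
    (E := V * (CD * √(n : ℝ)) ^ 2) (N := S.p n) (by positivity) (by positivity)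
    (fun j => ?_) (by simp)).trans_eq ?_
  · refine hN.eps_sq n _ _ (by positivity) ?_
    have h1 := hR.upper (Pi.single j 1)
    have h2 : l2 (Pi.single j (1 : ℝ) : Fin (S.p n) → ℝ) = 1 := by simp [l2]
    rw [h2, mul_one, Matrix.mulVec_single_one] at h1
    exact h1
  · congr 1
    rw [mul_pow, Real.sq_sqrt hn.le]
    field_simp

end TwoStageModel

/-! ### Sign recovery on an event of high probability -/

lemma l2_mulVec_le_of_sum_sq_le {η κ : Type*} [Fintype η] [Fintype κ] {A : Matrix η κ ℝ} {φ : ℝ}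
    (hφ : 0 ≤ φ) (hA : ∑ j, ∑ h, A h j ^ 2 ≤ φ ^ 2) (y : κ → ℝ) : l2 (A *ᵥ y) ≤ φ * l2 y := by
  refine l2_le_of_sum_sq_le (mul_nonneg hφ (l2_nonneg y)) ?_
  calc ∑ h, (A *ᵥ y) h ^ 2 ≤ ∑ h, (∑ j, A h j ^ 2) * ∑ j, y j ^ 2 :=
        Finset.sum_le_sum fun h _ => Finset.sum_mul_sq_le_sq_mul_sq _ _ _
    _ = (∑ j, ∑ h, A h j ^ 2) * l2 y ^ 2 := by
        rw [← Finset.sum_mul, Finset.sum_comm, l2_sq]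
    _ ≤ φ ^ 2 * l2 y ^ 2 := by gcongr
    _ = _ := by ring

namespace TwoStageModel

variable {Ω : Type*} (S : TwoStageModel Ω)

/-- The weights of the first-stage estimation errors in the inner product of a vector `a` with
the error of the fitted values. -/
def crossWeight (n : ℕ) (a : Fin n → ℝ) (j : Fin (S.p n)) :
    {h : Fin (S.q n) // S.α n h j ≠ 0} → ℝ :=
  fun h => S.β₀ n j * ((S.Z n)ᵀ *ᵥ a) h

/-- The event on which the adaptive LASSO recovers the signs. The family `c` consists of the
residual combinations of the irrelevant covariates. -/
structure GoodEvent (n : ℕ) (ω : Ω) (c : Fin (S.p n) → Fin (S.p n) → ℝ)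
    (M ξ MT r E₁ E₂ : ℝ) (b : Fin (S.p n) → ℝ) : Prop where
  selection : ∀ h j, S.alphaHat n ω h j = 0 ↔ S.α n h j = 0
  remainder : ∑ j, ∑ h, S.oracleRemainder n ω j h ^ 2 ≤ 1
  linear : ∑ j, ∑ h, S.linearTerm n ω j h ^ 2 ≤ M * S.p n
  instruments : ∑ j, ∑ h : {h : Fin (S.q n) // S.α n h j ≠ 0},
    ((S.Z n)ᵀ *ᵥ fun i => S.eps n i ω) h ^ 2 ≤ M * (n * S.p n)
  design : ∑ j, ((S.D n)ᵀ *ᵥ fun i => S.eps n i ω) j ^ 2 ≤ M * (n * S.p n)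
  noise : ∀ j, S.β₀ n j = 0 → |∑ i, (S.D n *ᵥ c j) i * S.eps n i ω| ≤ E₁
  cross : ∀ j, S.β₀ n j = 0 →
    |∑ l, ∑ h, S.crossWeight n (S.D n *ᵥ c j) l h * S.linearTerm n ω l h| ≤ E₂
  irrelevant : ∀ j, S.β₀ n j = 0 → r * |S.betaTilde n ω j| ≤ MT
  relevant : ∀ j, S.β₀ n j ≠ 0 → ξ ≤ |S.betaTilde n ω j|
  lasso : S.IsAdaptiveLasso n ω b

variable {S} {n : ℕ} {ω : Ω} {c : Fin (S.p n) → Fin (S.p n) → ℝ}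
  {M ξ MT r E₁ E₂ cD CD CZ τ B b₀ b₁ Cc X : ℝ} {K : ℕ} {b : Fin (S.p n) → ℝ}

/-- Row sparsity enters here. After exchanging the sums, the square of each coordinate `(Z'a)_h` is
counted once for every covariate that uses instrument `h`, hence at most `B` times, so the norm does
not grow with the number of covariates. -/
lemma RegularDesign.sum_crossWeight_sq_le (hR : S.RegularDesign n cD CD CZ τ B K)
    (hCZ : 0 < CZ) (hB : 0 < B) (hb₁ : 0 < b₁)
    (hβ : ∀ j, |S.β₀ n j| ≤ b₁) {a : Fin n → ℝ} {A : ℝ}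
    (ha : l2 a ≤ A * √(n : ℝ)) :
    ∑ j, ∑ h, S.crossWeight n a j h ^ 2 ≤ (b₁ * √B * CZ * A * n) ^ 2 := by
  have hn : (0 : ℝ) < n := by exact_mod_cast hR.pos
  have h1 : l2 ((S.Z n)ᵀ *ᵥ a) ≤ CZ * A * n := by
    calc _ ≤ CZ * √(n : ℝ) * l2 a := l2_transpose_mulVec_le (by positivity) hR.instruments a
      _ ≤ CZ * √(n : ℝ) * (A * √(n : ℝ)) := by gcongr
      _ = CZ * A * (√(n : ℝ) * √(n : ℝ)) := by ring
      _ = _ := by rw [Real.mul_self_sqrt hn.le]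
  calc ∑ j, ∑ h, S.crossWeight n a j h ^ 2
      ≤ ∑ j, ∑ h : {h : Fin (S.q n) // S.α n h j ≠ 0}, b₁ ^ 2 * ((S.Z n)ᵀ *ᵥ a) h ^ 2 := by
        refine Finset.sum_le_sum fun j _ => Finset.sum_le_sum fun h _ => ?_
        rw [crossWeight, mul_pow]
        refine mul_le_mul_of_nonneg_right ?_ (sq_nonneg _)
        rw [← sq_abs (S.β₀ n j)]
        exact pow_le_pow_left₀ (abs_nonneg _) (hβ j) 2
    _ = ∑ j, ∑ h, if S.α n h j ≠ 0 then b₁ ^ 2 * ((S.Z n)ᵀ *ᵥ a) h ^ 2 else 0 := by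
        refine Finset.sum_congr rfl fun j _ => ?_
        rw [← sum_subtype_of_support (fun h => S.α n h j ≠ 0)
          (fun h => if S.α n h j ≠ 0 then b₁ ^ 2 * ((S.Z n)ᵀ *ᵥ a) h ^ 2 else 0)
          fun h hh => if_neg hh]
        exact Finset.sum_congr rfl fun h _ => (if_pos h.2).symm
    _ = ∑ h, ((Finset.univ.filter fun j => S.α n h j ≠ 0).card : ℝ) *
          (b₁ ^ 2 * ((S.Z n)ᵀ *ᵥ a) h ^ 2) := by
        rw [Finset.sum_comm]
        refine Finset.sum_congr rfl fun h _ => ?_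
        rw [← Finset.sum_filter, Finset.sum_const, nsmul_eq_mul]
    _ ≤ ∑ h, B * (b₁ ^ 2 * ((S.Z n)ᵀ *ᵥ a) h ^ 2) := by
        refine Finset.sum_le_sum fun h _ => mul_le_mul_of_nonneg_right (hR.row_sparse h) ?_
        positivity
    _ = B * b₁ ^ 2 * l2 ((S.Z n)ᵀ *ᵥ a) ^ 2 := by
        rw [l2_sq, Finset.mul_sum]
        exact Finset.sum_congr rfl fun h _ => by ring
    _ ≤ B * b₁ ^ 2 * (CZ * A * n) ^ 2 := by
        have := l2_nonneg ((S.Z n)ᵀ *ᵥ a)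
        gcongr
    _ = _ := by
        simp only [mul_pow, Real.sq_sqrt hB.le]; ring

lemma DHat_eq_add (n : ℕ) (ω : Ω) :
    S.DHat n ω = S.D n + S.Z n * (S.alphaHat n ω - S.α n) := by
  rw [Matrix.mul_sub, DHat, D]; abel

lemma Y_eq_add (n : ℕ) (ω : Ω) :
    S.Y n ω = S.D n *ᵥ S.β₀ n + fun i => S.eps n i ω := by
  ext i
  simp only [Y, X, eps, D, Pi.add_apply, Matrix.mulVec, dotProduct, add_mul,
    Finset.sum_add_distrib]
  ring

namespace GoodEvent

lemma alphaHat_sub_eq (hn : 0 < n) (j : Fin (S.p n)) (h : {h : Fin (S.q n) // S.α n h j ≠ 0}) :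
    (S.alphaHat n ω - S.α n) h j =
      (√(n : ℝ))⁻¹ * (S.oracleRemainder n ω j h + S.linearTerm n ω j h) := by
  have hn' : (0 : ℝ) < √(n : ℝ) := Real.sqrt_pos.2 (by exact_mod_cast hn)
  rw [oracleRemainder, linearTerm, sub_add_cancel, inv_mul_cancel_left₀ hn'.ne']
  rfl

lemma alphaHat_sub_eq_zero (hG : S.GoodEvent n ω c M ξ MT r E₁ E₂ b) {h : Fin (S.q n)}
    {j : Fin (S.p n)} (hα : S.α n h j = 0) : (S.alphaHat n ω - S.α n) h j = 0 := by
  rw [Matrix.sub_apply, (hG.selection h j).2 hα, hα, sub_zero]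

/-- Correct selection confines the error to the support of `α`, where it is `n^{-1/2}` times
remainder plus linear term. The remainder contributes at most `1 ≤ p`, the linear term at most `M
p`. -/
lemma sum_sq_alphaHat_sub_le (hG : S.GoodEvent n ω c M ξ MT r E₁ E₂ b) (hn : 0 < n) (hM : 0 ≤ M)
    (hp : 1 ≤ S.p n) :
    ∑ j, ∑ h, (S.alphaHat n ω - S.α n) h j ^ 2 ≤
      (√(2 * (1 + M)) * √(S.p n : ℝ) / √(n : ℝ)) ^ 2 := by
  have hn' : (0 : ℝ) < n := by exact_mod_cast hn
  have hp' : (1 : ℝ) ≤ S.p n := by exact_mod_cast hp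
  have h1 : ∑ j, ∑ h, (S.alphaHat n ω - S.α n) h j ^ 2 =
      ∑ j, ∑ h : {h : Fin (S.q n) // S.α n h j ≠ 0}, (S.alphaHat n ω - S.α n) h j ^ 2 := by
    refine Finset.sum_congr rfl fun j _ => ?_
    exact (sum_subtype_of_support (fun h => S.α n h j ≠ 0)
      (fun h => (S.alphaHat n ω - S.α n) h j ^ 2)
      fun h hh => by rw [hG.alphaHat_sub_eq_zero (not_not.1 hh)]; ring).symm
  rw [h1]
  calc _ ≤ ∑ j, ∑ h, (n : ℝ)⁻¹ *
        (2 * S.oracleRemainder n ω j h ^ 2 + 2 * S.linearTerm n ω j h ^ 2) := by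
        refine Finset.sum_le_sum fun j _ => Finset.sum_le_sum fun h _ => ?_
        rw [alphaHat_sub_eq hn, mul_pow, inv_pow, Real.sq_sqrt hn'.le]
        refine mul_le_mul_of_nonneg_left ?_ (by positivity)
        nlinarith [sq_nonneg (S.oracleRemainder n ω j h - S.linearTerm n ω j h)]
    _ = (n : ℝ)⁻¹ * (2 * ∑ j, ∑ h, S.oracleRemainder n ω j h ^ 2 +
          2 * ∑ j, ∑ h, S.linearTerm n ω j h ^ 2) := by
        simp only [Finset.mul_sum, mul_add, Finset.sum_add_distrib]
    _ ≤ (n : ℝ)⁻¹ * (2 * (S.p n : ℝ) + 2 * (M * S.p n)) := by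
        have := hG.remainder
        have := hG.linear
        gcongr
        linarith
    _ = _ := by
        rw [div_pow, mul_pow, Real.sq_sqrt (by positivity), Real.sq_sqrt (by positivity),
          Real.sq_sqrt hn'.le]
        field_simp

/-- On the good event the signs are recovered if the numerical conditions hold. -/
lemma sign_eq (hG : S.GoodEvent n ω c M ξ MT r E₁ E₂ b)
    (hR : S.RegularDesign n cD CD CZ τ B K)
    (hcD : 0 < cD) (hCD : 0 < CD) (hCZ : 0 < CZ) (hB : 0 < B) (hM : 0 < M) (hξ : 0 < ξ)
    (hMT : 0 < MT) (hb₁ : 0 < b₁) (hCc : 0 < Cc) (hlam : 0 < S.lam n)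
    (hp : 1 ≤ S.p n) (hβ₁ : ∀ j, |S.β₀ n j| ≤ b₁) (hβ₀ : ∀ j, S.β₀ n j ≠ 0 → b₀ ≤ |S.β₀ n j|)
    (hc : ∀ j, S.β₀ n j = 0 → IsResidualCombination (S.D n) (S.β₀ n) j (c j) ∧ l2 (c j) ≤ Cc)
    (hg₁ : CZ * √(2 * (1 + M)) * √(S.p n : ℝ) ≤ cD * √(n : ℝ) / 2)
    (hg₂ : CZ * √(2 * (1 + M)) * √(S.p n : ℝ) ≤ CD * √(n : ℝ))
    (hX : √M * (√(n : ℝ) * √(S.p n : ℝ)) + √(2 * (1 + M)) * √M * S.p n +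
      2 * CD * √(n : ℝ) *
        (CZ * √(2 * (1 + M)) * √(S.p n : ℝ) * (b₁ * √(S.k n : ℝ))) +
      ξ⁻¹ * (S.lam n * √(S.k n : ℝ)) ≤ (cD * √(n : ℝ) / 2) ^ 2 * X)
    (hXb : X < b₀)
    (hfin : E₁ + (b₁ * √B * CZ * (CD * Cc) * √(n : ℝ) + (√(n : ℝ))⁻¹ * E₂) +
      Cc * (√(2 * (1 + M)) * √M * S.p n + CZ * √(2 * (1 + M)) * √(S.p n : ℝ) *
        (CZ * √(2 * (1 + M)) * √(S.p n : ℝ) * (b₁ * √(S.k n : ℝ)))) +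
      3 * CD * Cc * √(n : ℝ) * (CZ * √(2 * (1 + M)) * √(S.p n : ℝ)) * X +
      Cc * (ξ⁻¹ * (S.lam n * √(S.k n : ℝ))) ≤ S.lam n * (r / MT)) (j : Fin (S.p n)) :
    SignType.sign (b j) = SignType.sign (S.β₀ n j) := by
  have hn : (0 : ℝ) < n := by exact_mod_cast hR.pos
  have hp' : (1 : ℝ) ≤ S.p n := by exact_mod_cast hp
  have hs : 0 < √(n : ℝ) := Real.sqrt_pos.2 hn
  set Γ := S.alphaHat n ω - S.α n with hΓ
  set ε : Fin n → ℝ := fun i => S.eps n i ω with hε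
  set φ := √(2 * (1 + M)) * √(S.p n : ℝ) / √(n : ℝ) with hφ
  have hφ0 : 0 ≤ φ := by positivity
  have hφn : φ * √(n : ℝ) = √(2 * (1 + M)) * √(S.p n : ℝ) := by
    rw [hφ, div_mul_cancel₀ _ hs.ne']
  have hfro := hG.sum_sq_alphaHat_sub_le hR.pos hM.le hp
  have hΔ : ∀ y, l2 ((S.Z n * Γ) *ᵥ y) ≤ CZ * √(2 * (1 + M)) * √(S.p n : ℝ) * l2 y := by
    intro y
    rw [← Matrix.mulVec_mulVec]
    calc _ ≤ CZ * √(n : ℝ) * l2 (Γ *ᵥ y) := hR.instruments _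
      _ ≤ CZ * √(n : ℝ) * (φ * l2 y) := by
        gcongr; exact l2_mulVec_le_of_sum_sq_le hφ0 hfro y
      _ = CZ * (φ * √(n : ℝ)) * l2 y := by ring
      _ = _ := by rw [hφn]; ring
  have hG₁ : l2 ((S.D n)ᵀ *ᵥ ε) ≤ √M * (√(n : ℝ) * √(S.p n : ℝ)) := by
    refine l2_le_of_sum_sq_le (by positivity) ?_
    rw [mul_pow, mul_pow, Real.sq_sqrt hM.le, Real.sq_sqrt hn.le, Real.sq_sqrt (by positivity)]
    exact hG.design
  have hG₂ : l2 ((S.Z n * Γ)ᵀ *ᵥ ε) ≤ √(2 * (1 + M)) * √M * S.p n := by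
    refine l2_le_of_sum_sq_le (by positivity) ?_
    rw [Matrix.transpose_mul, ← Matrix.mulVec_mulVec]
    set z := (S.Z n)ᵀ *ᵥ ε with hz
    -- Only scores of instruments relevant for `l` meet a nonzero entry of `Γ`, so the total number
    -- of instruments plays no role.
    have h1 : ∀ l, (Γᵀ *ᵥ z) l ^ 2 ≤ (∑ h, Γ h l ^ 2) * (M * (n * S.p n)) := by
      intro l
      have h2 : (Γᵀ *ᵥ z) l = ∑ h : {h : Fin (S.q n) // S.α n h l ≠ 0}, Γ h l * z h :=
        (sum_subtype_of_support (fun h => S.α n h l ≠ 0) (fun h => Γ h l * z h) fun h hh => by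
          rw [hΓ, hG.alphaHat_sub_eq_zero (not_not.1 hh), zero_mul]).symm
      have h3 : ∑ h : {h : Fin (S.q n) // S.α n h l ≠ 0}, Γ h l ^ 2 = ∑ h, Γ h l ^ 2 :=
        sum_subtype_of_support (fun h => S.α n h l ≠ 0) (fun h => Γ h l ^ 2) fun h hh => by
          rw [hΓ, hG.alphaHat_sub_eq_zero (not_not.1 hh)]; ring
      have h4 : ∑ h : {h : Fin (S.q n) // S.α n h l ≠ 0}, z h ^ 2 ≤ M * (n * S.p n) :=
        (Finset.single_le_sum (f := fun l => ∑ h : {h : Fin (S.q n) // S.α n h l ≠ 0}, z h ^ 2)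
          (fun l _ => Finset.sum_nonneg fun h _ => sq_nonneg _) (Finset.mem_univ l)).trans
          hG.instruments
      rw [h2, ← h3]
      exact (Finset.sum_mul_sq_le_sq_mul_sq _ _ _).trans
        (mul_le_mul_of_nonneg_left h4 (Finset.sum_nonneg fun h _ => sq_nonneg _))
    calc ∑ l, (Γᵀ *ᵥ z) l ^ 2 ≤ ∑ l, (∑ h, Γ h l ^ 2) * (M * (n * S.p n)) :=
          Finset.sum_le_sum fun l _ => h1 l
      _ = (∑ l, ∑ h, Γ h l ^ 2) * (M * (n * S.p n)) := by rw [Finset.sum_mul]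
      _ ≤ φ ^ 2 * (M * (n * S.p n)) := by gcongr
      _ = (φ * √(n : ℝ)) ^ 2 * (M * S.p n) := by rw [mul_pow, Real.sq_sqrt hn.le]; ring
      _ = _ := by
        rw [hφn, mul_pow, mul_pow, mul_pow, Real.sq_sqrt (by positivity : (0 : ℝ) ≤ S.p n),
          Real.sq_sqrt hM.le]
        ring
  have hk : ∀ a : ℝ, 0 ≤ a → ∀ f : Fin (S.p n) → ℝ, (∀ j, S.β₀ n j = 0 → f j = 0) →
      (∀ j, |f j| ≤ a) → l2 f ≤ a * √(S.k n : ℝ) := by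
    intro a ha f hf hfa
    refine l2_le_of_sum_sq_le (by positivity) ?_
    rw [mul_pow, Real.sq_sqrt (Nat.cast_nonneg _), mul_comm, k, ← nsmul_eq_mul,
      ← Finset.sum_filter_of_ne (p := fun j => S.β₀ n j ≠ 0)
        (fun j _ hne h0 => hne (by rw [hf j h0]; ring))]
    refine Finset.sum_le_card_nsmul _ _ _ fun j _ => ?_
    rw [← sq_abs]
    exact pow_le_pow_left₀ (abs_nonneg _) (hfa j) 2
  have hF : l2 ((S.Z n * Γ) *ᵥ S.β₀ n) ≤
      CZ * √(2 * (1 + M)) * √(S.p n : ℝ) * (b₁ * √(S.k n : ℝ)) := by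
    refine (hΔ _).trans (mul_le_mul_of_nonneg_left ?_ (by positivity))
    exact hk b₁ hb₁.le _ (fun j h => h) hβ₁
  have hinv : ∀ l, S.β₀ n l ≠ 0 → |S.betaTilde n ω l|⁻¹ ≤ ξ⁻¹ := fun l hl =>
    inv_anti₀ hξ (hG.relevant l hl)
  have hΛw : l2 (fun j => if S.β₀ n j ≠ 0 then
      S.lam n * |S.betaTilde n ω j|⁻¹ * SignType.sign (S.β₀ n j) else 0) ≤
      ξ⁻¹ * (S.lam n * √(S.k n : ℝ)) := by
    rw [show ξ⁻¹ * (S.lam n * √(S.k n : ℝ)) = (S.lam n * ξ⁻¹) * √(S.k n : ℝ) by ring]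
    refine hk _ (by positivity) _ (fun j h => if_neg (not_not.2 h)) fun j => ?_
    by_cases h : S.β₀ n j ≠ 0
    · simp only [if_pos h, abs_mul, abs_of_pos hlam, abs_inv, abs_abs]
      have h1 : |((SignType.sign (S.β₀ n j) : SignType) : ℝ)| ≤ 1 := by
        rcases lt_or_gt_of_ne h with h | h
        · simp [sign_neg h]
        · simp [sign_pos h]
      calc _ ≤ S.lam n * ξ⁻¹ * 1 := by
            refine mul_le_mul ?_ h1 (abs_nonneg _) (by positivity)
            exact mul_le_mul_of_nonneg_left (hinv j h) hlam.le
        _ = _ := mul_one _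
    · simp only [if_neg h, abs_zero]; positivity
  have hcross : ∀ l, S.β₀ n l = 0 → |(S.D n *ᵥ c l) ⬝ᵥ ((S.Z n * Γ) *ᵥ S.β₀ n)| ≤
      b₁ * √B * CZ * (CD * Cc) * √(n : ℝ) + (√(n : ℝ))⁻¹ * E₂ := by
    intro l hl
    set a := S.D n *ᵥ c l with ha
    -- The oracle representation splits the cross term. The remainder part is bounded by
    -- Cauchy-Schwarz, the linear part by the event `cross`.
    have h1 : a ⬝ᵥ ((S.Z n * Γ) *ᵥ S.β₀ n) =
        (√(n : ℝ))⁻¹ * (∑ j, ∑ h, S.crossWeight n a j h * S.oracleRemainder n ω j h +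
          ∑ j, ∑ h, S.crossWeight n a j h * S.linearTerm n ω j h) := by
      rw [← Matrix.mulVec_mulVec, dotProduct_comm, ← dotProduct_transpose_mulVec]
      simp only [← Finset.sum_add_distrib, Finset.mul_sum]
      calc (Γ *ᵥ S.β₀ n) ⬝ᵥ ((S.Z n)ᵀ *ᵥ a)
          = ∑ j, ∑ h, S.β₀ n j * ((S.Z n)ᵀ *ᵥ a) h * Γ h j := by
            rw [Finset.sum_comm]
            refine Finset.sum_congr rfl fun h _ => ?_
            rw [Matrix.mulVec, dotProduct, Finset.sum_mul]
            exact Finset.sum_congr rfl fun j _ => by ring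
        _ = _ := by
            refine Finset.sum_congr rfl fun j _ => ?_
            rw [← sum_subtype_of_support (fun h => S.α n h j ≠ 0)
              (fun h => S.β₀ n j * ((S.Z n)ᵀ *ᵥ a) h * Γ h j) fun h hh => by
                rw [hΓ, hG.alphaHat_sub_eq_zero (not_not.1 hh), mul_zero]]
            refine Finset.sum_congr rfl fun h _ => ?_
            rw [hΓ, alphaHat_sub_eq hR.pos, crossWeight]
            ring
    have h2 : l2 a ≤ CD * Cc * √(n : ℝ) := by
      calc l2 a ≤ CD * √(n : ℝ) * l2 (c l) := hR.upper _
        _ ≤ CD * √(n : ℝ) * Cc := by gcongr; exact (hc l hl).2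
        _ = _ := by ring
    have h3 := abs_sum_sum_mul_le (S.crossWeight n a) (S.oracleRemainder n ω) (by positivity)
      one_pos.le (hR.sum_crossWeight_sq_le hCZ hB hb₁ hβ₁ h2)
      (by simpa using hG.remainder)
    have h4 := hG.cross l hl
    rw [h1, abs_mul, abs_of_pos (inv_pos.2 hs)]
    calc _ ≤ (√(n : ℝ))⁻¹ * (b₁ * √B * CZ * (CD * Cc) * n * 1 + E₂) := by
          gcongr
          exact (abs_add_le _ _).trans (add_le_add h3 h4)
      _ = b₁ * √B * CZ * (CD * Cc) * ((√(n : ℝ))⁻¹ * (√(n : ℝ) * √(n : ℝ))) +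
          (√(n : ℝ))⁻¹ * E₂ := by rw [Real.mul_self_sqrt hn.le]; ring
      _ = _ := by rw [inv_mul_cancel_left₀ hs.ne']
  obtain ⟨hfeas, hmin⟩ := hG.lasso
  refine sign_eq_of_lasso_minimizer (D := S.D n) (Δ := S.Z n * Γ) (T := S.betaTilde n ω) (ε := ε)
    hlam.le hs hcD hCD (by positivity) hCc.le hR.lower hR.upper hΔ hg₁ hg₂ hG₁ hG₂ hF hΛw hX hXb
    hβ₀ (fun l hl h0 => ?_) (fun l hl => ⟨c l, (hc l hl).1, (hc l hl).2, hG.noise l hl,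
      hcross l hl⟩) (fun l hl hT => ?_) hfin hfeas (fun b' hb' => ?_) j
  · have := hG.relevant l hl
    rw [h0, abs_zero] at this
    linarith
  · refine mul_le_mul_of_nonneg_left ?_ hlam.le
    have h1 : 0 < |S.betaTilde n ω l| := abs_pos.2 hT
    rw [div_le_iff₀ hMT, inv_mul_eq_div, le_div_iff₀ h1]
    exact hG.irrelevant l hl
  · have := hmin b' hb'
    rwa [loss, loss, Y_eq_add, DHat_eq_add] at this

end GoodEvent

end TwoStageModel

/-! ### Rates -/

/-- The numerical conditions for sign recovery; `a` and `b` stand for the square roots of the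
numbers of all and of the relevant covariates, `s` for the square root of the sample size. -/
lemma exists_estimation_error_bound {cD CD Cg CF C₁ C₂ CΛ Cc b₀ : ℝ} (hcD : 0 < cD) (hCD : 0 < CD)
    (hCg : 0 < Cg) (hCF : 0 < CF) (hC₁ : 0 < C₁) (hC₂ : 0 < C₂) (hCΛ : 0 < CΛ) (hCc : 0 < Cc)
    (hb₀ : 0 < b₀) :
    ∃ Q C : ℝ, 0 < Q ∧ 0 < C ∧ ∀ s a b lam : ℝ, 1 ≤ a → 1 ≤ b → 0 < lam →
      Q * (a ^ 2 * b) ≤ s → Q * (lam * b) ≤ s ^ 2 →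
      Cg * a ≤ cD * s / 2 ∧ Cg * a ≤ CD * s ∧
      ∃ X, C₁ * (s * a) + C₂ * a ^ 2 + 2 * CD * s * (Cg * a * (CF * b)) + CΛ * (lam * b) ≤
          (cD * s / 2) ^ 2 * X ∧ X < b₀ ∧
        Cc * (C₂ * a ^ 2 + Cg * a * (Cg * a * (CF * b))) + 3 * CD * Cc * s * (Cg * a) * X +
          Cc * (CΛ * (lam * b)) ≤ C * (s + lam * b) := by
  set H := C₁ + C₂ + 2 * CD * (Cg * CF) + CΛ with hH
  have hH0 : 0 < H := by positivity
  -- The summands in turn give `a ^ 2 * b ≤ s`, the two smallness conditions on the perturbation,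
  -- and `X ≤ b₀ / 2`.
  set Q := 1 + 2 * Cg / cD + Cg / CD + 8 * H / (cD ^ 2 * b₀) with hQ
  have hQ1 : 1 ≤ Q := by
    have : 0 ≤ 2 * Cg / cD + Cg / CD + 8 * H / (cD ^ 2 * b₀) := by positivity
    rw [hQ]; linarith
  have hQa : 2 * Cg / cD ≤ Q := by
    have : 0 ≤ 1 + Cg / CD + 8 * H / (cD ^ 2 * b₀) := by positivity
    rw [hQ]; linarith
  have hQb : Cg / CD ≤ Q := by
    have : 0 ≤ 1 + 2 * Cg / cD + 8 * H / (cD ^ 2 * b₀) := by positivity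
    rw [hQ]; linarith
  have hQc : 8 * H / (cD ^ 2 * b₀) ≤ Q := by
    have : 0 ≤ 1 + 2 * Cg / cD + Cg / CD := by positivity
    rw [hQ]; linarith
  clear_value Q
  refine ⟨Q, Cc * (C₂ + Cg * Cg * CF) + 12 * CD * Cc * Cg * H / cD ^ 2 + Cc * CΛ, by linarith,
    by positivity, fun s a b lam ha hb hlam hs hs₂ => ?_⟩
  have hQ0 : 0 < Q := by linarith
  have ha0 : 0 < a := by linarith
  have hb0 : 0 < b := by linarith
  have hab : a ≤ a ^ 2 * b := by nlinarith [mul_le_mul ha hb zero_le_one ha0.le]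
  have hQas : Q * a ≤ s := (mul_le_mul_of_nonneg_left hab hQ0.le).trans hs
  have hs0 : 0 < s := by nlinarith
  have has : a ≤ s := by nlinarith
  have hs1 : 1 ≤ s := ha.trans has
  have ha2b : a ^ 2 * b ≤ s := by
    have : 0 < a ^ 2 * b := by positivity
    nlinarith
  have ha2 : a ^ 2 ≤ a ^ 2 * b := le_mul_of_one_le_right (by positivity) hb
  have habb : a * b ≤ a ^ 2 * b := by nlinarith [mul_pos ha0 hb0]
  refine ⟨?_, ?_, ?_⟩
  · have : 2 * Cg / cD * a ≤ s := (mul_le_mul_of_nonneg_right hQa ha0.le).trans hQas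
    rw [div_mul_eq_mul_div, div_le_iff₀ hcD] at this
    linarith
  · have : Cg / CD * a ≤ s := (mul_le_mul_of_nonneg_right hQb ha0.le).trans hQas
    rw [div_mul_eq_mul_div, div_le_iff₀ hCD] at this
    linarith
  set N := C₁ * (s * a) + C₂ * a ^ 2 + 2 * CD * s * (Cg * a * (CF * b)) + CΛ * (lam * b) with hN
  have hN1 : N * Q ≤ H * s ^ 2 := by
    have e1 : C₁ * (s * a) * Q ≤ C₁ * s ^ 2 := by
      calc _ = C₁ * (s * (Q * a)) := by ring
        _ ≤ C₁ * (s * s) := by gcongr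
        _ = _ := by ring
    have e2 : C₂ * a ^ 2 * Q ≤ C₂ * s ^ 2 := by
      have : Q * a ^ 2 ≤ s := (mul_le_mul_of_nonneg_left ha2 hQ0.le).trans hs
      calc _ = C₂ * (Q * a ^ 2) := by ring
        _ ≤ C₂ * s ^ 2 := by
          gcongr
          exact this.trans (le_self_pow₀ hs1 two_ne_zero)
    have e3 : 2 * CD * s * (Cg * a * (CF * b)) * Q ≤ 2 * CD * (Cg * CF) * s ^ 2 := by
      have h1 : Q * (a * b) ≤ s := (mul_le_mul_of_nonneg_left habb hQ0.le).trans hs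
      have h2 : s * (Q * (a * b)) ≤ s * s := by gcongr
      calc _ = 2 * CD * (Cg * CF) * (s * (Q * (a * b))) := by ring
        _ ≤ 2 * CD * (Cg * CF) * (s * s) := by gcongr
        _ = _ := by ring
    have e4 : CΛ * (lam * b) * Q ≤ CΛ * s ^ 2 := by
      calc _ = CΛ * (Q * (lam * b)) := by ring
        _ ≤ _ := by gcongr
    rw [hN, hH]
    linarith
  -- In the final estimate `X` appears with the factor `s * a`, and `X` is of order `N / s ^ 2`; so
  -- it is `a * N / s` that must be of order `s + lam * b`.
  have hN2 : a * N ≤ H * (s * (s + lam * b)) := by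
    have hlb : 0 < lam * b := by positivity
    have e1 : a * (C₁ * (s * a)) ≤ C₁ * (s * (s + lam * b)) := by
      calc _ = C₁ * (s * a ^ 2) := by ring
        _ ≤ C₁ * (s * (s + lam * b)) := by gcongr; linarith
    have e2 : a * (C₂ * a ^ 2) ≤ C₂ * (s * (s + lam * b)) := by
      calc _ = C₂ * (a * a ^ 2) := by ring
        _ ≤ C₂ * (s * (s + lam * b)) := by gcongr; linarith
    have e3 : a * (2 * CD * s * (Cg * a * (CF * b))) ≤
        2 * CD * (Cg * CF) * (s * (s + lam * b)) := by
      calc _ = 2 * CD * (Cg * CF) * (s * (a ^ 2 * b)) := by ring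
        _ ≤ _ := by gcongr; linarith
    have e4 : a * (CΛ * (lam * b)) ≤ CΛ * (s * (s + lam * b)) := by
      calc _ = CΛ * (a * (lam * b)) := by ring
        _ ≤ _ := by gcongr; linarith
    rw [hN, hH]
    linarith
  have hd : 0 < (cD * s / 2) ^ 2 := by positivity
  refine ⟨N / (cD * s / 2) ^ 2, (mul_div_cancel₀ _ hd.ne').ge, ?_, ?_⟩
  · rw [div_lt_iff₀ hd]
    have h1 : 8 * H ≤ Q * (cD ^ 2 * b₀) := (div_le_iff₀ (by positivity)).1 hQc
    have h2 : N * Q * 8 ≤ Q * (cD ^ 2 * b₀) * s ^ 2 := by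
      have := mul_le_mul_of_nonneg_right h1 (sq_nonneg s)
      linarith
    have h3 : N * 8 ≤ cD ^ 2 * b₀ * s ^ 2 := by
      refine le_of_mul_le_mul_left ?_ hQ0
      linarith
    have h4 : 0 < cD ^ 2 * b₀ * s ^ 2 := by positivity
    nlinarith
  · have hlb : 0 < lam * b := by positivity
    have f1 : Cc * (C₂ * a ^ 2 + Cg * a * (Cg * a * (CF * b))) ≤
        Cc * (C₂ + Cg * Cg * CF) * (s + lam * b) := by
      calc _ = Cc * (C₂ * a ^ 2 + Cg * Cg * CF * (a ^ 2 * b)) := by ring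
        _ ≤ Cc * (C₂ * (s + lam * b) + Cg * Cg * CF * (s + lam * b)) := by gcongr <;> linarith
        _ = _ := by ring
    have f2 : 3 * CD * Cc * s * (Cg * a) * (N / (cD * s / 2) ^ 2) ≤
        12 * CD * Cc * Cg * H / cD ^ 2 * (s + lam * b) := by
      calc _ = 12 * CD * Cc * Cg / (cD ^ 2 * s) * (a * N) := by field_simp; ring
        _ ≤ 12 * CD * Cc * Cg / (cD ^ 2 * s) * (H * (s * (s + lam * b))) := by gcongr
        _ = _ := by field_simp
    have f3 : Cc * (CΛ * (lam * b)) ≤ Cc * CΛ * (s + lam * b) := by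
      calc _ = Cc * CΛ * (lam * b) := by ring
        _ ≤ _ := by gcongr; linarith
    linarith

lemma eventually_mul_le_of_tendsto_div {f g : ℕ → ℝ} (h : Tendsto (fun n => f n / g n) atTop (𝓝 0))
    (hg : ∀ᶠ n in atTop, 0 < g n) {C : ℝ} (hC : 0 < C) : ∀ᶠ n in atTop, C * f n ≤ g n := by
  filter_upwards [h.eventually_lt_const (inv_pos.2 hC), hg] with n h1 h2
  rw [div_lt_iff₀ h2] at h1
  have := mul_lt_mul_of_pos_left h1 hC
  rw [mul_inv_cancel_left₀ hC.ne'] at this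
  exact this.le

namespace TwoStageModel

variable {Ω : Type*} {S : TwoStageModel Ω} {d : ℝ} {r : ℕ → ℝ}

lemma eventually_sq_mul_le (hrates : S.Rates d r) {cD CD CZ τ B : ℝ} {K : ℕ} (hcD : 0 < cD)
    (hk : ∀ᶠ n in atTop, 1 ≤ S.k n)
    (hR : ∀ᶠ n in atTop, S.RegularDesign n cD CD CZ τ B K) {C : ℝ} (hC : 0 < C) :
    ∀ᶠ n : ℕ in atTop, C * (√(S.p n : ℝ) ^ 2 * √(S.k n : ℝ)) ≤ √(n : ℝ) := by
  have h0 : Tendsto (fun n : ℕ => ((S.p n : ℝ) ^ 2 * (S.k n * S.kzMax n)) / n) atTop (𝓝 0) :=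
    hrates.dims.congr fun n => by ring
  filter_upwards [eventually_mul_le_of_tendsto_div h0
    ((eventually_gt_atTop 0).mono fun n hn => by exact_mod_cast hn) (pow_pos hC 2), hk, hR]
    with n h1 h2 h3
  obtain ⟨j, hj⟩ : ∃ j, S.β₀ n j ≠ 0 := by
    obtain ⟨j, hj⟩ := Finset.card_pos.1 h2
    exact ⟨j, (Finset.mem_filter.1 hj).2⟩
  have hn : (0 : ℝ) < n := by exact_mod_cast h3.pos
  -- A relevant covariate without instruments would give a zero column of `D`, against the lower
  -- eigenvalue bound. So the factor `kzMax` in the rate condition can be dropped.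
  have hkz : 1 ≤ S.kzMax n := by
    obtain ⟨h, hh⟩ : ∃ h, S.α n h j ≠ 0 := by
      by_contra! hcon
      have e1 : S.D n *ᵥ Pi.single j 1 = 0 := by
        rw [Matrix.mulVec_single_one]
        ext i
        simp [D, Matrix.mul_apply, Matrix.col, hcon]
      have e2 := h3.lower (Pi.single j 1)
      have e3 : l2 (Pi.single j (1 : ℝ) : Fin (S.p n) → ℝ) = 1 := by simp [l2]
      rw [e1, e3, show l2 (0 : Fin n → ℝ) = 0 by simp [l2]] at e2
      have : 0 < cD * √(n : ℝ) * 1 := by positivity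
      linarith
    exact (Finset.card_pos.2 ⟨h, by simpa using hh⟩).trans_le
      (Finset.le_sup (f := fun j => (Finset.univ.filter fun h => S.α n h j ≠ 0).card)
        (Finset.mem_univ j))
  refine Real.le_sqrt_of_sq_le ?_
  rw [Real.sq_sqrt (by positivity), mul_pow, mul_pow, Real.sq_sqrt (by positivity)]
  refine le_trans (mul_le_mul_of_nonneg_left (mul_le_mul_of_nonneg_left ?_ (by positivity))
    (by positivity)) h1
  exact le_mul_of_one_le_right (by positivity) (by exact_mod_cast hkz)

lemma eventually_lam_mul_le (hrates : S.Rates d r) (hk : ∀ᶠ n in atTop, 1 ≤ S.k n) {C : ℝ}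
    (hC : 0 < C) : ∀ᶠ n : ℕ in atTop, C * (S.lam n * √(S.k n : ℝ)) ≤ √(n : ℝ) ^ 2 := by
  filter_upwards [eventually_mul_le_of_tendsto_div hrates.lam_k'
    ((eventually_gt_atTop 0).mono fun n hn => by exact_mod_cast hn) hC, hk,
    hrates.lam_tendsto.eventually_gt_atTop 0] with n h1 h2 h3
  rw [Real.sq_sqrt (by positivity)]
  refine le_trans ?_ h1
  have : (1 : ℝ) ≤ S.k n := by exact_mod_cast h2
  gcongr
  rw [Real.sqrt_le_left (by positivity)]
  nlinarith

lemma eventually_sqrt_k_mul_le (hrates : S.Rates d r) (hr : Tendsto r atTop atTop)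
    (hk : ∀ᶠ n in atTop, 1 ≤ S.k n) {C : ℝ} (hC : 0 < C) :
    ∀ᶠ n : ℕ in atTop, C * √(S.k n : ℝ) ≤ r n := by
  filter_upwards [eventually_mul_le_of_tendsto_div hrates.k_r (hr.eventually_gt_atTop 0) hC, hk]
    with n h1 h2
  refine le_trans ?_ h1
  have : (1 : ℝ) ≤ S.k n := by exact_mod_cast h2
  gcongr
  rw [Real.sqrt_le_left (by positivity)]
  nlinarith [pow_le_pow_left₀ (by positivity) this 3, sq_nonneg (S.k n : ℝ)]

/-- The tuning parameter dominates the maximum of the noise over the irrelevant covariates. -/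
lemma tendsto_log_m (hrates : S.Rates d r) (hd₁ : 1 ≤ d) (hr : Tendsto r atTop atTop) :
    Tendsto (fun n : ℕ => √(n : ℝ) * Real.log (S.m n) ^ (1 / d) / (S.lam n * r n))
      atTop (𝓝 0) := by
  -- For `d = 1` the assumed rate carries an extra factor `log n`, which is at least one from `n =
  -- 3` on.
  rcases hd₁.eq_or_lt with h | h
  · refine squeeze_zero' ?_ ?_ (hrates.log_m_one h.symm)
    · filter_upwards [hrates.lam_tendsto.eventually_gt_atTop 0, hr.eventually_gt_atTop 0]
        with n h1 h2
      have : 0 ≤ Real.log (S.m n) := Real.log_natCast_nonneg _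
      positivity
    · filter_upwards [hrates.lam_tendsto.eventually_gt_atTop 0, hr.eventually_gt_atTop 0,
        eventually_ge_atTop 3] with n h1 h2 h3
      have h4 : 0 ≤ Real.log (S.m n) := Real.log_natCast_nonneg _
      have h5 : 1 ≤ Real.log n := by
        rw [Real.le_log_iff_exp_le (by positivity)]
        have : (3 : ℝ) ≤ n := by exact_mod_cast h3
        linarith [Real.exp_one_lt_d9]
      rw [← h, div_one, Real.rpow_one]
      have : √(n : ℝ) * Real.log (S.m n) ≤ √(n : ℝ) * Real.log n * Real.log (S.m n) := by
        rw [mul_assoc]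
        gcongr
        exact le_mul_of_one_le_left h4 h5
      gcongr
  · exact hrates.log_m h

lemma eventually_sqrt_mul_le (hrates : S.Rates d r) (hd₁ : 1 ≤ d) (hr : Tendsto r atTop atTop) {C : ℝ} (hC : 0 < C) :
    ∀ᶠ n : ℕ in atTop, C * (√(n : ℝ) * Real.log (S.m n) ^ (1 / d)) ≤ S.lam n * r n := by
  refine eventually_mul_le_of_tendsto_div (tendsto_log_m hrates hd₁ hr) ?_ hC
  filter_upwards [hrates.lam_tendsto.eventually_gt_atTop 0, hr.eventually_gt_atTop 0] with n h1 h2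
  positivity

/-- With at least two irrelevant covariates `log m` is bounded below by `log 2`, so the rate for the
maximum of the noise also dominates `√n` itself. -/
lemma eventually_sqrt_n_mul_le (hrates : S.Rates d r) (hd₁ : 1 ≤ d)
    (hm : ∀ᶠ n in atTop, 2 ≤ S.m n) (hr : Tendsto r atTop atTop) {C : ℝ} (hC : 0 < C) :
    ∀ᶠ n : ℕ in atTop, C * √(n : ℝ) ≤ S.lam n * r n := by
  have hl : 0 < Real.log 2 ^ (1 / d) := Real.rpow_pos_of_pos (Real.log_pos one_lt_two) _
  filter_upwards [eventually_sqrt_mul_le hrates hd₁ hr (div_pos hC hl), hm] with n h1 h2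
  refine le_trans ?_ h1
  have h3 : Real.log 2 ^ (1 / d) ≤ Real.log (S.m n) ^ (1 / d) := by
    refine Real.rpow_le_rpow (Real.log_pos one_lt_two).le ?_ (by positivity)
    exact Real.log_le_log two_pos (by exact_mod_cast h2)
  calc C * √(n : ℝ) = C / Real.log 2 ^ (1 / d) * (√(n : ℝ) * Real.log 2 ^ (1 / d)) := by
        field_simp
    _ ≤ _ := by gcongr

/-- The union bound over the irrelevant covariates. -/
lemma eventually_union_bound_le (hrates : S.Rates d r) (hd₁ : 1 ≤ d)
    (hm : ∀ᶠ n in atTop, 2 ≤ S.m n) (hr : Tendsto r atTop atTop) {c θ η : ℝ} (hc : 0 < c)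
    (hθ : 0 < θ) (hη : 0 < η) :
    ∀ᶠ n : ℕ in atTop, 1 ≤ θ * (S.lam n * r n / √(n : ℝ)) ∧
      S.m n * (2 * Real.exp (-c * (θ * (S.lam n * r n / √(n : ℝ))) ^ d)) ≤ η := by
  have hd0 : 0 < d := by linarith
  -- Once `c * t ^ d ≥ A * log m`, the union bound is at most `2 * m ^ (1 - A)`, and `m ≥ 2` makes
  -- this at most `η`, even if `m` stays bounded.
  obtain ⟨A, hA1, hA⟩ : ∃ A : ℝ, 2 ≤ A ∧ 2 * Real.exp (-(Real.log 2 * (A - 1))) ≤ η := by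
    have h1 : Tendsto (fun A : ℝ => 2 * Real.exp (-(Real.log 2 * (A - 1)))) atTop (𝓝 (2 * 0)) := by
      refine (Real.tendsto_exp_neg_atTop_nhds_zero.comp ?_).const_mul 2
      exact (tendsto_atTop_add_const_right _ _ tendsto_id).const_mul_atTop
        (Real.log_pos one_lt_two)
    rw [mul_zero] at h1
    obtain ⟨A, h2, h3⟩ := ((eventually_ge_atTop 2).and (h1.eventually_lt_const hη)).exists
    exact ⟨A, h2, h3.le⟩
  have hAc : 0 < (A / c) ^ (1 / d) := by positivity
  filter_upwards [eventually_sqrt_mul_le hrates hd₁ hr (div_pos hAc hθ),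
    eventually_sqrt_n_mul_le hrates hd₁ hm hr (inv_pos.2 hθ), hm, eventually_gt_atTop 0]
    with n h1 h2 h3 h4
  have hn : (0 : ℝ) < n := by exact_mod_cast h4
  have hs : 0 < √(n : ℝ) := Real.sqrt_pos.2 hn
  have hm2 : (2 : ℝ) ≤ S.m n := by exact_mod_cast h3
  have hlog2 := Real.log_pos one_lt_two
  have hlog : Real.log 2 ≤ Real.log (S.m n) := Real.log_le_log two_pos hm2
  have hlog0 : 0 < Real.log (S.m n) := hlog2.trans_le hlog
  set t := θ * (S.lam n * r n / √(n : ℝ)) with ht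
  have ht1 : 1 ≤ t := by
    rw [ht, mul_div_assoc', le_div_iff₀ hs, one_mul]
    have := mul_le_mul_of_nonneg_left h2 hθ.le
    rwa [mul_inv_cancel_left₀ hθ.ne'] at this
  refine ⟨ht1, ?_⟩
  have ht2 : (A / c) ^ (1 / d) * Real.log (S.m n) ^ (1 / d) ≤ t := by
    rw [ht, mul_div_assoc', le_div_iff₀ hs]
    have := mul_le_mul_of_nonneg_left h1 hθ.le
    calc _ = θ * ((A / c) ^ (1 / d) / θ * (√(n : ℝ) * Real.log (S.m n) ^ (1 / d))) := by
          field_simp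
      _ ≤ _ := this
  have ht3 : A / c * Real.log (S.m n) ≤ t ^ d := by
    rw [← Real.mul_rpow (by positivity) hlog0.le] at ht2
    have := Real.rpow_le_rpow (by positivity) ht2 hd0.le
    rwa [← Real.rpow_mul (by positivity), one_div_mul_cancel hd0.ne', Real.rpow_one] at this
  have ht4 : A * Real.log (S.m n) ≤ c * t ^ d := by
    have := mul_le_mul_of_nonneg_left ht3 hc.le
    calc _ = c * (A / c * Real.log (S.m n)) := by field_simp
      _ ≤ _ := this
  calc (S.m n : ℝ) * (2 * Real.exp (-c * t ^ d))
      = 2 * Real.exp (Real.log (S.m n) + -c * t ^ d) := by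
        rw [Real.exp_add, Real.exp_log (by linarith)]; ring
    _ ≤ 2 * Real.exp (-(Real.log 2 * (A - 1))) := by
        gcongr
        nlinarith
    _ ≤ η := hA

end TwoStageModel

/-! ### The probability of the good event and sign consistency -/

namespace TwoStageModel

variable {Ω : Type*} [MeasurableSpace Ω] {P : Measure Ω} {S : TwoStageModel Ω}

lemma measure_exists_irrelevant_le (n : ℕ) (s : Fin (S.p n) → Set Ω) {x : ℝ}
    (hs : ∀ j, S.β₀ n j = 0 → P (s j) ≤ ENNReal.ofReal x) {η : ℝ} (hη : S.m n * x ≤ η) :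
    P {ω | ¬ ∀ j, S.β₀ n j = 0 → ω ∉ s j} ≤ ENNReal.ofReal η := by
  have hsub : {ω | ¬ ∀ j, S.β₀ n j = 0 → ω ∉ s j} ⊆
      ⋃ j ∈ Finset.univ.filter fun j => S.β₀ n j = 0, s j := by
    intro ω hω
    have : ∃ j, S.β₀ n j = 0 ∧ ω ∈ s j := by
      by_contra! h
      exact hω h
    obtain ⟨j, hj, hjs⟩ := this
    exact Set.mem_biUnion (by simpa using hj) hjs
  calc _ ≤ ∑ j ∈ Finset.univ.filter fun j => S.β₀ n j = 0, P (s j) :=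
        (measure_mono hsub).trans (measure_biUnion_finset_le _ _)
    _ ≤ (Finset.univ.filter fun j => S.β₀ n j = 0).card • ENNReal.ofReal x :=
        Finset.sum_le_card_nsmul _ _ _ fun j hj => hs j (Finset.mem_filter.1 hj).2
    _ = ENNReal.ofReal (S.m n * x) := by
        rw [nsmul_eq_mul, ENNReal.ofReal_mul (Nat.cast_nonneg _), ENNReal.ofReal_natCast, m]
    _ ≤ _ := ENNReal.ofReal_le_ofReal hη

lemma eventually_selection [IsProbabilityMeasure P] (hmeas : S.MeasurableEstimators)
    (hsel : S.FirstStageSelectionConsistent P) {η : ℝ} (hη : 0 < η) :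
    ∀ᶠ n in atTop, P {ω | ¬ ∀ h j, S.alphaHat n ω h j = 0 ↔ S.α n h j = 0} ≤
      ENNReal.ofReal η := by
  have hms : ∀ n, MeasurableSet {ω | ∀ h j, S.alphaHat n ω h j = 0 ↔ S.α n h j = 0} := fun n => by
    have : {ω | ∀ h j, S.alphaHat n ω h j = 0 ↔ S.α n h j = 0} =
        ⋂ h, ⋂ j, {ω | S.alphaHat n ω h j = 0 ↔ S.α n h j = 0} := by ext; simp
    rw [this]
    exact MeasurableSet.iInter fun h => MeasurableSet.iInter fun j =>
      (measurableSet_eq_fun (hmeas.1 n h j) measurable_const).iff (MeasurableSet.const _)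
  have h1 : Tendsto (fun n => P {ω | ¬ ∀ h j, S.alphaHat n ω h j = 0 ↔ S.α n h j = 0}) atTop
      (𝓝 (1 - 1)) := by
    refine (ENNReal.Tendsto.sub tendsto_const_nhds hsel (Or.inl ENNReal.one_ne_top)).congr
      fun n => ?_
    exact (prob_compl_eq_one_sub (hms n)).symm
  rw [tsub_self] at h1
  exact h1.eventually_le_const (ENNReal.ofReal_pos.2 hη)

/-- Uniformity over the unit ball is convergence of the Euclidean norm: the supremum is attained at
the normalized remainder, a random `δ`. -/
lemma eventually_remainder (horacle : S.FirstStageOracleEfficient P) {η : ℝ} (hη : 0 < η) :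
    ∀ᶠ n in atTop, P {ω | ¬ ∑ j, ∑ h, S.oracleRemainder n ω j h ^ 2 ≤ 1} ≤ ENNReal.ofReal η := by
  refine ((horacle 1 one_pos).eventually_le_const (ENNReal.ofReal_pos.2 hη)).mono fun n hn =>
    (measure_mono fun ω hω => ?_).trans hn
  set N := ∑ j, ∑ h, S.oracleRemainder n ω j h ^ 2 with hN
  have h1 : 1 < N := not_le.1 hω
  have h2 : 1 < √N := Real.lt_sqrt_of_sq_lt (by simpa using h1)
  have h3 : √N ^ 2 = N := Real.sq_sqrt (by linarith)
  refine ⟨fun j h => (√N)⁻¹ * S.oracleRemainder n ω j h, ?_, ?_⟩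
  · simp only [mul_pow, ← Finset.mul_sum]
    rw [← hN, inv_pow, h3, inv_mul_cancel₀ (by linarith)]
  · have h4 : ∑ j, ∑ h, (√N)⁻¹ * S.oracleRemainder n ω j h * S.oracleRemainder n ω j h = √N := by
      simp only [mul_assoc, ← Finset.mul_sum, ← pow_two]
      rw [← hN, ← h3]
      field_simp
      rw [h3]
      exact h3.symm
    rw [h4, abs_of_pos (by linarith)]
    exact h2.le

lemma eventually_relevant [IsProbabilityMeasure P] (hmeas : S.MeasurableEstimators) {ξ η : ℝ}
    (h : ∀ᶠ n in atTop, 1 - η < P.real {ω | ∀ j, S.β₀ n j ≠ 0 → ξ ≤ |S.betaTilde n ω j|}) :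
    ∀ᶠ n in atTop, P {ω | ¬ ∀ j, S.β₀ n j ≠ 0 → ξ ≤ |S.betaTilde n ω j|} ≤
      ENNReal.ofReal η := by
  refine h.mono fun n hn => ?_
  have hms : MeasurableSet {ω | ∀ j, S.β₀ n j ≠ 0 → ξ ≤ |S.betaTilde n ω j|} := by
    have : {ω | ∀ j, S.β₀ n j ≠ 0 → ξ ≤ |S.betaTilde n ω j|} =
        ⋂ j, ⋂ _ : S.β₀ n j ≠ 0, {ω | ξ ≤ |S.betaTilde n ω j|} := by ext; simp
    rw [this]
    exact MeasurableSet.iInter fun j => MeasurableSet.iInter fun _ =>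
      measurableSet_le measurable_const (hmeas.2 n j).abs
  have h1 := probReal_compl_eq_one_sub (μ := P) hms
  rw [← ofReal_measureReal]
  refine ENNReal.ofReal_le_ofReal ?_
  have h2 : P.real {ω | ¬ ∀ j, S.β₀ n j ≠ 0 → ξ ≤ |S.betaTilde n ω j|} =
    1 - P.real {ω | ∀ j, S.β₀ n j ≠ 0 → ξ ≤ |S.betaTilde n ω j|} := h1
  linarith

lemma GoodEvent.measure_not_le {n : ℕ} {c : Fin (S.p n) → Fin (S.p n) → ℝ}
    {M ξ MT r E₁ E₂ η : ℝ} {b : Ω → Fin (S.p n) → ℝ} (hη : 0 ≤ η)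
    (h1 : P {ω | ¬ ∀ h j, S.alphaHat n ω h j = 0 ↔ S.α n h j = 0} ≤ ENNReal.ofReal η)
    (h2 : P {ω | ¬ ∑ j, ∑ h, S.oracleRemainder n ω j h ^ 2 ≤ 1} ≤ ENNReal.ofReal η)
    (h3 : P {ω | M * S.p n < ∑ j, ∑ h, S.linearTerm n ω j h ^ 2} ≤ ENNReal.ofReal η)
    (h4 : P {ω | M * (n * S.p n) < ∑ j, ∑ h : {h : Fin (S.q n) // S.α n h j ≠ 0},
        ((S.Z n)ᵀ *ᵥ fun i => S.eps n i ω) h ^ 2} ≤ ENNReal.ofReal η)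
    (h5 : P {ω | M * (n * S.p n) < ∑ j, ((S.D n)ᵀ *ᵥ fun i => S.eps n i ω) j ^ 2} ≤
      ENNReal.ofReal η)
    (h6 : P {ω | ¬ ∀ j, S.β₀ n j = 0 →
      ω ∉ {ω | E₁ < |∑ i, (S.D n *ᵥ c j) i * S.eps n i ω|}} ≤ ENNReal.ofReal η)
    (h7 : P {ω | ¬ ∀ j, S.β₀ n j = 0 →
      ω ∉ {ω | E₂ < |∑ l, ∑ h, S.crossWeight n (S.D n *ᵥ c j) l h * S.linearTerm n ω l h|}} ≤
      ENNReal.ofReal η)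
    (h8 : P {ω | ∃ j, S.β₀ n j = 0 ∧ MT < r * |S.betaTilde n ω j|} ≤ ENNReal.ofReal η)
    (h9 : P {ω | ¬ ∀ j, S.β₀ n j ≠ 0 → ξ ≤ |S.betaTilde n ω j|} ≤ ENNReal.ofReal η)
    (h10 : ∀ᵐ ω ∂P, S.IsAdaptiveLasso n ω (b ω)) :
    P {ω | ¬ S.GoodEvent n ω c M ξ MT r E₁ E₂ (b ω)} ≤ ENNReal.ofReal (9 * η) := by
  have hsub : {ω | ¬ S.GoodEvent n ω c M ξ MT r E₁ E₂ (b ω)} ⊆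
      {ω | ¬ ∀ h j, S.alphaHat n ω h j = 0 ↔ S.α n h j = 0} ∪
      ({ω | ¬ ∑ j, ∑ h, S.oracleRemainder n ω j h ^ 2 ≤ 1} ∪
      ({ω | M * S.p n < ∑ j, ∑ h, S.linearTerm n ω j h ^ 2} ∪
      ({ω | M * (n * S.p n) < ∑ j, ∑ h : {h : Fin (S.q n) // S.α n h j ≠ 0},
        ((S.Z n)ᵀ *ᵥ fun i => S.eps n i ω) h ^ 2} ∪
      ({ω | M * (n * S.p n) < ∑ j, ((S.D n)ᵀ *ᵥ fun i => S.eps n i ω) j ^ 2} ∪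
      ({ω | ¬ ∀ j, S.β₀ n j = 0 →
        ω ∉ {ω | E₁ < |∑ i, (S.D n *ᵥ c j) i * S.eps n i ω|}} ∪
      ({ω | ¬ ∀ j, S.β₀ n j = 0 → ω ∉ {ω | E₂ <
        |∑ l, ∑ h, S.crossWeight n (S.D n *ᵥ c j) l h * S.linearTerm n ω l h|}} ∪
      ({ω | ∃ j, S.β₀ n j = 0 ∧ MT < r * |S.betaTilde n ω j|} ∪
      ({ω | ¬ ∀ j, S.β₀ n j ≠ 0 → ξ ≤ |S.betaTilde n ω j|} ∪
      {ω | ¬ S.IsAdaptiveLasso n ω (b ω)})))))))) := by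
    intro ω hω
    by_contra hcon
    simp only [Set.mem_union, Set.mem_ofPred_eq, not_or, not_not, not_exists, not_and,
      not_lt] at hcon
    obtain ⟨g1, g2, g3, g4, g5, g6, g7, g8, g9, g10⟩ := hcon
    exact hω ⟨g1, g2, g3, g4, g5, g6, g7, g8, g9, g10⟩
  refine (measure_mono hsub).trans ?_
  refine (measure_union_le _ _).trans ((add_le_add h1 ((measure_union_le _ _).trans (add_le_add h2
    ((measure_union_le _ _).trans (add_le_add h3 ((measure_union_le _ _).trans (add_le_add h4
    ((measure_union_le _ _).trans (add_le_add h5 ((measure_union_le _ _).trans (add_le_add h6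
    ((measure_union_le _ _).trans (add_le_add h7 ((measure_union_le _ _).trans (add_le_add h8
    ((measure_union_le _ _).trans (add_le_add h9
      (ae_iff.1 h10).le))))))))))))))))).trans_eq ?_)
  rw [show (9 : ℝ) * η = η + (η + (η + (η + (η + (η + (η + (η + (η + 0)))))))) by ring]
  repeat rw [ENNReal.ofReal_add hη (by positivity)]
  rw [ENNReal.ofReal_zero]

/-- With probability close to one the adaptive LASSO recovers the signs. -/
lemma eventually_measure_not_sign_le [IsProbabilityMeasure P] {d b₀ b₁ : ℝ} {r : ℕ → ℝ}
    {betaHat : (n : ℕ) → Ω → Fin (S.p n) → ℝ}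
    (hk : ∀ᶠ n in atTop, 1 ≤ S.k n) (hm : ∀ᶠ n in atTop, 2 ≤ S.m n)
    (hmeas : S.MeasurableEstimators) (hstd : S.StandardizedInstruments)
    (hZeig : S.FirstStageEigenvalues) (hα : S.FirstStageCoefficients)
    (hsel : S.FirstStageSelectionConsistent P) (horacle : S.FirstStageOracleEfficient P)
    (hiid : S.ErrorsIID P) (hsub : S.JointlySubGaussian P) (hd₁ : 1 ≤ d) (hd₂ : d ≤ 2)
    (htail : S.EpsTail P d) (hinit : S.ZeroConsistent P r b₁)
    (hβ : S.SecondStageCoefficients b₀ b₁) (hrates : S.Rates d r) (hdesign : S.SecondStageDesign)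
    (hlasso : ∀ᶠ n in atTop, ∀ᵐ ω ∂P, S.IsAdaptiveLasso n ω (betaHat n ω))
    {η : ℝ} (hη : 0 < η) :
    ∀ᶠ n in atTop,
      P {ω | ¬ ∀ j, SignType.sign (betaHat n ω j) = SignType.sign (S.β₀ n j)} ≤
        ENNReal.ofReal (9 * η) := by
  obtain ⟨cD, CD, CZ, τ, B, K, hcD, hCD, hCZ, hτ, hB, hR⟩ :=
    S.eventually_regularDesign hstd hZeig hα hdesign
  obtain ⟨V, c, hV, hc, hN⟩ := exists_noiseBounds hiid hsub hd₁ hd₂ htail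
  obtain ⟨hr, hirr, ξ', hξ', hrel⟩ := hinit
  obtain ⟨hb₀, hb, hβ⟩ := hβ
  have hb₁ : 0 < b₁ := hb₀.trans hb
  obtain ⟨M₀, hirr⟩ := hirr η hη
  set MT := max M₀ 1 with hMT
  have hMT0 : 0 < MT := lt_max_of_lt_right one_pos
  set ξ := ξ' * b₁ with hξ
  have hξ0 : 0 < ξ := mul_pos hξ' hb₁
  -- The sum of the three Markov constants over `η`, so that each of the three exceptional
  -- probabilities is at most `η`.
  set M := (K * (V / τ) + K * V + V * CD ^ 2) / η with hM
  have hM0 : 0 < M := by positivity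
  have hMη : M * η = K * (V / τ) + K * V + V * CD ^ 2 := div_mul_cancel₀ _ hη.ne'
  have t1 : 0 ≤ K * (V / τ) := by positivity
  have t2 : 0 ≤ K * V := by positivity
  have t3 : 0 ≤ V * CD ^ 2 := by positivity
  set Cc := 1 + CD ^ 2 / cD ^ 2 with hCc
  have hCc0 : 0 < Cc := by positivity
  set A := CD * Cc with hA
  have hA0 : 0 < A := by positivity
  set A' := b₁ * √B * CZ * A with hA'
  have hA'0 : 0 < A' := by positivity
  obtain ⟨Q, C, hQ, hC, hnum⟩ := exists_estimation_error_bound (cD := cD) (CD := CD)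
    (Cg := CZ * √(2 * (1 + M))) (CF := b₁) (C₁ := √M) (C₂ := √(2 * (1 + M)) * √M) (CΛ := ξ⁻¹)
    (Cc := Cc) (b₀ := b₀) hcD hCD (by positivity) hb₁ (by positivity) (by positivity)
    (by positivity) hCc0 hb₀
  -- At deviation level `t = θ λ r / √n` the noise and the linear part of the cross term together
  -- use exactly half of the threshold `λ r / MT`. One quarter is kept for terms of order `√n` and
  -- one for those of order `λ √k`.
  set θ := (2 * MT * (A + A' / √τ))⁻¹ with hθ
  have hθ0 : 0 < θ := by positivity
  have hθA : θ * (A + A' / √τ) = (2 * MT)⁻¹ := by rw [hθ]; field_simp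
  filter_upwards [hk, hR, hβ, hirr, eventually_relevant hmeas (hrel η hη),
    eventually_selection hmeas hsel hη, eventually_remainder horacle hη, hlasso,
    hrates.lam_tendsto.eventually_gt_atTop 0, hr.eventually_gt_atTop 0,
    eventually_sq_mul_le hrates hcD hk hR hQ, eventually_lam_mul_le hrates hk hQ,
    eventually_sqrt_k_mul_le hrates hr hk (mul_pos (mul_pos four_pos hMT0) hC),
    eventually_sqrt_n_mul_le hrates hd₁ hm hr (mul_pos (mul_pos four_pos hMT0) (add_pos hA'0 hC)),
    eventually_union_bound_le hrates hd₁ hm hr hc hθ0 hη]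
    with n hk hR hβ hirr hrel hsel hrem hlasso hlam hrn hQ₁ hQ₂ hkr hnr hunion
  obtain ⟨ht, hunion⟩ := hunion
  have hn : (0 : ℝ) < n := by exact_mod_cast hR.pos
  have hs : 0 < √(n : ℝ) := Real.sqrt_pos.2 hn
  have hp : 1 ≤ S.p n := hk.trans ((Finset.card_filter_le _ _).trans (by simp))
  have hpsq : √(S.p n : ℝ) ^ 2 = S.p n := Real.sq_sqrt (by positivity)
  obtain ⟨hg₁, hg₂, X, hX, hXb, hfin⟩ := hnum √(n : ℝ) √(S.p n : ℝ) √(S.k n : ℝ) (S.lam n)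
    (Real.one_le_sqrt.2 (by exact_mod_cast hp)) (Real.one_le_sqrt.2 (by exact_mod_cast hk))
    hlam hQ₁ hQ₂
  rw [hpsq] at hX hfin
  have hβ₁ : ∀ j, |S.β₀ n j| ≤ b₁ := fun j => by
    by_cases h : S.β₀ n j = 0
    · rw [h, abs_zero]; exact hb₁.le
    · exact (hβ j h).2
  have hex : ∀ j, ∃ c, S.β₀ n j = 0 → IsResidualCombination (S.D n) (S.β₀ n) j c ∧ l2 c ≤ Cc := by
    intro j
    by_cases h : S.β₀ n j = 0
    · obtain ⟨c, hc⟩ := exists_isResidualCombination (S.D n) (S.β₀ n) hs hcD hCD hR.lower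
        hR.upper j h
      exact ⟨c, fun _ => hc⟩
    · exact ⟨0, fun h' => absurd h' h⟩
  choose comb hcomb using hex
  set t := θ * (S.lam n * r n / √(n : ℝ)) with ht'
  have hst : √(n : ℝ) * t = θ * (S.lam n * r n) := by
    rw [ht']; field_simp
  have ha : ∀ j, S.β₀ n j = 0 → l2 (S.D n *ᵥ comb j) ≤ A * √(n : ℝ) := fun j hj => by
    calc _ ≤ CD * √(n : ℝ) * l2 (comb j) := hR.upper _
      _ ≤ CD * √(n : ℝ) * Cc := by gcongr; exact (hcomb j hj).2
      _ = _ := by rw [hA]; ring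
  have hbad := GoodEvent.measure_not_le (c := comb) (M := M) (ξ := ξ) (MT := MT) (r := r n)
    (E₁ := A * √(n : ℝ) * t) (E₂ := A' * n / √τ * t) (b := betaHat n) hη.le hsel hrem
    ((hN.linearTerm_sq hiid hR hτ hV hM0 hp).trans (ENNReal.ofReal_le_ofReal (by
      rw [div_le_iff₀ hM0]; linarith)))
    ((hN.instruments_sq hiid hR hV hM0 hp).trans (ENNReal.ofReal_le_ofReal (by
      rw [div_le_iff₀ hM0]; linarith)))
    ((hN.design_sq hiid hR hCD hV hM0 hp).trans (ENNReal.ofReal_le_ofReal (by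
      rw [div_le_iff₀ hM0]; linarith)))
    (measure_exists_irrelevant_le n _ (fun j hj =>
      hN.eps_tail n _ _ (by positivity) (ha j hj) t ht) hunion)
    (measure_exists_irrelevant_le n _ (fun j hj =>
      hN.linearTerm_tail hR hτ _ (by positivity)
        (hR.sum_crossWeight_sq_le hCZ hB hb₁ hβ₁ (ha j hj)) ht) hunion)
    ?_ hrel hlasso
  · refine (measure_mono fun ω hω hall => ?_).trans hbad
    refine hω fun j => hall.sign_eq hR hcD hCD hCZ hB hM0 hξ0 hMT0 hb₁ hCc0 hlam hp hβ₁
      (fun j h => (hβ j h).1) hcomb hg₁ hg₂ hX hXb ?_ j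
    have e1 : A * √(n : ℝ) * t + (A' * √(n : ℝ) + (√(n : ℝ))⁻¹ * (A' * n / √τ * t)) =
        (2 * MT)⁻¹ * (S.lam n * r n) + A' * √(n : ℝ) := by
      have : (√(n : ℝ))⁻¹ * (A' * n / √τ * t) = A' / √τ * (√(n : ℝ) * t) := by
        rw [inv_mul_eq_iff_eq_mul₀ hs.ne']
        linear_combination -(A' / √τ * t) * Real.mul_self_sqrt hn.le
      rw [this, mul_assoc A, hst, ← hθA]
      ring
    have e2 : C * (S.lam n * √(S.k n : ℝ)) ≤ (4 * MT)⁻¹ * (S.lam n * r n) := by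
      rw [inv_mul_eq_div, le_div_iff₀ (by positivity)]
      have := mul_le_mul_of_nonneg_left hkr hlam.le
      linarith
    have e3 : (A' + C) * √(n : ℝ) ≤ (4 * MT)⁻¹ * (S.lam n * r n) := by
      rw [inv_mul_eq_div, le_div_iff₀ (by positivity)]
      linarith
    have e4 : S.lam n * (r n / MT) = (2 * MT)⁻¹ * (S.lam n * r n) +
        (4 * MT)⁻¹ * (S.lam n * r n) + (4 * MT)⁻¹ * (S.lam n * r n) := by
      field_simp; ring
    rw [e4]
    linarith
  · rw [← ofReal_measureReal]
    refine ENNReal.ofReal_le_ofReal (le_trans ?_ hirr)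
    refine measureReal_mono fun ω hω => ?_
    obtain ⟨j, hj, hlt⟩ := hω
    exact ⟨j, hj, (le_max_left _ _).trans_lt hlt⟩

end TwoStageModel

theorem theorem5 {Ω : Type*} [MeasurableSpace Ω] (P : Measure Ω) [IsProbabilityMeasure P]
    (S : TwoStageModel Ω) (d b₀ b₁ : ℝ) (r : ℕ → ℝ)
    (betaHat : (n : ℕ) → Ω → Fin (S.p n) → ℝ)
    (hk : ∀ᶠ n in atTop, 1 ≤ S.k n)
    (hm : ∀ᶠ n in atTop, 2 ≤ S.m n)
    (hmeas : S.MeasurableEstimators)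
    (hstd : S.StandardizedInstruments)
    (hZeig : S.FirstStageEigenvalues)
    (hα : S.FirstStageCoefficients)
    (hsel : S.FirstStageSelectionConsistent P)
    (horacle : S.FirstStageOracleEfficient P)
    (hiid : S.ErrorsIID P)
    (hsub : S.JointlySubGaussian P)
    (hd₁ : 1 ≤ d) (hd₂ : d ≤ 2)
    (htail : S.EpsTail P d)
    (hinit : S.ZeroConsistent P r b₁)
    (hβ : S.SecondStageCoefficients b₀ b₁)
    (hrates : S.Rates d r)
    (hdesign : S.SecondStageDesign)
    (hbdd : S.InstrumentsBoundedInProbability)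
    (hlasso : ∀ᶠ n in atTop, ∀ᵐ ω ∂P, S.IsAdaptiveLasso n ω (betaHat n ω)) :
    Tendsto (fun n => P {ω | ∀ j, SignType.sign (betaHat n ω j) = SignType.sign (S.β₀ n j)})
      atTop (𝓝 1) := by
  rw [ENNReal.tendsto_atTop ENNReal.one_ne_top]
  intro ε hε
  obtain ⟨η, hη, hηε⟩ : ∃ η : ℝ, 0 < η ∧ ENNReal.ofReal (9 * η) ≤ ε := by
    rcases eq_or_ne ε ⊤ with h | h
    · exact ⟨1, one_pos, h ▸ le_top⟩
    · refine ⟨ε.toReal / 9, div_pos (ENNReal.toReal_pos hε.ne' h) (by norm_num), ?_⟩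
      rw [mul_div_cancel₀ _ (by norm_num), ENNReal.ofReal_toReal h]
  obtain ⟨N, hN⟩ := eventually_atTop.1 (TwoStageModel.eventually_measure_not_sign_le hk hm hmeas
    hstd hZeig hα hsel horacle hiid hsub hd₁ hd₂ htail hinit hβ hrates hdesign hlasso hη)
  refine ⟨N, fun n hn => ⟨?_, prob_le_one.trans le_self_add⟩⟩
  rw [tsub_le_iff_right]
  set E := {ω | ∀ j, SignType.sign (betaHat n ω j) = SignType.sign (S.β₀ n j)} with hE
  -- The estimator `betaHat` is any selection of minimizers and need not be measurable, so
  -- subadditivity replaces the complement formula.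
  calc (1 : ENNReal) = P (E ∪ Eᶜ) := by rw [Set.union_compl_self, measure_univ]
    _ ≤ P E + P Eᶜ := measure_union_le _ _
    _ ≤ P E + ε := add_le_add_right ((hN n hn).trans hηε) _
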